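/- Let $M$ be a Coxeter graph of type $A_n$ ($n\ge 1$), $D_n$ ($n\ge 4$), $E_6$, $E_7$ or $E_8$, let $W$ be its Coxeter group with simple reflections $r_i$, $\Phi$ its root system (roots normalized by $(\alpha,\alpha)=2$) with simple roots $\alpha_i$ and positive roots $\Phi^+$, and write $r_\alpha\in W$ for the reflection of a root $\alpha$ and $\alpha\sim\beta$ for $|(\alpha,\beta)|=1$. $W$ acts on sets $B$ of mutually orthogonal positive roots by $wB=\Phi^+\cap\{\pm w\beta\mid\beta\in B\}$. Such a set $B$ is admissible if, whenever $\beta_1,\beta_2,\beta_3\in B$ are distinct and $\alpha\in\Phi$ satisfies $\alpha\sim\beta_i$ for $i=1,2,3$, the positive root among $\pm r_\alpha r_{\beta_1}r_{\beta_2}r_{\beta_3}\alpha$ lies in $B$. A $W$-orbit $\mathcal B$ of admissible sets is partially ordered by the reflexive transitive closure of the relations $B<r_iB$, which hold when $B\neq r_iB$ and the minimal height of a root in $B\setminus r_iB$ is smaller than that of a root in $r_iB\setminus B$. Let $X$ be an admissible set that is the highest element of its orbit $\mathcal B=WX$, let $C$ be the set of nodes $i$ with $\alpha_i\perp X$, and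 $W(C)=\langle r_i\mid i\in C\rangle$. The Brauer monoid $\mathrm{BrM}(M)$ is the monoid generated by $r_i$, $e_i$ ($i$ a node) and $\delta,\delta^{-1}$ subject to: $\delta$ is central and $\delta\delta^{-1}=1$; $r_i^2=1$, $e_ir_i=r_ie_i=e_i$, $e_i^2=\delta e_i$; for distinct non-adjacent $i,j$: $r_ir_j=r_jr_i$, $e_ir_j=r_je_i$, $e_ie_j=e_je_i$; for adjacent $i,j$: $r_ir_jr_i=r_jr_ir_j$, $r_je_ir_j=r_ie_jr_i$, $r_jr_ie_j=e_ie_j$. Its monoid algebra over $\mathbb Z$ is the Brauer algebra. For a positive root $\beta=w\alpha_i$ put $e_\beta=we_iw^{-1}$, and put $e_X=\prod_{\beta\in X}e_\beta$ (the factors commute). Let $$A_X=\{w\in W\mid we_X=e_X\},\quad N_X=\{w\in W\mid e_Xw=we_X\},\quad N_W(X)=\{w\in W\mid wX=X\}.$$ For $B\in\mathcal B$ and a node $i$ let $h_{B,i}\in W(C)$ be $1$ if $\alpha_i\not\perp B$, and for $\alpha_i\perp B$ let it be the simple reflection of $W(C)$ determined by $h_{X,i}=r_i$, by $h_{B,i}=h_{r_jB,i}$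 if $j\ne i$ is not adjacent to $i$ and $r_jB>B$, and by $h_{B,i}=h_{r_ir_jB,j}$ if $j$ is adjacent to $i$ and $r_ir_jB>r_jB>B$. Let $V$ be the free right $\mathbb Z[\delta^{\pm1}][W(C)]$-module with basis $(\xi_B)_{B\in\mathcal B}$. Then: (i) $N_X=N_W(X)$. (ii) $A_X$ is a normal subgroup of $N_X$. There is a unique right-linear representation $\rho$ of $W$ on $V$ with $\rho(r_i)\xi_B=\xi_{r_iB}h_{B,i}$ for all $i$ and $B$, and $A_X=K_X$, where $K_X=\{w\in W\mid \rho(w)\xi_X=\xi_X\}$. Moreover $A_X$ is the subgroup of $W$ generated by $$\{r_\beta\mid\beta\in X\}\cup\{r_\alpha r_\beta r_\gamma r_\alpha\mid\alpha\in\Phi^+,\ \beta,\gamma\in X,\ \beta\sim\alpha\sim\gamma\}.$$ (iii) $N_X$ is the semidirect product of its normal subgroup $A_X$ and its subgroup $W(C)$, that is, $N_X=A_X\rtimes W(C)$. -/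

import Mathlib

noncomputable section

namespace BrauerADE

set_option linter.unusedSectionVars false
set_option linter.unusedSimpArgs false

/-! ### Simply laced graphs, their Coxeter groups and root systems -/

section Roots

variable {ι : Type*} [Fintype ι] [DecidableEq ι] (G : SimpleGraph ι) [DecidableRel G.Adj]

/-- Gram matrix of the simple roots of the simply laced graph `G`: `2` on the diagonal,
`-1` for adjacent nodes, `0` otherwise. -/
def gram : Matrix ι ι ℤ := Matrix.of fun i j => if i = j then 2 else if G.Adj i j then -1 else 0

/-- `G` is one of the Coxeter graphs `A_n` (`n ≥ 1`), `D_n` (`n ≥ 4`), `E_6`, `E_7`, `E_8`,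
up to a relabelling of its nodes. -/
def IsADE : Prop :=
  (∃ n : ℕ, 1 ≤ n ∧ ∃ f : ι ≃ Fin n, gram G = (CartanMatrix.A n).submatrix f f) ∨
  (∃ n : ℕ, 4 ≤ n ∧ ∃ f : ι ≃ Fin n, gram G = (CartanMatrix.D n).submatrix f f) ∨
  (∃ f : ι ≃ Fin 6, gram G = CartanMatrix.E₆.submatrix f f) ∨
  (∃ f : ι ≃ Fin 7, gram G = CartanMatrix.E₇.submatrix f f) ∨
  (∃ f : ι ≃ Fin 8, gram G = CartanMatrix.E₈.submatrix f f)

/-- The Coxeter matrix of `G`: `m = 3` for adjacent nodes, `m = 2` for distinct non-adjacent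
nodes. -/
def coxMat : CoxeterMatrix ι where
  M := Matrix.of fun i j => if i = j then 1 else if G.Adj i j then 3 else 2
  isSymm := by
    ext i j
    simp only [Matrix.transpose_apply, Matrix.of_apply, eq_comm (a := j), G.adj_comm j i]
  diagonal i := by simp
  off_diagonal i j h := by
    simp only [Matrix.of_apply, if_neg h]
    split_ifs <;> decide

theorem coxMat_apply (i j : ι) :
    (coxMat G) i j = if i = j then 1 else if G.Adj i j then 3 else 2 := rfl

/-- The Coxeter group `W` of type `G`. -/
abbrev W : Type _ := (coxMat G).Group

/-- The simple reflection `r_i ∈ W`. -/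
def s (i : ι) : W G := (coxMat G).simple i

/-- The symmetric bilinear form on the root lattice `ℤ^ι`, whose standard basis is the basis
of simple roots. -/
def form : LinearMap.BilinForm ℤ (ι → ℤ) := Matrix.toBilin' (gram G)

/-- The simple root `α_i`. -/
def simpleRoot (i : ι) : ι → ℤ := Pi.single i 1

/-- The linear map `x ↦ x - (x, α) α`; for a root `α` this is the reflection in `α`. -/
def refl (α : ι → ℤ) : Module.End ℤ (ι → ℤ) :=
  LinearMap.id - ((form G).flip α).smulRight α

theorem refl_apply (α x : ι → ℤ) : refl G α x = x - form G x α • α := by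
  simp [refl]

theorem form_simple (i j : ι) : form G (simpleRoot i) (simpleRoot j) = gram G i j := by
  simp [form, simpleRoot, Matrix.toBilin'_single]

theorem refl_liftable : (coxMat G).IsLiftable (fun i => refl G (simpleRoot i)) := by
  intro i j
  have hij : form G (simpleRoot i) (simpleRoot j) =
      if i = j then 2 else if G.Adj i j then -1 else 0 := form_simple G i j
  have hji : form G (simpleRoot j) (simpleRoot i) =
      if i = j then 2 else if G.Adj i j then -1 else 0 := by
    rw [form_simple, gram, Matrix.of_apply]
    simp only [eq_comm (a := j), G.adj_comm j i]
  have hii : form G (simpleRoot i) (simpleRoot i) = 2 := by simp [form_simple, gram]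
  have hjj : form G (simpleRoot j) (simpleRoot j) = 2 := by simp [form_simple, gram]
  rw [coxMat_apply]
  refine LinearMap.ext fun x => ?_
  by_cases h : i = j
  · subst h
    simp only [if_true, pow_one, Module.End.mul_apply, refl_apply, map_sub, map_smul,
      LinearMap.sub_apply, LinearMap.smul_apply, hii, smul_eq_mul, Module.End.one_apply]
    module
  · simp only [if_neg h] at *
    by_cases ha : G.Adj i j
    · simp only [if_pos ha] at *
      simp only [pow_succ, pow_zero, one_mul, Module.End.mul_apply, refl_apply, map_sub, map_smul,
        LinearMap.sub_apply, LinearMap.smul_apply, hii, hij, hji, hjj, smul_eq_mul,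
        Module.End.one_apply]
      module
    · simp only [if_neg ha] at *
      simp only [pow_succ, pow_zero, one_mul, Module.End.mul_apply, refl_apply, map_sub, map_smul,
        LinearMap.sub_apply, LinearMap.smul_apply, hii, hij, hji, hjj, smul_eq_mul,
        Module.End.one_apply]
      module

/-- The action of `W` on the root lattice, in which `r_i` acts as the reflection in `α_i`. -/
def geom : W G →* Module.End ℤ (ι → ℤ) :=
  (coxMat G).toCoxeterSystem.lift ⟨_, refl_liftable G⟩

/-- The root system `Φ`: the images of the simple roots under `W`. -/
def roots : Set (ι → ℤ) := {α | ∃ (w : W G) (i : ι), geom G w (simpleRoot i) = α}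

/-- The positive roots `Φ⁺`: the roots that are nonnegative combinations of simple roots. -/
def posRoots : Set (ι → ℤ) := {α | α ∈ roots G ∧ ∀ i, 0 ≤ α i}

/-- `α ∼ β`, that is, `|(α, β)| = 1`. -/
def Joined (α β : ι → ℤ) : Prop := |form G α β| = 1

open Classical in
/-- The reflection `r_α ∈ W` of a root `α`: if `α = w α_i`, then `r_α = w r_i w⁻¹`
(which does not depend on the choice of `w` and `i`). -/
def rootRefl (α : ι → ℤ) : W G :=
  if h : ∃ p : W G × ι, geom G p.1 (simpleRoot p.2) = α then
    h.choose.1 * s G h.choose.2 * h.choose.1⁻¹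
  else 1

/-- The positive one among `α` and `-α`, for a root `α`. -/
def posRep (α : ι → ℤ) : ι → ℤ := if ∀ i, 0 ≤ α i then α else -α

/-- The height of a root: the sum of its coefficients on the simple roots. -/
def height (α : ι → ℤ) : ℤ := ∑ i, α i

/-! ### Admissible sets, their `W`-orbits and the partial order -/

/-- `B` is a set of mutually orthogonal positive roots. -/
def IsOrthoSet (B : Finset (ι → ℤ)) : Prop :=
  (∀ β ∈ B, β ∈ posRoots G) ∧ ∀ β ∈ B, ∀ γ ∈ B, β ≠ γ → form G β γ = 0

/-- Admissible sets of mutually orthogonal positive roots: if a root `α` is joined to three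
distinct `β₁, β₂, β₃ ∈ B`, then the positive root among `± r_α r_β₁ r_β₂ r_β₃ α` lies in `B`. -/
def IsAdmissible (B : Finset (ι → ℤ)) : Prop :=
  IsOrthoSet G B ∧
  ∀ β₁ ∈ B, ∀ β₂ ∈ B, ∀ β₃ ∈ B, β₁ ≠ β₂ → β₁ ≠ β₃ → β₂ ≠ β₃ →
    ∀ α ∈ roots G, Joined G α β₁ → Joined G α β₂ → Joined G α β₃ →
      posRep (refl G α (refl G β₁ (refl G β₂ (refl G β₃ α)))) ∈ B

/-- The action of `w ∈ W` on sets of mutually orthogonal positive roots: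
`wB = Φ⁺ ∩ {± w β | β ∈ B}`. -/
def act (w : W G) (B : Finset (ι → ℤ)) : Finset (ι → ℤ) :=
  B.image fun β => posRep (geom G w β)

/-- The `W`-orbit of `X`. -/
def orbit (X : Finset (ι → ℤ)) : Set (Finset (ι → ℤ)) := {B | ∃ w : W G, act G w X = B}

/-- `r_i B > B` in the poset: the minimal height of a root in `B \ r_i B` is smaller than the
minimal height of a root in `r_i B \ B`. -/
def Raises (i : ι) (B : Finset (ι → ℤ)) : Prop :=
  ∃ β ∈ B \ act G (s G i) B, ∀ γ ∈ act G (s G i) B \ B, height β < height γ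

/-- The partial order on a `W`-orbit of admissible sets: the reflexive transitive closure of
the relations `B < r_i B`. -/
def le : Finset (ι → ℤ) → Finset (ι → ℤ) → Prop :=
  Relation.ReflTransGen fun B B' => ∃ i, Raises G i B ∧ B' = act G (s G i) B

/-- `X` is the highest element of its `W`-orbit. -/
def IsHighest (X : Finset (ι → ℤ)) : Prop := ∀ B ∈ orbit G X, le G B X

/-- `N_W(X)`, the set stabilizer of `X` in `W`. -/
def setStab (X : Finset (ι → ℤ)) : Set (W G) := {w | act G w X = X}

/-- `α_i ⊥ B`. -/
def Perp (i : ι) (B : Finset (ι → ℤ)) : Prop := ∀ β ∈ B, form G (simpleRoot i) β = 0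

/-- The set `C` of nodes `i` with `α_i ⊥ X`. -/
def nodesC (X : Finset (ι → ℤ)) : Set ι := {i | Perp G i X}

/-- The parabolic subgroup `W(C)` of `W` generated by the `r_i`, `i ∈ C`. -/
def WC (X : Finset (ι → ℤ)) : Subgroup (W G) := Subgroup.closure (s G '' nodesC G X)

/-! ### The linear representation attached to the orbit of `X` -/

/-- `HNode G X B i k` says that the simple reflection `h_{B,i}` of `W(C)`, for `B` in the orbit
of the highest element `X` and `α_i ⊥ B`, is `r_k`. The elements `h_{B,i}` are determined by
downward recursion in the poset from `h_{X,i} = r_i` by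
`h_{B,i} = h_{r_j B, i}` if `j ≁ i` and `r_j B > B`, and
`h_{B,i} = h_{r_i r_j B, j}` if `j ∼ i` and `r_i r_j B > r_j B > B`. -/
inductive HNode (X : Finset (ι → ℤ)) : Finset (ι → ℤ) → ι → ι → Prop
  | base (i : ι) : Perp G i X → HNode X X i i
  | comm (B : Finset (ι → ℤ)) (i j k : ι) : Perp G i B → i ≠ j → ¬ G.Adj i j → Raises G j B →
      HNode X (act G (s G j) B) i k → HNode X B i k
  | braid (B : Finset (ι → ℤ)) (i j k : ι) : Perp G i B → G.Adj i j → Raises G j B →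
      Raises G i (act G (s G j) B) →
      HNode X (act G (s G i) (act G (s G j) B)) j k → HNode X B i k

open Classical in
/-- The element `h_{B,i} ∈ W(C)`; it is `1` if `α_i` is not orthogonal to `B`. -/
def hElt (X B : Finset (ι → ℤ)) (i : ι) : WC G X :=
  if h : ∃ k : nodesC G X, HNode G X B i k then
    ⟨s G h.choose, Subgroup.subset_closure ⟨h.choose, h.choose.2, rfl⟩⟩
  else 1

/-- The coefficient ring `ℤ[δ^{±1}][W(C)]`. -/
abbrev Coeff (X : Finset (ι → ℤ)) : Type _ :=
  MonoidAlgebra (LaurentPolynomial ℤ) (WC G X)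

/-- The free right `ℤ[δ^{±1}][W(C)]`-module `V` with basis `ξ_B`, `B` in the orbit of `X`. -/
abbrev VMod (X : Finset (ι → ℤ)) : Type _ := orbit G X →₀ Coeff G X

/-- The basis vector `ξ_B`. -/
def xi (X : Finset (ι → ℤ)) (B : orbit G X) : VMod G X := Finsupp.single B 1

/-- `ρ` is a representation of `W` by (right-linear) endomorphisms of `V` with
`ρ(r_i) ξ_B = ξ_{r_i B} h_{B,i}` for all nodes `i` and all `B` in the orbit. -/
def IsRho (X : Finset (ι → ℤ)) (ρ : W G →* Module.End (Coeff G X)ᵐᵒᵖ (VMod G X)) : Prop :=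
  ∀ (i : ι) (B B' : orbit G X), (B' : Finset (ι → ℤ)) = act G (s G i) B →
    ρ (s G i) (xi G X B) =
      MulOpposite.op (MonoidAlgebra.of (LaurentPolynomial ℤ) (WC G X) (hElt G X B i)) • xi G X B'

theorem self_mem_orbit {X : Finset (ι → ℤ)} (hX : IsOrthoSet G X) : X ∈ orbit G X := by
  refine ⟨1, ?_⟩
  have h : ∀ β ∈ X, posRep (geom G 1 β) = id β := fun β hβ => by
    simp [posRep, (hX.1 β hβ).2]
  rw [act, Finset.image_congr h, Finset.image_id]

/-- `K_X = {w ∈ W | w ξ_X = ξ_X}`. -/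
def kernelK {X : Finset (ι → ℤ)} (hX : IsOrthoSet G X)
    (ρ : W G →* Module.End (Coeff G X)ᵐᵒᵖ (VMod G X)) : Set (W G) :=
  {w | ρ w (xi G X ⟨X, self_mem_orbit G hX⟩) = xi G X ⟨X, self_mem_orbit G hX⟩}

end Roots

/-! ### The Brauer monoid -/

/-- Generators of the Brauer monoid. -/
inductive Gen (ι : Type*)
  | r (i : ι)
  | e (i : ι)
  | delta
  | deltaInv

section Brauer

variable {ι : Type*} [Fintype ι] [DecidableEq ι] (G : SimpleGraph ι) [DecidableRel G.Adj]

/-- `gr i` is the generator `r_i` as a word. -/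
abbrev gr (i : ι) : FreeMonoid (Gen ι) := FreeMonoid.of (Gen.r i)

/-- `ge i` is the generator `e_i` as a word. -/
abbrev ge (i : ι) : FreeMonoid (Gen ι) := FreeMonoid.of (Gen.e i)

/-- The generator `δ` as a word. -/
abbrev gd : FreeMonoid (Gen ι) := FreeMonoid.of Gen.delta

/-- The generator `δ⁻¹` as a word. -/
abbrev gdi : FreeMonoid (Gen ι) := FreeMonoid.of Gen.deltaInv

/-- The defining relations of the Brauer monoid of type `G`. -/
inductive BrRel : FreeMonoid (Gen ι) → FreeMonoid (Gen ι) → Prop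
  | delta_central (g : Gen ι) : BrRel (gd * FreeMonoid.of g) (FreeMonoid.of g * gd)
  | delta_inv : BrRel (gd * gdi) 1
  | rSrr (i : ι) : BrRel (gr i * gr i) 1
  | rSer (i : ι) : BrRel (ge i * gr i) (ge i)
  | rSre (i : ι) : BrRel (gr i * ge i) (ge i)
  | hSee (i : ι) : BrRel (ge i * ge i) (gd * ge i)
  | hCrr (i j : ι) : i ≠ j → ¬ G.Adj i j → BrRel (gr i * gr j) (gr j * gr i)
  | hCer (i j : ι) : i ≠ j → ¬ G.Adj i j → BrRel (ge i * gr j) (gr j * ge i)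
  | hCee (i j : ι) : i ≠ j → ¬ G.Adj i j → BrRel (ge i * ge j) (ge j * ge i)
  | hNrrr (i j : ι) : G.Adj i j → BrRel (gr i * gr j * gr i) (gr j * gr i * gr j)
  | hNrer (i j : ι) : G.Adj i j → BrRel (gr j * ge i * gr j) (gr i * ge j * gr i)
  | rNrre (i j : ι) : G.Adj i j → BrRel (gr j * gr i * ge j) (ge i * ge j)

/-- The Brauer monoid of type `G`. The Brauer algebra is the monoid algebra `ℤ[BrM]`, which
contains `BrM` as a basis, so identities between monomials of the algebra are identities
in `BrM`. -/
abbrev BrM : Type _ := PresentedMonoid (BrRel G)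

/-- The element `r_i` of the Brauer monoid. -/
def rBr (i : ι) : BrM G := PresentedMonoid.of (BrRel G) (Gen.r i)

/-- The element `e_i` of the Brauer monoid. -/
def eBr (i : ι) : BrM G := PresentedMonoid.of (BrRel G) (Gen.e i)

theorem rBr_sq (i : ι) : rBr G i * rBr G i = 1 :=
  PresentedMonoid.mk_eq_mk_of_rel (BrRel.rSrr i)

theorem rBr_comm (i j : ι) (h : i ≠ j) (h' : ¬ G.Adj i j) :
    rBr G i * rBr G j = rBr G j * rBr G i :=
  PresentedMonoid.mk_eq_mk_of_rel (BrRel.hCrr i j h h')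

theorem rBr_braid (i j : ι) (h : G.Adj i j) :
    rBr G i * rBr G j * rBr G i = rBr G j * rBr G i * rBr G j :=
  PresentedMonoid.mk_eq_mk_of_rel (BrRel.hNrrr i j h)

theorem rBr_liftable : (coxMat G).IsLiftable (rBr G) := by
  intro i j
  rw [coxMat_apply]
  by_cases h : i = j
  · subst h
    simp [rBr_sq]
  · rw [if_neg h]
    by_cases ha : G.Adj i j
    · rw [if_pos ha]
      calc (rBr G i * rBr G j) ^ 3
          = (rBr G i * rBr G j * rBr G i) * (rBr G j * rBr G i * rBr G j) := by
            simp only [pow_succ, pow_zero, one_mul, mul_assoc]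
        _ = (rBr G j * rBr G i) * (rBr G j * rBr G j) * (rBr G i * rBr G j) := by
            rw [rBr_braid G i j ha]
            simp only [mul_assoc]
        _ = rBr G j * (rBr G i * rBr G i) * rBr G j := by
            rw [rBr_sq, mul_one]
            simp only [mul_assoc]
        _ = 1 := by rw [rBr_sq, mul_one, rBr_sq]
    · rw [if_neg ha, pow_two]
      calc rBr G i * rBr G j * (rBr G i * rBr G j)
          = rBr G i * rBr G j * (rBr G j * rBr G i) := by rw [rBr_comm G i j h ha]
        _ = rBr G i * (rBr G j * rBr G j) * rBr G i := by simp only [mul_assoc]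
        _ = 1 := by rw [rBr_sq, mul_one, rBr_sq]

/-- The homomorphism from `W` to the Brauer monoid that sends `r_i` to `r_i`. -/
def toBr : W G →* BrM G := (coxMat G).toCoxeterSystem.lift ⟨_, rBr_liftable G⟩

open Classical in
/-- The element `e_β` of the Brauer monoid, for a root `β`: if `β = w α_i`, then
`e_β = w e_i w⁻¹` (which does not depend on the choice of `w` and `i`). -/
def eRoot (β : ι → ℤ) : BrM G :=
  if h : ∃ p : W G × ι, geom G p.1 (simpleRoot p.2) = β then
    toBr G h.choose.1 * eBr G h.choose.2 * toBr G h.choose.1⁻¹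
  else 1

/-- `e_B = ∏_{β ∈ B} e_β` for a set `B` of mutually orthogonal positive roots; the factors
commute, so the chosen enumeration of `B` is immaterial. -/
def eSet (B : Finset (ι → ℤ)) : BrM G := (B.toList.map (eRoot G)).prod

/-- The annihilator `A_X = {w ∈ W | w e_X = e_X}`. -/
def annihilator (X : Finset (ι → ℤ)) : Subgroup (W G) where
  carrier := {w | toBr G w * eSet G X = eSet G X}
  one_mem' := by simp
  mul_mem' {a b} ha hb := by
    simp only [Set.mem_ofPred_eq, map_mul, mul_assoc] at *
    rw [hb, ha]
  inv_mem' {a} ha := by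
    simp only [Set.mem_ofPred_eq] at *
    conv_lhs => rw [← ha]
    rw [← mul_assoc, ← map_mul, inv_mul_cancel, map_one, one_mul]

/-- The centralizer `N_X = {w ∈ W | e_X w = w e_X}`. -/
def centralizerN (X : Finset (ι → ℤ)) : Subgroup (W G) where
  carrier := {w | eSet G X * toBr G w = toBr G w * eSet G X}
  one_mem' := by simp
  mul_mem' {a b} ha hb := by
    simp only [Set.mem_ofPred_eq, map_mul] at *
    rw [← mul_assoc, ha, mul_assoc, hb, mul_assoc]
  inv_mem' {a} ha := by
    simp only [Set.mem_ofPred_eq] at *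
    have h1 : toBr G a⁻¹ * toBr G a = 1 := by rw [← map_mul, inv_mul_cancel, map_one]
    have h2 : toBr G a * toBr G a⁻¹ = 1 := by rw [← map_mul, mul_inv_cancel, map_one]
    calc eSet G X * toBr G a⁻¹
        = toBr G a⁻¹ * toBr G a * eSet G X * toBr G a⁻¹ := by rw [h1, one_mul]
      _ = toBr G a⁻¹ * (eSet G X * toBr G a) * toBr G a⁻¹ := by rw [ha]; simp only [mul_assoc]
      _ = toBr G a⁻¹ * eSet G X * (toBr G a * toBr G a⁻¹) := by simp only [mul_assoc]
      _ = toBr G a⁻¹ * eSet G X := by rw [h2, mul_one]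

/-- The elements `r_β` (`β ∈ X`) and `r_α r_β r_γ r_α` (`α ∈ Φ⁺`, `β, γ ∈ X`, `β ∼ α ∼ γ`)
of `W`. -/
def annGens (X : Finset (ι → ℤ)) : Set (W G) :=
  {g | ∃ β ∈ X, g = rootRefl G β} ∪
  {g | ∃ α ∈ posRoots G, ∃ β ∈ X, ∃ γ ∈ X, Joined G β α ∧ Joined G α γ ∧
    g = rootRefl G α * rootRefl G β * rootRefl G γ * rootRefl G α}

end Brauer

end BrauerADE

end

noncomputable section

namespace BrauerADE

set_option linter.unusedSectionVars false
set_option linter.unusedSimpArgs false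

variable {ι : Type*} [Fintype ι] [DecidableEq ι] {G : SimpleGraph ι} [DecidableRel G.Adj]

/-! ### Positive definiteness of the root lattice -/

/-! Let `K` be the subgroup generated by `annGens G X` (`annGrp`). Everything follows once `K`
equals both `A_X` and `K_X`, and `N_W(X)` equals both `N_X` and `K W(C)`, with `K ∩ W(C) = 1`.

Two tools serve throughout. The form is positive definite, so non-proportional roots have inner
product `-1`, `0` or `1`. Moreover two such roots are, up to signs, conjugate to a pair of simple
roots (`exists_simple_pair_of_roots`), so the defining relations of the Brauer monoid that are
needed hold for `r_β` and `e_β` of arbitrary roots.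

The orbit is treated as a rewriting system. Raising terminates (`exists_rank`), and two raises of
the same `B` close up to a diamond (`Raises.diamond`) or a hexagon (`Raises.hexagon`). The only
exception is `r_i B = r_j B` with `β` and `β + α_i + α_j` both in `B`, where admissibility forces
the coincidence. Induction in the style of Newman's lemma then shows that `h_{B,i}` is well defined
(`existsUnique_hNode`), and that two raising paths from `B` to `X` differ by an element of the group
attached to `B`; the exceptional diamonds account for generators `r_α r_β r_γ r_α`. If `h_{B,i} =
r_k`, some raising path `w` satisfies `r_i = w r_k w⁻¹`. Hence walking along any edge of the orbit
changes a path only by elements of `K` and `W(C)`, and the stabilizer of `X` is `K W(C)`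
(`exists_mul_of_mem_setStab`).

For `ρ` to exist, the `h_{B,i}` must satisfy Coxeter relations in `W(C)`. The reason is a
congruence: `K` preserves modulo two the inner products of vectors that have even inner product with
every element of `X` (`even_form_geom_sub`). So adjacent nodes at `B` go to adjacent nodes of `C`,
and non-adjacent ones to commuting reflections. The generators of `K` fix `ξ_X`, because they are
conjugate to products of simple reflections whose `h`-factors are `1`; on the other hand `W(C)` acts
on `ξ_X` by left multiplication of the coefficient. Hence `K_X = K` and `K ∩ W(C) = 1`.

On the Brauer side, `K ≤ A_X` follows from `r_γ r_α e_γ = e_α e_γ`. Conversely the monoid acts on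
the cosets `W/K` with an absorbing point adjoined (`brAct`): `e_β` fixes a coset whose set contains
`±β`, multiplies it by `r_γ r_β` if `β` is joined to `γ` in its set, and kills it if `β` is
orthogonal to its set. The one hard relation is the commutation of `e_α` and `e_β` for `α ⊥ β`
(`eAct_comm`). The element `e_X` fixes the base coset, so `A_X` fixes it too and lies in `K`. Every
coset in the image of `e_X` has a set containing `X`, so commuting with `e_X` forces `wX = X`. -/

/-- The form on the root lattice of `G` is positive definite. -/
def FormPosDef (G : SimpleGraph ι) [DecidableRel G.Adj] : Prop :=
  ∀ x : ι → ℤ, x ≠ 0 → 0 < form G x x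

/-- A square integer matrix is positive definite. -/
def IntPosDef {κ : Type*} [Fintype κ] (M : Matrix κ κ ℤ) : Prop :=
  ∀ x : κ → ℤ, x ≠ 0 → 0 < ∑ i, ∑ j, x i * M i j * x j

theorem form_apply (x y : ι → ℤ) : form G x y = ∑ i, ∑ j, x i * gram G i j * y j := by
  simp [form, Matrix.toBilin'_apply]

theorem formPosDef_of_submatrix {κ : Type*} [Fintype κ] {M : Matrix κ κ ℤ} (hM : IntPosDef M)
    (f : ι ≃ κ) (h : gram G = M.submatrix f f) : FormPosDef G := by
  intro x hx
  have h1 : (fun k => x (f.symm k)) ≠ 0 := by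
    intro h0
    apply hx
    funext i
    simpa using congrFun h0 (f i)
  have h2 := hM _ h1
  rw [form_apply, h, ← Equiv.sum_comp f.symm]
  refine h2.trans_eq (Finset.sum_congr rfl fun k _ => ?_)
  rw [← Equiv.sum_comp f.symm]
  simp

/-- A Gram matrix of linearly independent integer vectors has a quadratic form that is a sum of
squares, vanishing only at zero. -/
theorem intPosDef_of_vectors {κ μ : Type*} [Fintype κ] [Fintype μ] {M : Matrix κ κ ℤ}
    (v : κ → μ → ℤ) (hM : ∀ i j, M i j = ∑ k, v i k * v j k)
    (hv : ∀ x : κ → ℤ, (∀ k, ∑ i, x i * v i k = 0) → x = 0) : IntPosDef M := by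
  intro x hx
  have key : ∑ i, ∑ j, x i * M i j * x j = ∑ k, (∑ i, x i * v i k) ^ 2 := by
    simp only [hM, pow_two, Finset.mul_sum, Finset.sum_mul]
    rw [Finset.sum_comm' (t' := Finset.univ) (s' := fun _ => Finset.univ) (by simp)]
    rw [Finset.sum_comm]
    conv_rhs => rw [Finset.sum_comm]
    refine Finset.sum_congr rfl fun i _ => ?_
    conv_rhs => rw [Finset.sum_comm]
    refine Finset.sum_congr rfl fun j _ => Finset.sum_congr rfl fun k _ => by ring
  rw [key]
  by_contra hneg
  refine hx (hv x fun k => ?_)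
  have h0 : ∑ k, (∑ i, x i * v i k) ^ 2 = 0 :=
    le_antisymm (not_lt.1 hneg) (Finset.sum_nonneg fun _ _ => sq_nonneg _)
  have := (Finset.sum_eq_zero_iff_of_nonneg (fun _ _ => sq_nonneg _)).1 h0 k (Finset.mem_univ k)
  exact pow_eq_zero_iff (two_ne_zero) |>.1 this

/-- The vectors are the usual `e_i - e_{i+1}`. Coordinate `j` of a combination involves only the
coefficients `j` and `j - 1`, so independence is triangular. -/
theorem intPosDef_A (n : ℕ) : IntPosDef (CartanMatrix.A n) := by
  refine intPosDef_of_vectors (μ := Fin (n + 1))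
    (fun i k => (if k = i.castSucc then 1 else 0) - (if k = i.succ then 1 else 0)) ?_ ?_
  · intro i j
    simp only [mul_sub, mul_ite, mul_one, mul_zero,
      Finset.sum_sub_distrib, Finset.sum_ite_eq', Finset.mem_univ, if_true]
    simp only [CartanMatrix.A, Matrix.of_apply, Fin.ext_iff, Fin.val_castSucc, Fin.val_succ]
    grind
  · intro x hx
    funext j
    induction j using WellFoundedLT.induction with
    | _ j ih =>
      have h := hx j.castSucc
      rw [Finset.sum_eq_single j] at h
      · simpa [Fin.ext_iff] using h
      · intro i _ hij
        rcases lt_or_gt_of_ne hij with h1 | h1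
        · simp [ih i h1]
        · have : (j : ℕ) < i := h1
          simp only [Fin.ext_iff, Fin.val_castSucc, Fin.val_succ]
          rw [if_neg (by omega), if_neg (by omega)]
          simp
      · simp

/-- The vectors are `e_i - e_{i+1}` for `i < n - 1` and `e_{n-2} + e_{n-1}` for the last node. The
truncations by `min` let one formula cover both kinds. -/
theorem intPosDef_D (n : ℕ) (hn : 4 ≤ n) : IntPosDef (CartanMatrix.D n) := by
  obtain ⟨m, rfl⟩ : ∃ m, n = m + 4 := ⟨n - 4, by omega⟩
  have hp (i : Fin (m + 4)) : min ((i : ℕ)) (m + 2) < m + 4 := by omega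
  have hq (i : Fin (m + 4)) : min ((i : ℕ) + 1) (m + 3) < m + 4 := by omega
  set p : Fin (m + 4) → Fin (m + 4) := fun i => ⟨min (i : ℕ) (m + 2), hp i⟩ with hpdef
  set q : Fin (m + 4) → Fin (m + 4) := fun i => ⟨min ((i : ℕ) + 1) (m + 3), hq i⟩ with hqdef
  refine intPosDef_of_vectors (μ := Fin (m + 4))
    (fun i k => (if k = p i then 1 else 0)
      + (if k = q i then (if (i : ℕ) = m + 3 then 1 else -1) else 0)) ?_ ?_
  · intro i j
    simp only [mul_add, mul_ite, mul_one, mul_neg, mul_zero,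
      Finset.sum_add_distrib, Finset.sum_ite_eq', Finset.mem_univ, if_true]
    have hi := i.2
    have hj := j.2
    simp only [CartanMatrix.D, Matrix.of_apply, Fin.ext_iff, hpdef, hqdef]
    clear_value p q
    clear hp hq hpdef hqdef
    split_ifs <;> first | rfl | (exfalso; omega)
  · intro x hx
    have hlt : ∀ k : ℕ, ∀ j : Fin (m + 4), (j : ℕ) = k → k < m + 2 → x j = 0 := by
      intro k
      induction k using Nat.strong_induction_on with
      | _ k ih =>
        intro j hj hk
        have h := hx j
        rw [Finset.sum_eq_single j] at h
        · have h1 : j = p j := by simp only [Fin.ext_iff, hpdef]; omega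
          have h2 : ¬ j = q j := by simp only [Fin.ext_iff, hqdef]; omega
          rw [if_pos h1, if_neg h2] at h
          simpa using h
        · intro i _ hij
          by_cases h1 : (i : ℕ) < j
          · rw [ih i (by omega) i rfl (by omega), zero_mul]
          · have h2 : ¬ j = p i := by
              simp only [Fin.ext_iff, hpdef] at hij ⊢; omega
            have h3 : ¬ j = q i := by
              simp only [Fin.ext_iff, hqdef] at hij ⊢; omega
            rw [if_neg h2, if_neg h3]
            simp
        · simp
    -- Only two nodes are left. Their coordinates give `x_a + x_b = 0` and `x_b - x_a = 0`.
    set a : Fin (m + 4) := ⟨m + 2, by omega⟩ with ha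
    set b : Fin (m + 4) := ⟨m + 3, by omega⟩ with hb
    have hab : a ≠ b := by simp [Fin.ext_iff, ha, hb]
    have hsum (k : Fin (m + 4)) := hx k
    have hred (f : Fin (m + 4) → ℤ) : ∑ i, x i * f i = x a * f a + x b * f b := by
      rw [← Finset.sum_subset (Finset.subset_univ {a, b}), Finset.sum_pair hab]
      intro i _ hi
      simp only [Finset.mem_insert, Finset.mem_singleton, not_or, Fin.ext_iff, ha, hb] at hi
      rw [hlt i i rfl (by have := i.2; omega), zero_mul]
    have h1 := hx a
    have h2 := hx b
    rw [hred] at h1 h2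
    have e1 : a = p a := by simp [Fin.ext_iff, hpdef, ha]
    have e2 : a = p b := by simp [Fin.ext_iff, hpdef, ha, hb]
    have e3 : b = q a := by simp [Fin.ext_iff, hqdef, ha, hb]
    have e4 : b = q b := by simp [Fin.ext_iff, hqdef, hb]
    rw [← e1, ← e2, ← e3, ← e4] at h1 h2
    simp only [hab, hab.symm, if_true, if_false, ha, hb] at h1 h2
    norm_num at h1 h2
    funext j
    by_cases hj : (j : ℕ) < m + 2
    · exact hlt j j rfl hj
    · by_cases hj2 : (j : ℕ) = m + 2
      · have : j = a := Fin.ext hj2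
        rw [this]
        simp only [Pi.zero_apply, ha]
        linarith
      · have : j = b := Fin.ext (by have := j.2; simp only [hb]; omega)
        rw [this]
        simp only [Pi.zero_apply, hb]
        linarith

/-- The squares are completed along the three arms from their ends towards the branch node `3`. The
factor `60` clears denominators, and `2 x_3²` is what remains at the branch node. -/
theorem intPosDef_E8 : IntPosDef CartanMatrix.E₈ := by
  intro x hx
  have key : 60 * (∑ i, ∑ j, x i * CartanMatrix.E₈ i j * x j) =
      30 * (2 * x 0 - x 2) ^ 2 + 10 * (3 * x 2 - 2 * x 3) ^ 2 + 30 * (2 * x 1 - x 3) ^ 2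
      + 30 * (2 * x 7 - x 6) ^ 2 + 10 * (3 * x 6 - 2 * x 5) ^ 2 + 5 * (4 * x 5 - 3 * x 4) ^ 2
      + 3 * (5 * x 4 - 4 * x 3) ^ 2 + 2 * x 3 ^ 2 := by
    simp [Fin.sum_univ_succ, CartanMatrix.E₈, Fin.succ]
    ring
  by_contra hneg
  have hs (a : ℤ) : 0 ≤ a ^ 2 := sq_nonneg a
  have hz {a : ℤ} (h : a ^ 2 ≤ 0) : a = 0 := by
    have := le_antisymm h (sq_nonneg a)
    exact pow_eq_zero_iff two_ne_zero |>.1 this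
  have g1 := hs (2 * x 0 - x 2)
  have g2 := hs (3 * x 2 - 2 * x 3)
  have g3 := hs (2 * x 1 - x 3)
  have g4 := hs (2 * x 7 - x 6)
  have g5 := hs (3 * x 6 - 2 * x 5)
  have g6 := hs (4 * x 5 - 3 * x 4)
  have g7 := hs (5 * x 4 - 4 * x 3)
  have g8 := hs (x 3)
  have f1 := hz (a := 2 * x 0 - x 2) (by linarith)
  have f2 := hz (a := 3 * x 2 - 2 * x 3) (by linarith)
  have f3 := hz (a := 2 * x 1 - x 3) (by linarith)
  have f4 := hz (a := 2 * x 7 - x 6) (by linarith)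
  have f5 := hz (a := 3 * x 6 - 2 * x 5) (by linarith)
  have f6 := hz (a := 4 * x 5 - 3 * x 4) (by linarith)
  have f7 := hz (a := 5 * x 4 - 4 * x 3) (by linarith)
  have f8 := hz (a := x 3) (by linarith)
  apply hx
  funext i
  simp only [Pi.zero_apply]
  fin_cases i <;> simp <;> omega

/-- Vectors are extended by zero to the larger index set. This reduces `E₆` and `E₇` to `E₈`, of
which they are leading blocks. -/
theorem intPosDef_of_castLE {m n : ℕ} (h : m ≤ n) {M : Matrix (Fin m) (Fin m) ℤ}
    {N : Matrix (Fin n) (Fin n) ℤ} (hN : IntPosDef N)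
    (hMN : ∀ i j, M i j = N (Fin.castLE h i) (Fin.castLE h j)) : IntPosDef M := by
  intro x hx
  set y : Fin n → ℤ := fun i => if hi : (i : ℕ) < m then x ⟨i, hi⟩ else 0 with hy
  have hyx (i : Fin m) : y (Fin.castLE h i) = x i := by simp [hy]
  have hsum (f : Fin n → ℤ) (hf : ∀ i : Fin n, ¬ (i : ℕ) < m → f i = 0) :
      ∑ i, f i = ∑ i : Fin m, f (Fin.castLE h i) := by
    refine Eq.trans ?_ (Finset.sum_map Finset.univ (Fin.castLEEmb h) f)
    symm
    refine Finset.sum_subset (Finset.subset_univ _) fun i _ hi => hf i fun hlt => hi ?_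
    rw [Finset.mem_map]
    exact ⟨⟨i, hlt⟩, Finset.mem_univ _, rfl⟩
  have hy0 : y ≠ 0 := by
    intro h0
    apply hx
    funext i
    rw [← hyx, h0]
    rfl
  have h1 := hN y hy0
  rw [hsum _ (fun i hi => by simp [hy, hi])] at h1
  refine h1.trans_eq (Finset.sum_congr rfl fun i _ => ?_)
  rw [hsum _ (fun i hi => by simp [hy, hi])]
  exact Finset.sum_congr rfl fun j _ => by rw [hyx, hyx, hMN]

theorem IsADE.formPosDef (hG : IsADE G) : FormPosDef G := by
  rcases hG with ⟨n, -, f, h⟩ | ⟨n, hn, f, h⟩ | ⟨f, h⟩ | ⟨f, h⟩ | ⟨f, h⟩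
  · exact formPosDef_of_submatrix (intPosDef_A n) f h
  · exact formPosDef_of_submatrix (intPosDef_D n hn) f h
  · exact formPosDef_of_submatrix
      (intPosDef_of_castLE (by norm_num) intPosDef_E8 fun i j => by fin_cases i <;> fin_cases j <;> rfl) f h
  · exact formPosDef_of_submatrix
      (intPosDef_of_castLE (by norm_num) intPosDef_E8 fun i j => by fin_cases i <;> fin_cases j <;> rfl) f h
  · exact formPosDef_of_submatrix intPosDef_E8 f h

/-! ### The form, the geometric representation and roots -/

theorem form_comm (x y : ι → ℤ) : form G x y = form G y x := by
  rw [form_apply, form_apply, Finset.sum_comm]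
  refine Finset.sum_congr rfl fun i _ => Finset.sum_congr rfl fun j _ => ?_
  have : gram G j i = gram G i j := by
    simp only [gram, Matrix.of_apply, eq_comm (a := j), G.adj_comm j i]
  rw [this]
  ring

theorem form_simple_self (i : ι) : form G (simpleRoot i) (simpleRoot i) = 2 := by
  simp [form_simple, gram]

theorem form_simple_adj {i j : ι} (h : G.Adj i j) :
    form G (simpleRoot i) (simpleRoot j) = -1 := by
  simp [form_simple, gram, h.ne, h]

theorem form_simple_not_adj {i j : ι} (h : i ≠ j) (h' : ¬ G.Adj i j) :
    form G (simpleRoot i) (simpleRoot j) = 0 := by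
  simp [form_simple, gram, h, h']

theorem form_simple_nonpos {i j : ι} (h : i ≠ j) :
    form G (simpleRoot i) (simpleRoot j) ≤ 0 := by
  by_cases h' : G.Adj i j
  · rw [form_simple_adj h']; norm_num
  · rw [form_simple_not_adj h h']

theorem geom_s (i : ι) : geom G (s G i) = refl G (simpleRoot i) :=
  (coxMat G).toCoxeterSystem.lift_apply_simple (refl_liftable G) i

theorem geom_s_apply (i : ι) (x : ι → ℤ) :
    geom G (s G i) x = x - form G x (simpleRoot i) • simpleRoot i := by
  rw [geom_s, refl_apply]

theorem geom_mul_apply (w v : W G) (x : ι → ℤ) : geom G (w * v) x = geom G w (geom G v x) := by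
  rw [map_mul, Module.End.mul_apply]

@[simp] theorem geom_one_apply (x : ι → ℤ) : geom G 1 x = x := by
  rw [map_one, Module.End.one_apply]

@[simp] theorem geom_inv_geom (w : W G) (x : ι → ℤ) : geom G w⁻¹ (geom G w x) = x := by
  rw [← geom_mul_apply, inv_mul_cancel, geom_one_apply]

@[simp] theorem geom_geom_inv (w : W G) (x : ι → ℤ) : geom G w (geom G w⁻¹ x) = x := by
  rw [← geom_mul_apply, mul_inv_cancel, geom_one_apply]

theorem s_mul_self (i : ι) : s G i * s G i = 1 :=
  (coxMat G).toCoxeterSystem.simple_mul_simple_self i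

theorem s_inv (i : ι) : (s G i)⁻¹ = s G i :=
  (coxMat G).toCoxeterSystem.inv_simple i

theorem s_mul_cancel (i : ι) (w : W G) : s G i * (s G i * w) = w :=
  (coxMat G).toCoxeterSystem.simple_mul_simple_cancel_left i

theorem mul_s_cancel (i : ι) (w : W G) : w * s G i * s G i = w :=
  (coxMat G).toCoxeterSystem.simple_mul_simple_cancel_right i

theorem geom_s_s (i : ι) (x : ι → ℤ) : geom G (s G i) (geom G (s G i) x) = x := by
  rw [← geom_mul_apply, s_mul_self, geom_one_apply]

theorem s_comm {i j : ι} (h : i ≠ j) (h' : ¬ G.Adj i j) : s G i * s G j = s G j * s G i := by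
  have h1 := (coxMat G).toCoxeterSystem.simple_mul_simple_pow i j
  rw [coxMat_apply, if_neg h, if_neg h', pow_two] at h1
  have h2 : s G i * s G j * (s G i * s G j) = 1 := h1
  rw [mul_eq_one_iff_eq_inv, mul_inv_rev, s_inv, s_inv] at h2
  exact h2

theorem s_braid {i j : ι} (h : G.Adj i j) :
    s G i * s G j * s G i = s G j * s G i * s G j := by
  have h1 := (coxMat G).toCoxeterSystem.simple_mul_simple_pow i j
  rw [coxMat_apply, if_neg h.ne, if_pos h] at h1
  have h2 : (s G i * s G j * s G i) * (s G j * s G i * s G j) = 1 := by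
    rw [← h1]
    simp only [pow_succ, pow_zero, one_mul, mul_assoc]
    rfl
  rw [mul_eq_one_iff_eq_inv, mul_inv_rev, mul_inv_rev, s_inv, s_inv, ← mul_assoc] at h2
  exact h2

theorem W_induction_left {p : W G → Prop} (w : W G) (one : p 1)
    (mul : ∀ (w : W G) (i : ι), p w → p (s G i * w)) : p w :=
  (coxMat G).toCoxeterSystem.simple_induction_left w one mul

theorem form_geom (w : W G) (x y : ι → ℤ) : form G (geom G w x) (geom G w y) = form G x y := by
  induction w using W_induction_left with
  | one => simp
  | mul w i ih =>
    rw [geom_mul_apply, geom_mul_apply, geom_s_apply, geom_s_apply]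
    simp only [map_sub, map_smul, LinearMap.sub_apply, LinearMap.smul_apply, smul_eq_mul,
      form_simple_self, ih]
    rw [form_comm (simpleRoot i) (geom G w y)]
    ring

theorem form_geom_left (w : W G) (x y : ι → ℤ) :
    form G (geom G w x) y = form G x (geom G w⁻¹ y) := by
  rw [← form_geom w x, geom_geom_inv]

theorem simpleRoot_mem_roots (i : ι) : simpleRoot i ∈ roots G := ⟨1, i, by simp⟩

theorem geom_mem_roots {α : ι → ℤ} (hα : α ∈ roots G) (w : W G) : geom G w α ∈ roots G := by
  obtain ⟨v, i, rfl⟩ := hα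
  exact ⟨w * v, i, geom_mul_apply _ _ _⟩

theorem geom_s_simple_self (i : ι) : geom G (s G i) (simpleRoot i) = -simpleRoot i := by
  rw [geom_s_apply, form_simple_self]
  module

theorem neg_mem_roots {α : ι → ℤ} (hα : α ∈ roots G) : -α ∈ roots G := by
  obtain ⟨v, i, rfl⟩ := hα
  exact ⟨v * s G i, i, by rw [geom_mul_apply, geom_s_simple_self, map_neg]⟩

theorem form_self {α : ι → ℤ} (hα : α ∈ roots G) : form G α α = 2 := by
  obtain ⟨v, i, rfl⟩ := hα
  rw [form_geom, form_simple_self]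

theorem ne_zero_of_mem_roots {α : ι → ℤ} (hα : α ∈ roots G) : α ≠ 0 := by
  rintro rfl
  simpa using form_self hα

/-! ### Length and positivity -/

/-- The length function of the Coxeter group of `G`. -/
abbrev len (w : W G) : ℕ := (coxMat G).toCoxeterSystem.length w

theorem len_mul_s (w : W G) (i : ι) : len (w * s G i) = len w + 1 ∨ len (w * s G i) + 1 = len w :=
  (coxMat G).toCoxeterSystem.length_mul_simple w i

theorem exists_descent {w : W G} (hw : w ≠ 1) : ∃ i, len (w * s G i) < len w :=
  (coxMat G).toCoxeterSystem.exists_rightDescent_of_ne_one hw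

theorem geom_simple_add {i k : ι} (h : G.Adj i k) :
    geom G (s G k) (simpleRoot i) = simpleRoot i + simpleRoot k := by
  rw [geom_s_apply, form_simple_adj h]
  module

theorem geom_simple_of_not_adj {i k : ι} (hne : i ≠ k) (h : ¬ G.Adj i k) :
    geom G (s G k) (simpleRoot i) = simpleRoot i := by
  rw [geom_s_apply, form_simple_not_adj hne h]
  module

theorem geom_s_s_simple {i k : ι} (h : G.Adj i k) :
    geom G (s G i) (geom G (s G k) (simpleRoot i)) = simpleRoot k := by
  rw [geom_simple_add h, map_add, geom_s_simple_self, geom_simple_add h.symm]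
  module

theorem simpleRoot_nonneg (i k : ι) : 0 ≤ simpleRoot i k := by
  rw [simpleRoot, Pi.single_apply]
  split_ifs <;> norm_num

/-- If `w s_i` is longer than `w`, then `w α_i` is a nonnegative combination of simple roots. -/
theorem geom_simple_nonneg (w : W G) (i : ι) (h : len w < len (w * s G i)) (k : ι) :
    0 ≤ geom G w (simpleRoot i) k := by
  induction hn : len w using Nat.strong_induction_on generalizing w i k with
  | _ n ih =>
  subst hn
  by_cases hw : w = 1
  · subst hw
    simpa using simpleRoot_nonneg i k
  obtain ⟨j, hj⟩ := exists_descent hw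
  have hji : i ≠ j := by
    rintro rfl
    omega
  obtain ⟨v, rfl⟩ : ∃ v, w = v * s G j := ⟨w * s G j, (mul_s_cancel j w).symm⟩
  rw [mul_s_cancel] at hj
  have hvj := len_mul_s v j
  -- For adjacent nodes and `w = v s_j` there are two cases: if `v s_i` is longer than `v`, then `w
  -- α_i = v α_i + v α_j` with both summands nonnegative; otherwise `v = u s_i` and `w α_i = u α_j`.
  by_cases ha : G.Adj i j
  · have h1 := ih (len v) hj v j (by omega)
    rw [geom_mul_apply, geom_simple_add ha, map_add, Pi.add_apply]
    rcases len_mul_s v i with h2 | h2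
    · have h3 := ih (len v) hj v i (by omega) k rfl
      have h4 := h1 k rfl
      omega
    · obtain ⟨u, rfl⟩ : ∃ u, v = u * s G i := ⟨v * s G i, (mul_s_cancel i v).symm⟩
      rw [mul_s_cancel] at h2
      have h5 := len_mul_s u j
      -- If `u s_j` were shorter than `u`, the braid relation would write `w s_i` as `u s_j s_i
      -- s_j`, of length at most `len u + 1`, whereas `w` already has length `len u + 2`.
      have h6 : len u < len (u * s G j) := by
        by_contra hcon
        have e : u * s G i * s G j * s G i = u * s G j * s G i * s G j := by
          simp only [mul_assoc]
          rw [← mul_assoc (s G i), s_braid ha, mul_assoc]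
        rw [e] at h
        have g1 := len_mul_s (u * s G j) i
        have g2 := len_mul_s (u * s G j * s G i) j
        omega
      have h7 := ih (len u) (by omega) u j h6 k rfl
      rw [← Pi.add_apply, ← map_add, ← geom_simple_add ha, geom_mul_apply, geom_s_s_simple ha]
      exact h7
  · rw [geom_mul_apply, geom_simple_of_not_adj hji ha]
    refine ih (len v) hj v i ?_ k rfl
    by_contra hcon
    have e : v * s G j * s G i = v * s G i * s G j := by
      rw [mul_assoc, mul_assoc, s_comm hji ha]
    rw [e] at h
    have g1 := len_mul_s v i
    have g2 := len_mul_s (v * s G i) j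
    omega

theorem geom_simple_nonpos (w : W G) (i : ι) (h : len (w * s G i) < len w) (k : ι) :
    geom G w (simpleRoot i) k ≤ 0 := by
  obtain ⟨v, rfl⟩ : ∃ v, w = v * s G i := ⟨w * s G i, (mul_s_cancel i w).symm⟩
  rw [mul_s_cancel] at h
  have := geom_simple_nonneg v i h k
  rw [geom_mul_apply, geom_s_simple_self, map_neg, Pi.neg_apply]
  omega

theorem root_nonneg_or_nonpos {α : ι → ℤ} (hα : α ∈ roots G) : (∀ i, 0 ≤ α i) ∨ ∀ i, α i ≤ 0 := by
  obtain ⟨w, i, rfl⟩ := hα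
  rcases len_mul_s w i with h | h
  · exact Or.inl (geom_simple_nonneg w i (by omega))
  · exact Or.inr (geom_simple_nonpos w i (by omega))

theorem mem_posRoots_or_neg {α : ι → ℤ} (hα : α ∈ roots G) : α ∈ posRoots G ∨ -α ∈ posRoots G := by
  rcases root_nonneg_or_nonpos hα with h | h
  · exact Or.inl ⟨hα, h⟩
  · exact Or.inr ⟨neg_mem_roots hα, fun i => by simpa using h i⟩

theorem height_add (α β : ι → ℤ) : height (α + β) = height α + height β :=
  Finset.sum_add_distrib

theorem height_neg (α : ι → ℤ) : height (-α) = -height α := by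
  simp [height]

theorem height_sub (α β : ι → ℤ) : height (α - β) = height α - height β := by
  simp [height]

theorem height_smul (n : ℤ) (α : ι → ℤ) : height (n • α) = n * height α := by
  simp [height, Finset.mul_sum]

theorem height_simple (i : ι) : height (simpleRoot i) = 1 := by
  simp [height, simpleRoot]

theorem height_pos {α : ι → ℤ} (hα : α ∈ posRoots G) : 0 < height α := by
  refine lt_of_le_of_ne (Finset.sum_nonneg fun i _ => hα.2 i) fun h => ?_
  refine ne_zero_of_mem_roots hα.1 (funext fun i => ?_)
  exact (Finset.sum_eq_zero_iff_of_nonneg (fun i _ => hα.2 i)).1 h.symm i (Finset.mem_univ i)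

theorem height_ne_zero {α : ι → ℤ} (hα : α ∈ roots G) : height α ≠ 0 := by
  rcases mem_posRoots_or_neg hα with h | h
  · exact (height_pos h).ne'
  · have := height_pos h
    rw [height_neg] at this
    omega

theorem mem_posRoots_of_height_pos {α : ι → ℤ} (hα : α ∈ roots G) (h : 0 < height α) :
    α ∈ posRoots G := by
  refine (mem_posRoots_or_neg hα).resolve_right fun h' => ?_
  have := height_pos h'
  rw [height_neg] at this
  omega

theorem not_neg_mem_posRoots {α : ι → ℤ} (hα : α ∈ posRoots G) : -α ∉ posRoots G := fun h => by
  have h1 := height_pos hα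
  have h2 := height_pos h
  rw [height_neg] at h2
  omega

theorem simpleRoot_mem_posRoots (i : ι) : simpleRoot i ∈ posRoots G :=
  ⟨simpleRoot_mem_roots i, simpleRoot_nonneg i⟩

/-- A positive root of height one is simple. -/
theorem exists_eq_simpleRoot {α : ι → ℤ} (hα : α ∈ posRoots G) (h : height α = 1) :
    ∃ i, α = simpleRoot i := by
  obtain ⟨i, hi⟩ : ∃ i, α i ≠ 0 := by
    by_contra! hcon
    exact ne_zero_of_mem_roots hα.1 (funext hcon)
  have h1 := hα.2 i
  have h2 : ∑ j ∈ Finset.univ.erase i, α j = 1 - α i := by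
    rw [← h, height, ← Finset.add_sum_erase _ _ (Finset.mem_univ i)]
    ring
  have h3 : 0 ≤ ∑ j ∈ Finset.univ.erase i, α j := Finset.sum_nonneg fun j _ => hα.2 j
  have h4 : ∑ j ∈ Finset.univ.erase i, α j = 0 := by omega
  refine ⟨i, funext fun j => ?_⟩
  by_cases hij : j = i
  · subst hij
    simp [simpleRoot]
    omega
  · rw [simpleRoot, Pi.single_eq_of_ne hij]
    exact (Finset.sum_eq_zero_iff_of_nonneg (fun i _ => hα.2 i)).1 h4 j (by simp [hij])

/-! ### Elements attached to roots -/

/-- Conjugates of elements attached to simple roots depend only on the root. -/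
theorem conj_eq_of_geom_eq {M : Type*} [Monoid M] (φ : W G →* M) (x : ι → M)
    (hcomm : ∀ i k, i ≠ k → ¬ G.Adj i k → φ (s G k) * x i = x i * φ (s G k))
    (hadj : ∀ i k, G.Adj i k → φ (s G i * s G k) * x i = x k * φ (s G i * s G k))
    (w : W G) (i j : ι) (h : geom G w (simpleRoot i) = simpleRoot j) :
    φ w * x i = x j * φ w := by
  induction hn : len w using Nat.strong_induction_on generalizing w i with
  | _ n ih =>
  subst hn
  by_cases hw : w = 1
  · subst hw
    have : i = j := by
      by_contra hne
      have := congrFun h j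
      simp [simpleRoot, Ne.symm hne] at this
    simp [this]
  obtain ⟨k, hk⟩ := exists_descent hw
  have hki : i ≠ k := by
    rintro rfl
    have := geom_simple_nonpos w i hk j
    rw [h] at this
    simp [simpleRoot] at this
  obtain ⟨v, rfl⟩ : ∃ v, w = v * s G k := ⟨w * s G k, (mul_s_cancel k w).symm⟩
  rw [mul_s_cancel] at hk
  by_cases ha : G.Adj i k
  · have h1 := geom_simple_nonneg v k hk
    rcases len_mul_s v i with h2 | h2
    -- Here `w α_i = v α_i + v α_k` would be a sum of two positive roots, of height at least two,
    -- and could not be simple.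
    · exfalso
      have h3 := geom_simple_nonneg v i (by omega)
      rw [geom_mul_apply, geom_simple_add ha, map_add] at h
      have h4 := height_pos (G := G) ⟨geom_mem_roots (simpleRoot_mem_roots i) v, h3⟩
      have h5 := height_pos (G := G) ⟨geom_mem_roots (simpleRoot_mem_roots k) v, h1⟩
      have h6 := congrArg height h
      rw [height_add, height_simple] at h6
      omega
    · obtain ⟨u, rfl⟩ : ∃ u, v = u * s G i := ⟨v * s G i, (mul_s_cancel i v).symm⟩
      rw [mul_s_cancel] at h2
      rw [geom_mul_apply, geom_mul_apply, geom_s_s_simple ha] at h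
      have h7 := ih (len u) (by omega) u k h rfl
      rw [mul_assoc, map_mul, mul_assoc, hadj i k ha, ← mul_assoc, h7, mul_assoc]
  · rw [geom_mul_apply, geom_simple_of_not_adj hki ha] at h
    rw [map_mul, mul_assoc, hcomm i k hki ha, ← mul_assoc, ih (len v) hk v i h rfl, mul_assoc]

/-- Conjugates of elements attached to simple roots depend only on the root up to sign. -/
theorem conj_eq_conj {M : Type*} [Monoid M] (φ : W G →* M) (x : ι → M)
    (hself : ∀ i, φ (s G i) * x i = x i * φ (s G i))
    (hcomm : ∀ i k, i ≠ k → ¬ G.Adj i k → φ (s G k) * x i = x i * φ (s G k))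
    (hadj : ∀ i k, G.Adj i k → φ (s G i * s G k) * x i = x k * φ (s G i * s G k))
    (w v : W G) (i j : ι) (h : geom G w (simpleRoot i) = geom G v (simpleRoot j) ∨
      geom G w (simpleRoot i) = -geom G v (simpleRoot j)) :
    φ w * x i * φ w⁻¹ = φ v * x j * φ v⁻¹ := by
  have key : ∀ w : W G, geom G w (simpleRoot i) = geom G v (simpleRoot j) →
      φ w * x i * φ w⁻¹ = φ v * x j * φ v⁻¹ := by
    intro w h
    have h1 : geom G (v⁻¹ * w) (simpleRoot i) = simpleRoot j := by
      rw [geom_mul_apply, h, geom_inv_geom]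
    have h2 := conj_eq_of_geom_eq φ x hcomm hadj (v⁻¹ * w) i j h1
    have h3 : φ w = φ v * φ (v⁻¹ * w) := by rw [← map_mul, mul_inv_cancel_left]
    have h4 : φ (v⁻¹ * w) * φ w⁻¹ = φ v⁻¹ := by rw [← map_mul, mul_inv_cancel_right]
    rw [h3, mul_assoc (φ v), h2, mul_assoc, mul_assoc, h4, mul_assoc]
  rcases h with h | h
  · exact key w h
  · rw [← key (w * s G i) (by rw [geom_mul_apply, geom_s_simple_self, map_neg, h, neg_neg]),
      mul_inv_rev, s_inv, map_mul, map_mul]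
    have h1 : φ (s G i) * φ (s G i) = 1 := by rw [← map_mul, s_mul_self, map_one]
    simp only [mul_assoc]
    rw [← mul_assoc (φ (s G i)) (x i), hself, mul_assoc (x i), ← mul_assoc (φ (s G i)), h1,
      one_mul]

theorem s_conj_adj {i k : ι} (h : G.Adj i k) :
    s G i * s G k * s G i = s G k * (s G i * s G k) := by
  rw [s_braid h, mul_assoc]

theorem rootRefl_geom (w : W G) (i : ι) :
    rootRefl G (geom G w (simpleRoot i)) = w * s G i * w⁻¹ := by
  have h : ∃ p : W G × ι, geom G p.1 (simpleRoot p.2) = geom G w (simpleRoot i) := ⟨(w, i), rfl⟩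
  rw [rootRefl, dif_pos h]
  exact conj_eq_conj (MonoidHom.id _) (s G) (fun _ => rfl) (fun i k h h' => (s_comm h h').symm)
    (fun i k h => s_conj_adj h) _ _ _ _ (Or.inl h.choose_spec)

theorem rootRefl_simple (i : ι) : rootRefl G (simpleRoot i) = s G i := by
  simpa using rootRefl_geom (G := G) 1 i

theorem rootRefl_conj {α : ι → ℤ} (hα : α ∈ roots G) (w : W G) :
    rootRefl G (geom G w α) = w * rootRefl G α * w⁻¹ := by
  obtain ⟨v, i, rfl⟩ := hα
  rw [← geom_mul_apply, rootRefl_geom, rootRefl_geom]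
  group

theorem rootRefl_neg {α : ι → ℤ} (hα : α ∈ roots G) : rootRefl G (-α) = rootRefl G α := by
  obtain ⟨v, i, rfl⟩ := hα
  have : -geom G v (simpleRoot i) = geom G (v * s G i) (simpleRoot i) := by
    rw [geom_mul_apply, geom_s_simple_self, map_neg]
  rw [this, rootRefl_geom, rootRefl_geom, mul_inv_rev, s_inv, mul_s_cancel, mul_assoc]

theorem geom_rootRefl {α : ι → ℤ} (hα : α ∈ roots G) (x : ι → ℤ) :
    geom G (rootRefl G α) x = x - form G x α • α := by
  obtain ⟨v, i, rfl⟩ := hα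
  rw [rootRefl_geom, geom_mul_apply, geom_mul_apply, geom_s_apply, map_sub, map_smul,
    geom_geom_inv, form_geom_left, inv_inv]

theorem geom_rootRefl_eq_refl {α : ι → ℤ} (hα : α ∈ roots G) :
    geom G (rootRefl G α) = refl G α :=
  LinearMap.ext fun x => by rw [geom_rootRefl hα, refl_apply]

theorem rootRefl_mul_self {α : ι → ℤ} (hα : α ∈ roots G) :
    rootRefl G α * rootRefl G α = 1 := by
  obtain ⟨v, i, rfl⟩ := hα
  rw [rootRefl_geom]
  simp [mul_assoc, s_mul_cancel]

theorem rootRefl_inv {α : ι → ℤ} (hα : α ∈ roots G) : (rootRefl G α)⁻¹ = rootRefl G α :=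
  inv_eq_of_mul_eq_one_right (rootRefl_mul_self hα)

/-! ### Relations in the Brauer monoid and the elements `e_β` -/

theorem rBr_mul_eBr (i : ι) : rBr G i * eBr G i = eBr G i :=
  PresentedMonoid.mk_eq_mk_of_rel (BrRel.rSre i)

theorem eBr_mul_rBr (i : ι) : eBr G i * rBr G i = eBr G i :=
  PresentedMonoid.mk_eq_mk_of_rel (BrRel.rSer i)

theorem eBr_rBr_comm {i j : ι} (h : i ≠ j) (h' : ¬ G.Adj i j) :
    eBr G i * rBr G j = rBr G j * eBr G i :=
  PresentedMonoid.mk_eq_mk_of_rel (BrRel.hCer i j h h')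

theorem eBr_comm {i j : ι} (h : i ≠ j) (h' : ¬ G.Adj i j) :
    eBr G i * eBr G j = eBr G j * eBr G i :=
  PresentedMonoid.mk_eq_mk_of_rel (BrRel.hCee i j h h')

theorem rBr_eBr_rBr {i j : ι} (h : G.Adj i j) :
    rBr G j * eBr G i * rBr G j = rBr G i * eBr G j * rBr G i :=
  PresentedMonoid.mk_eq_mk_of_rel (BrRel.hNrer i j h)

theorem rBr_rBr_eBr {i j : ι} (h : G.Adj i j) :
    rBr G j * rBr G i * eBr G j = eBr G i * eBr G j :=
  PresentedMonoid.mk_eq_mk_of_rel (BrRel.rNrre i j h)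

theorem toBr_s (i : ι) : toBr G (s G i) = rBr G i :=
  (coxMat G).toCoxeterSystem.lift_apply_simple (rBr_liftable G) i

theorem toBr_inv_mul (w : W G) : toBr G w⁻¹ * toBr G w = 1 := by
  rw [← map_mul, inv_mul_cancel, map_one]

/-- The hypotheses of `conj_eq_conj` hold in the monoid: for adjacent nodes, `r_k e_i r_k = r_i e_k
r_i` gives `r_i r_k e_i = e_k r_i r_k`. This makes `e_β` independent of choices. -/
theorem eBr_conj_eq (w v : W G) (i j : ι)
    (h : geom G w (simpleRoot i) = geom G v (simpleRoot j) ∨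
      geom G w (simpleRoot i) = -geom G v (simpleRoot j)) :
    toBr G w * eBr G i * toBr G w⁻¹ = toBr G v * eBr G j * toBr G v⁻¹ := by
  refine conj_eq_conj (toBr G) (eBr G) (fun i => ?_) (fun i k h h' => ?_) (fun i k h => ?_) _ _ _ _ h
  · rw [toBr_s, rBr_mul_eBr, eBr_mul_rBr]
  · rw [toBr_s, eBr_rBr_comm h h']
  · rw [map_mul, toBr_s, toBr_s]
    calc rBr G i * rBr G k * eBr G i
        = rBr G i * (rBr G k * eBr G i * rBr G k) * rBr G k := by
          simp only [mul_assoc, rBr_sq, mul_one]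
      _ = (rBr G i * rBr G i) * eBr G k * rBr G i * rBr G k := by
          rw [rBr_eBr_rBr h]
          simp only [mul_assoc]
      _ = eBr G k * (rBr G i * rBr G k) := by rw [rBr_sq, one_mul, mul_assoc]

theorem eRoot_geom (w : W G) (i : ι) :
    eRoot G (geom G w (simpleRoot i)) = toBr G w * eBr G i * toBr G w⁻¹ := by
  have h : ∃ p : W G × ι, geom G p.1 (simpleRoot p.2) = geom G w (simpleRoot i) := ⟨(w, i), rfl⟩
  rw [eRoot, dif_pos h]
  exact eBr_conj_eq _ _ _ _ (Or.inl h.choose_spec)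

theorem eRoot_conj {α : ι → ℤ} (hα : α ∈ roots G) (w : W G) :
    eRoot G (geom G w α) = toBr G w * eRoot G α * toBr G w⁻¹ := by
  obtain ⟨v, i, rfl⟩ := hα
  rw [← geom_mul_apply, eRoot_geom, eRoot_geom, mul_inv_rev, map_mul, map_mul]
  simp only [mul_assoc]

theorem eRoot_neg {α : ι → ℤ} (hα : α ∈ roots G) : eRoot G (-α) = eRoot G α := by
  obtain ⟨v, i, rfl⟩ := hα
  have : -geom G v (simpleRoot i) = geom G (v * s G i) (simpleRoot i) := by
    rw [geom_mul_apply, geom_s_simple_self, map_neg]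
  rw [this, eRoot_geom, eRoot_geom]
  refine eBr_conj_eq _ _ _ _ (Or.inr ?_)
  rw [this.symm]

theorem eRoot_simple (i : ι) : eRoot G (simpleRoot i) = eBr G i := by
  simpa using eRoot_geom (G := G) 1 i

/-! ### Pairs of roots -/

theorem form_eq_sum (x y : ι → ℤ) : form G x y = ∑ k, y k * form G x (simpleRoot k) := by
  conv_lhs => rw [pi_eq_sum_univ' y]
  rw [map_sum]
  refine Finset.sum_congr rfl fun k _ => ?_
  rw [map_smul, smul_eq_mul]
  rfl

/-- `α - β` and `α + β` have norms `4 - 2(α, β)` and `4 + 2(α, β)`, which are positive unless the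
vector is zero. -/
theorem form_le_two (hP : FormPosDef G) {α β : ι → ℤ} (hα : α ∈ roots G) (hβ : β ∈ roots G) :
    form G α β ≤ 2 ∧ (form G α β = 2 → α = β) ∧ -2 ≤ form G α β ∧
      (form G α β = -2 → α = -β) := by
  have hs : form G (α - β) (α - β) = 4 - 2 * form G α β := by
    simp only [map_sub, LinearMap.sub_apply, form_self hα, form_self hβ, form_comm β α]
    ring
  have ha : form G (α + β) (α + β) = 4 + 2 * form G α β := by
    simp only [map_add, LinearMap.add_apply, form_self hα, form_self hβ, form_comm β α]
    ring
  refine ⟨?_, fun h => ?_, ?_, fun h => ?_⟩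
  · by_cases h0 : α - β = 0
    · rw [sub_eq_zero.1 h0, form_self hβ]
    · have := hP _ h0
      omega
  · by_contra hne
    have := hP _ (sub_ne_zero.2 hne)
    omega
  · by_cases h0 : α + β = 0
    · rw [h0] at ha
      simp at ha
      omega
    · have := hP _ h0
      omega
  · by_contra hne
    have := hP (α + β) fun h => hne (eq_neg_of_add_eq_zero_left h)
    omega

theorem joined_or_perp (hP : FormPosDef G) {α β : ι → ℤ} (hα : α ∈ roots G) (hβ : β ∈ roots G)
    (h : α ≠ β) (h' : α ≠ -β) : form G α β = -1 ∨ form G α β = 0 ∨ form G α β = 1 := by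
  obtain ⟨h1, h2, h3, h4⟩ := form_le_two hP hα hβ
  have h5 : form G α β ≠ 2 := fun e => h (h2 e)
  have h6 : form G α β ≠ -2 := fun e => h' (h4 e)
  omega

theorem reflection_mem_roots {α β : ι → ℤ} (hα : α ∈ roots G) (hβ : β ∈ roots G) :
    α - form G α β • β ∈ roots G := by
  rw [← geom_rootRefl hβ]
  exact geom_mem_roots hα _

theorem sub_mem_roots {α β : ι → ℤ} (hα : α ∈ roots G) (hβ : β ∈ roots G)
    (h : form G α β = 1) : α - β ∈ roots G := by
  simpa [h] using reflection_mem_roots hα hβ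

theorem add_mem_roots {α β : ι → ℤ} (hα : α ∈ roots G) (hβ : β ∈ roots G)
    (h : form G α β = -1) : α + β ∈ roots G := by
  simpa [h] using reflection_mem_roots hα hβ

/-- The sum of three mutually adjacent simple roots would have norm `6 - 6 = 0`. -/
theorem triangle_free (hP : FormPosDef G) {i j k : ι} (hij : G.Adj i j) (hjk : G.Adj j k) :
    ¬ G.Adj i k := by
  intro hik
  have h := hP (simpleRoot i + simpleRoot j + simpleRoot k) fun h0 => by
    have := congrArg height h0
    rw [height_add, height_add, height_simple, height_simple, height_simple] at this
    simp [height] at this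
  simp only [map_add, LinearMap.add_apply, form_simple_self, form_simple_adj hij,
    form_simple_adj hjk, form_simple_adj hik, form_simple_adj hij.symm,
    form_simple_adj hjk.symm, form_simple_adj hik.symm] at h
  omega

/-- Otherwise all `(α, α_k)` are nonpositive, and so is `(α, α) = ∑ α_k-coefficient · (α, α_k)`,
which equals `2`. -/
theorem exists_form_simple_eq_one (hP : FormPosDef G) {α : ι → ℤ} (hα : α ∈ posRoots G)
    (hs : ∀ i, α ≠ simpleRoot i) : ∃ k, form G α (simpleRoot k) = 1 := by
  by_contra! hcon
  have h1 : ∀ k, form G α (simpleRoot k) ≤ 0 := fun k => by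
    obtain ⟨h2, h3, -, -⟩ := form_le_two hP hα.1 (simpleRoot_mem_roots k)
    have h4 : form G α (simpleRoot k) ≠ 2 := fun e => hs k (h3 e)
    have := hcon k
    omega
  have h5 : form G α α ≤ 0 := by
    rw [form_eq_sum]
    exact Finset.sum_nonpos fun k _ => mul_nonpos_of_nonneg_of_nonpos (hα.2 k) (h1 k)
  rw [form_self hα.1] at h5
  omega

theorem height_ge_two {α : ι → ℤ} (hα : α ∈ posRoots G) (hs : ∀ i, α ≠ simpleRoot i) :
    2 ≤ height α := by
  have h1 := height_pos hα
  have h2 : height α ≠ 1 := fun h => by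
    obtain ⟨i, hi⟩ := exists_eq_simpleRoot hα h
    exact hs i hi
  omega

/-- A simple root and a positive root in nonpositive position are conjugate to a pair of simple
roots. -/
theorem exists_simple_pair (hP : FormPosDef G) (i : ι) (α : ι → ℤ) (hα : α ∈ posRoots G)
    (h : form G (simpleRoot i) α ≤ 0) :
    ∃ (w : W G) (i' j : ι), geom G w (simpleRoot i') = simpleRoot i ∧
      geom G w (simpleRoot j) = α := by
  induction hn : (height α).toNat using Nat.strong_induction_on generalizing i α with
  | _ n ih =>
  subst hn
  by_cases hs : ∃ j, α = simpleRoot j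
  · obtain ⟨j, rfl⟩ := hs
    exact ⟨1, i, j, by simp⟩
  push Not at hs
  obtain ⟨k, hk⟩ := exists_form_simple_eq_one hP hα hs
  have hht := height_ge_two hα hs
  have hki : i ≠ k := by
    rintro rfl
    rw [form_comm] at h
    omega
  have hsk : geom G (s G k) α = α - simpleRoot k := by rw [geom_s_apply, hk, one_smul]
  have hrt : α - simpleRoot k ∈ roots G := sub_mem_roots hα.1 (simpleRoot_mem_roots k) hk
  have hh1 : height (α - simpleRoot k) = height α - 1 := by rw [height_sub, height_simple]
  have hpos : α - simpleRoot k ∈ posRoots G := mem_posRoots_of_height_pos hrt (by omega)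
  -- The height of `α` is lowered by `s_k`. If `k` is not adjacent to `i`, then `s_k` fixes `α_i`.
  -- If it is adjacent, `s_i s_k` sends `α_i` to the simple root `α_k`, keeps the inner product, and
  -- still lowers `α`, since `(α_i, α - α_k)` is `0` or `1`.
  by_cases ha : G.Adj i k
  · have hlow := (form_le_two hP (simpleRoot_mem_roots i) hα.1).2.2
    have hne2 : form G (simpleRoot i) α ≠ -2 := fun e => by
      have := hlow.2 e
      have h1 := not_neg_mem_posRoots hα
      rw [← this] at h1
      exact h1 (simpleRoot_mem_posRoots i)
    have hif : form G (simpleRoot i) (α - simpleRoot k) = form G (simpleRoot i) α + 1 := by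
      rw [map_sub, form_simple_adj ha]; ring
    have hkf : form G (simpleRoot k) (α - simpleRoot k) = -1 := by
      rw [map_sub, form_simple_self, form_comm, hk]; ring
    obtain ⟨w, i', j, hw1, hw2⟩ : ∃ (w : W G) (i' j : ι),
        geom G w (simpleRoot i') = simpleRoot k ∧
          geom G w (simpleRoot j) = geom G (s G i) (α - simpleRoot k) := by
      have he : geom G (s G i) (α - simpleRoot k)
          = α - simpleRoot k - (form G (simpleRoot i) α + 1) • simpleRoot i := by
        rw [geom_s_apply, form_comm, hif]
      have hr2 : geom G (s G i) (α - simpleRoot k) ∈ roots G := geom_mem_roots hrt _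
      have hh2 : height (geom G (s G i) (α - simpleRoot k))
          = height α - 1 - (form G (simpleRoot i) α + 1) := by
        rw [he, height_sub, hh1, height_smul, height_simple, mul_one]
      have hz := height_ne_zero hr2
      refine ih (height (geom G (s G i) (α - simpleRoot k))).toNat (by omega) k _
        (mem_posRoots_of_height_pos hr2 (by omega)) ?_ rfl
      rw [he, map_sub, hkf, map_smul, form_simple_adj ha.symm, smul_eq_mul]
      omega
    refine ⟨s G k * s G i * w, i', j, ?_, ?_⟩
    · rw [geom_mul_apply, hw1, geom_mul_apply, geom_s_s_simple ha.symm]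
    · rw [geom_mul_apply, hw2, geom_mul_apply, geom_s_s, ← hsk, geom_s_s]
  · obtain ⟨w, i', j, hw1, hw2⟩ := ih (height (α - simpleRoot k)).toNat (by omega) i _ hpos
      (by rw [map_sub, form_simple_not_adj hki ha]; omega) rfl
    refine ⟨s G k * w, i', j, ?_, ?_⟩
    · rw [geom_mul_apply, hw1, geom_simple_of_not_adj hki ha]
    · rw [geom_mul_apply, hw2, ← hsk, geom_s_s]

/-- Any two roots that are not proportional are, up to signs, conjugate to a pair of simple
roots. -/
theorem exists_simple_pair_of_roots (hP : FormPosDef G) {a b : ι → ℤ} (ha : a ∈ roots G)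
    (hb : b ∈ roots G) (h1 : b ≠ a) (h2 : b ≠ -a) :
    ∃ (w : W G) (i j : ι), i ≠ j ∧
      (geom G w (simpleRoot i) = a ∨ geom G w (simpleRoot i) = -a) ∧
      (geom G w (simpleRoot j) = b ∨ geom G w (simpleRoot j) = -b) := by
  obtain ⟨v, i, rfl⟩ := ha
  have key : ∀ c ∈ roots G, geom G v c = b ∨ geom G v c = -b →
      form G (simpleRoot i) c ≤ 0 → ∃ (w : W G) (i' j : ι), i' ≠ j ∧
      (geom G w (simpleRoot i') = geom G v (simpleRoot i) ∨
        geom G w (simpleRoot i') = -geom G v (simpleRoot i)) ∧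
      (geom G w (simpleRoot j) = b ∨ geom G w (simpleRoot j) = -b) := by
    intro c hc hcb hle
    have base : ∀ u : W G, ∀ d ∈ posRoots G, form G (simpleRoot i) d ≤ 0 →
        (geom G u (simpleRoot i) = geom G v (simpleRoot i) ∨
          geom G u (simpleRoot i) = -geom G v (simpleRoot i)) →
        (geom G u d = b ∨ geom G u d = -b) → ∃ (w : W G) (i' j : ι), i' ≠ j ∧
        (geom G w (simpleRoot i') = geom G v (simpleRoot i) ∨
          geom G w (simpleRoot i') = -geom G v (simpleRoot i)) ∧
        (geom G w (simpleRoot j) = b ∨ geom G w (simpleRoot j) = -b) := by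
      intro u d hd hid hu1 hu2
      obtain ⟨w, i', j, hw1, hw2⟩ := exists_simple_pair hP i d hd hid
      refine ⟨u * w, i', j, ?_, ?_, ?_⟩
      · rintro rfl
        rw [hw1] at hw2
        rw [← hw2, form_simple_self] at hid
        omega
      · rwa [geom_mul_apply, hw1]
      · rwa [geom_mul_apply, hw2]
    rcases mem_posRoots_or_neg hc with hp | hp
    · exact base v c hp hle (Or.inl rfl) hcb
    · have hneg : geom G v (-c) = b ∨ geom G v (-c) = -b := by
        rw [map_neg]
        rcases hcb with h | h
        · exact Or.inr (by rw [h])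
        · exact Or.inl (by rw [h, neg_neg])
      by_cases h0 : form G (simpleRoot i) c = 0
      · exact base v (-c) hp (by rw [map_neg, h0]; norm_num) (Or.inl rfl) hneg
      · have hm : form G (simpleRoot i) c = -1 := by
          obtain ⟨-, -, h3, h4⟩ := form_le_two hP (simpleRoot_mem_roots i) hc
          have : form G (simpleRoot i) c ≠ -2 := fun e => by
            have := h4 e
            rw [← this] at hneg
            rcases hneg with h | h
            · exact h1 h.symm
            · exact h2 (by rw [h, neg_neg])
          omega
        -- Neither `c` nor `-c` qualifies directly: the first is negative and the second has product
        -- `1` with `α_i`. Applying `s_i` reverses `α_i` and turns `-c` into the positive root `-c -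
        -- α_i`, whose product with `α_i` is `-1`.
        have hs : geom G (s G i) (-c) = -c - simpleRoot i := by
          rw [geom_s_apply, form_comm, map_neg, hm]
          module
        have hr : -c - simpleRoot i ∈ roots G := hs ▸ geom_mem_roots hp.1 _
        have hz := height_ne_zero hr
        have hp2 := height_pos hp
        rw [height_sub, height_simple] at hz
        refine base (v * s G i) (-c - simpleRoot i) (mem_posRoots_of_height_pos hr ?_) ?_ ?_ ?_
        · rw [height_sub, height_simple]
          omega
        · rw [map_sub, map_neg, hm, form_simple_self]
          norm_num
        · right
          rw [geom_mul_apply, geom_s_simple_self, map_neg]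
        · rwa [geom_mul_apply, ← hs, geom_s_s]
  rcases le_total (form G (simpleRoot i) (geom G v⁻¹ b)) 0 with h | h
  · exact key _ (geom_mem_roots hb _) (Or.inl (by rw [geom_geom_inv])) h
  · refine key (-geom G v⁻¹ b) (neg_mem_roots (geom_mem_roots hb _)) (Or.inr ?_) ?_
    · rw [map_neg, geom_geom_inv]
    · rw [map_neg]
      omega

theorem eRoot_of_eq_or_neg {α β : ι → ℤ} (hα : α ∈ roots G) (h : α = β ∨ α = -β) :
    eRoot G β = eRoot G α := by
  rcases h with rfl | h
  · rfl
  · rw [eq_neg_iff_add_eq_zero, add_comm, ← eq_neg_iff_add_eq_zero] at h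
    rw [h, eRoot_neg hα]

theorem rootRefl_of_eq_or_neg {α β : ι → ℤ} (hα : α ∈ roots G) (h : α = β ∨ α = -β) :
    rootRefl G β = rootRefl G α := by
  rcases h with rfl | h
  · rfl
  · rw [eq_neg_iff_add_eq_zero, add_comm, ← eq_neg_iff_add_eq_zero] at h
    rw [h, rootRefl_neg hα]

theorem abs_form_of_eq_or_neg {α β α' β' : ι → ℤ} (h : α = α' ∨ α = -α')
    (h' : β = β' ∨ β = -β') : |form G α β| = |form G α' β'| := by
  rcases h with rfl | rfl <;> rcases h' with rfl | rfl <;> simp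

theorem ne_or_neg_of_form {a b : ι → ℤ} (ha : a ∈ roots G) (h : |form G a b| ≤ 1) :
    b ≠ a ∧ b ≠ -a := by
  constructor <;> rintro rfl
  · rw [form_self ha] at h
    norm_num at h
  · rw [map_neg, form_self ha] at h
    norm_num at h

/-! ### Transfer of relations from simple roots to arbitrary roots -/

theorem toBr_conj_mul_conj (w : W G) (x y : BrM G) :
    (toBr G w * x * toBr G w⁻¹) * (toBr G w * y * toBr G w⁻¹) =
      toBr G w * (x * y) * toBr G w⁻¹ := by
  calc (toBr G w * x * toBr G w⁻¹) * (toBr G w * y * toBr G w⁻¹)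
      = toBr G w * x * (toBr G w⁻¹ * toBr G w) * y * toBr G w⁻¹ := by simp only [mul_assoc]
    _ = _ := by rw [toBr_inv_mul, mul_one]; simp only [mul_assoc]

/-- Orthogonal roots are, up to signs, simultaneously conjugate to two non-adjacent simple roots,
where this is a defining relation. `toBr_mul_eRoot_of_joined` transfers the adjacent relation in the
same way. -/
theorem eRoot_mul_comm (hP : FormPosDef G) {a b : ι → ℤ} (ha : a ∈ roots G) (hb : b ∈ roots G)
    (h : form G a b = 0) : eRoot G a * eRoot G b = eRoot G b * eRoot G a := by
  obtain ⟨h1, h2⟩ := ne_or_neg_of_form ha (b := b) (by rw [h]; norm_num)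
  obtain ⟨w, i, j, hij, hi, hj⟩ := exists_simple_pair_of_roots hP ha hb h1 h2
  have hadj : ¬ G.Adj i j := fun hadj => by
    have := abs_form_of_eq_or_neg (G := G) hi hj
    rw [form_geom, form_simple_adj hadj, h] at this
    norm_num at this
  rw [eRoot_of_eq_or_neg ⟨w, i, rfl⟩ hi, eRoot_of_eq_or_neg ⟨w, j, rfl⟩ hj, eRoot_geom, eRoot_geom,
    toBr_conj_mul_conj, toBr_conj_mul_conj, eBr_comm hij hadj]

theorem toBr_rootRefl_mul_eRoot {a : ι → ℤ} (ha : a ∈ roots G) :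
    toBr G (rootRefl G a) * eRoot G a = eRoot G a := by
  obtain ⟨w, i, rfl⟩ := ha
  rw [rootRefl_geom, eRoot_geom, map_mul, map_mul, toBr_s, toBr_conj_mul_conj, rBr_mul_eBr]

theorem toBr_mul_eRoot_of_joined (hP : FormPosDef G) {a b : ι → ℤ} (ha : a ∈ roots G)
    (hb : b ∈ roots G) (h : Joined G a b) :
    toBr G (rootRefl G b * rootRefl G a) * eRoot G b = eRoot G a * eRoot G b := by
  have h' : |form G a b| = 1 := h
  obtain ⟨h1, h2⟩ := ne_or_neg_of_form ha (b := b) (by rw [h'])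
  obtain ⟨w, i, j, hij, hi, hj⟩ := exists_simple_pair_of_roots hP ha hb h1 h2
  have hadj : G.Adj i j := by
    by_contra hadj
    have := abs_form_of_eq_or_neg (G := G) hi hj
    rw [form_geom, form_simple_not_adj hij hadj, h'] at this
    norm_num at this
  rw [eRoot_of_eq_or_neg ⟨w, i, rfl⟩ hi, eRoot_of_eq_or_neg ⟨w, j, rfl⟩ hj,
    rootRefl_of_eq_or_neg ⟨w, i, rfl⟩ hi, rootRefl_of_eq_or_neg ⟨w, j, rfl⟩ hj,
    eRoot_geom, eRoot_geom, rootRefl_geom, rootRefl_geom, map_mul, map_mul, map_mul, map_mul,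
    map_mul, toBr_s, toBr_s, toBr_conj_mul_conj, toBr_conj_mul_conj, toBr_conj_mul_conj,
    rBr_rBr_eBr hadj]

theorem rootRefl_comm {a b : ι → ℤ} (hb : b ∈ roots G) (ha : a ∈ roots G)
    (h : form G b a = 0) : rootRefl G a * rootRefl G b = rootRefl G b * rootRefl G a := by
  have h1 := rootRefl_conj hb (rootRefl G a)
  rw [geom_rootRefl ha, h, zero_smul, sub_zero] at h1
  exact (eq_mul_inv_iff_mul_eq.1 h1).symm

/-- A root is determined by its inner products with the simple roots, by positive definiteness, and
these all lie in `[-2, 2]`. -/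
theorem roots_finite (hP : FormPosDef G) : (roots G).Finite := by
  have hinj : Set.InjOn (fun (x : ι → ℤ) (i : ι) => form G x (simpleRoot i)) (roots G) := by
    intro x _ y _ h
    by_contra hne
    have h1 := hP _ (sub_ne_zero.2 hne)
    rw [form_eq_sum, Finset.sum_eq_zero] at h1
    · exact lt_irrefl _ h1
    · intro k _
      have := congrFun h k
      simp only at this
      rw [map_sub, LinearMap.sub_apply, this, sub_self, mul_zero]
  refine Set.Finite.of_finite_image ?_ hinj
  refine (Set.finite_Icc (fun _ : ι => (-2 : ℤ)) (fun _ => 2)).subset ?_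
  rintro _ ⟨x, hx, rfl⟩
  exact ⟨fun i => (form_le_two hP hx (simpleRoot_mem_roots i)).2.2.1,
    fun i => (form_le_two hP hx (simpleRoot_mem_roots i)).1⟩

/-! ### Positive representatives and the action on orthogonal sets -/

theorem posRep_of_mem {α : ι → ℤ} (h : α ∈ posRoots G) : posRep α = α := if_pos h.2

theorem posRep_of_neg_mem {α : ι → ℤ} (h : -α ∈ posRoots G) : posRep α = -α := by
  refine if_neg fun h' => ?_
  have h1 : α ∈ posRoots G := ⟨by simpa using neg_mem_roots h.1, h'⟩
  exact not_neg_mem_posRoots h1 h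

theorem posRep_eq_or (α : ι → ℤ) : posRep α = α ∨ posRep α = -α := by
  rw [posRep]
  split_ifs
  · exact Or.inl rfl
  · exact Or.inr rfl

theorem posRep_mem {α : ι → ℤ} (h : α ∈ roots G) : posRep α ∈ posRoots G := by
  rcases mem_posRoots_or_neg h with h' | h'
  · rwa [posRep_of_mem h']
  · rwa [posRep_of_neg_mem h']

theorem posRep_neg {α : ι → ℤ} (h : α ∈ roots G) : posRep (-α) = posRep α := by
  rcases mem_posRoots_or_neg h with h' | h'
  · rw [posRep_of_mem h', posRep_of_neg_mem (α := -α) (by rwa [neg_neg]), neg_neg]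
  · rw [posRep_of_mem h', posRep_of_neg_mem h']

theorem posRep_eq_of_eq_or_neg {α β : ι → ℤ} (hβ : β ∈ posRoots G) (h : α = β ∨ α = -β) :
    posRep α = β := by
  rcases h with rfl | rfl
  · exact posRep_of_mem hβ
  · rw [posRep_neg hβ.1, posRep_of_mem hβ]

theorem eq_or_neg_posRep (α : ι → ℤ) : α = posRep α ∨ α = -posRep α := by
  rcases posRep_eq_or α with h | h
  · exact Or.inl h.symm
  · exact Or.inr (by rw [h, neg_neg])

theorem posRep_geom_posRep {α : ι → ℤ} (hα : α ∈ roots G) (w : W G) :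
    posRep (geom G w (posRep α)) = posRep (geom G w α) := by
  rcases posRep_eq_or α with h | h
  · rw [h]
  · rw [h, map_neg, posRep_neg (geom_mem_roots hα w)]

theorem mem_act {w : W G} {B : Finset (ι → ℤ)} {γ : ι → ℤ} :
    γ ∈ act G w B ↔ ∃ β ∈ B, posRep (geom G w β) = γ := Finset.mem_image

theorem act_one {B : Finset (ι → ℤ)} (hB : ∀ β ∈ B, β ∈ posRoots G) : act G 1 B = B := by
  have h : ∀ β ∈ B, posRep (geom G 1 β) = id β := fun β hβ => by
    rw [geom_one_apply, posRep_of_mem (hB β hβ), id]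
  rw [act, Finset.image_congr h, Finset.image_id]

theorem act_mul {B : Finset (ι → ℤ)} (hB : ∀ β ∈ B, β ∈ posRoots G) (w v : W G) :
    act G (w * v) B = act G w (act G v B) := by
  rw [act, act, act, Finset.image_image]
  refine Finset.image_congr fun β hβ => ?_
  rw [Function.comp_apply, posRep_geom_posRep (geom_mem_roots (hB β hβ).1 v), geom_mul_apply]

theorem IsOrthoSet.act {B : Finset (ι → ℤ)} (hB : IsOrthoSet G B) (w : W G) :
    IsOrthoSet G (act G w B) := by
  refine ⟨fun γ hγ => ?_, fun γ hγ δ hδ hne => ?_⟩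
  · obtain ⟨β, hβ, rfl⟩ := mem_act.1 hγ
    exact posRep_mem (geom_mem_roots (hB.1 β hβ).1 w)
  · obtain ⟨β, hβ, rfl⟩ := mem_act.1 hγ
    obtain ⟨β', hβ', rfl⟩ := mem_act.1 hδ
    have h1 := hB.2 β hβ β' hβ' (fun h => hne (by rw [h]))
    have h2 := abs_form_of_eq_or_neg (G := G) (posRep_eq_or (geom G w β))
      (posRep_eq_or (geom G w β'))
    rwa [form_geom, h1, abs_zero, abs_eq_zero] at h2

theorem act_inv_act {B : Finset (ι → ℤ)} (hB : IsOrthoSet G B) (w : W G) :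
    act G w⁻¹ (act G w B) = B := by
  rw [← act_mul hB.1, inv_mul_cancel, act_one hB.1]

theorem act_s_s {B : Finset (ι → ℤ)} (hB : IsOrthoSet G B) (i : ι) :
    act G (s G i) (act G (s G i) B) = B := by
  rw [← act_mul hB.1, s_mul_self, act_one hB.1]

theorem card_act {B : Finset (ι → ℤ)} (hB : IsOrthoSet G B) (w : W G) :
    (act G w B).card = B.card := by
  refine le_antisymm Finset.card_image_le ?_
  conv_lhs => rw [← act_inv_act hB w]
  exact Finset.card_image_le

theorem posRep_geom_mem_act {w : W G} {B : Finset (ι → ℤ)} {β : ι → ℤ} (hβ : β ∈ B) :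
    posRep (geom G w β) ∈ act G w B := Finset.mem_image_of_mem _ hβ

/-- By orthogonality `r_{β₁} r_{β₂} r_{β₃} α = α - ∑ (α, β_i) β_i`. Its product with `α` is `2 - 3 =
-1`, so `r_α` adds one more `α`. -/
theorem admissible_root {B : Finset (ι → ℤ)} (hB : IsAdmissible G B) {β₁ β₂ β₃ α : ι → ℤ}
    (h₁ : β₁ ∈ B) (h₂ : β₂ ∈ B) (h₃ : β₃ ∈ B) (h12 : β₁ ≠ β₂) (h13 : β₁ ≠ β₃) (h23 : β₂ ≠ β₃)
    (hα : α ∈ roots G) (j₁ : Joined G α β₁) (j₂ : Joined G α β₂) (j₃ : Joined G α β₃) :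
    posRep ((2 : ℤ) • α - form G α β₁ • β₁ - form G α β₂ • β₂ - form G α β₃ • β₃) ∈ B := by
  have h := hB.2 β₁ h₁ β₂ h₂ β₃ h₃ h12 h13 h23 α hα j₁ j₂ j₃
  have o12 := hB.1.2 β₁ h₁ β₂ h₂ h12
  have o13 := hB.1.2 β₁ h₁ β₃ h₃ h13
  have o23 := hB.1.2 β₂ h₂ β₃ h₃ h23
  have q {x : ℤ} (hx : |x| = 1) : x * x = 1 := by
    rw [← abs_mul_abs_self, hx, one_mul]
  have q1 := q j₁
  have q2 := q j₂
  have q3 := q j₃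
  convert h using 2
  simp only [refl_apply, map_sub, map_smul, LinearMap.sub_apply, LinearMap.smul_apply,
    smul_eq_mul, form_comm β₂ β₁, form_comm β₃ β₁, form_comm β₃ β₂, o12, o13, o23,
    form_self hα, form_comm β₁ α, form_comm β₂ α, form_comm β₃ α, mul_zero, sub_zero]
  match_scalars <;> first | ring1 | linear_combination -q1 - q2 - q3

theorem refl_posRep_geom {β : ι → ℤ} {w : W G} (x : ι → ℤ) :
    refl G (posRep (geom G w β)) x = geom G w (refl G β (geom G w⁻¹ x)) := by
  have h : refl G (posRep (geom G w β)) x = refl G (geom G w β) x := by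
    rcases posRep_eq_or (geom G w β) with h | h <;> rw [h]
    simp [refl_apply]
  rw [h, refl_apply, refl_apply, map_sub, map_smul, geom_geom_inv, form_geom_left, inv_inv]

theorem IsAdmissible.act {B : Finset (ι → ℤ)} (hB : IsAdmissible G B) (w : W G) :
    IsAdmissible G (act G w B) := by
  refine ⟨hB.1.act w, ?_⟩
  intro γ₁ h₁ γ₂ h₂ γ₃ h₃ h12 h13 h23 α hα j₁ j₂ j₃
  obtain ⟨β₁, hβ₁, rfl⟩ := mem_act.1 h₁
  obtain ⟨β₂, hβ₂, rfl⟩ := mem_act.1 h₂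
  obtain ⟨β₃, hβ₃, rfl⟩ := mem_act.1 h₃
  have hj : ∀ β : ι → ℤ, Joined G α (posRep (geom G w β)) → Joined G (geom G w⁻¹ α) β := by
    intro β h
    have := abs_form_of_eq_or_neg (G := G) (Or.inl (rfl : α = α)) (posRep_eq_or (geom G w β))
    rw [Joined, form_geom_left, inv_inv]
    rw [← this]
    exact h
  have hα' : geom G w⁻¹ α ∈ roots G := geom_mem_roots hα _
  have h := hB.2 β₁ hβ₁ β₂ hβ₂ β₃ hβ₃ (fun h => h12 (by rw [h])) (fun h => h13 (by rw [h]))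
    (fun h => h23 (by rw [h])) _ hα' (hj _ j₁) (hj _ j₂) (hj _ j₃)
  have h' := posRep_geom_mem_act (w := w) h
  have hmem : refl G (geom G w⁻¹ α) (refl G β₁ (refl G β₂ (refl G β₃ (geom G w⁻¹ α))))
      ∈ roots G := by
    rw [← geom_rootRefl_eq_refl (hB.1.1 _ hβ₁).1, ← geom_rootRefl_eq_refl (hB.1.1 _ hβ₂).1,
      ← geom_rootRefl_eq_refl (hB.1.1 _ hβ₃).1, ← geom_rootRefl_eq_refl hα']
    exact geom_mem_roots (geom_mem_roots (geom_mem_roots (geom_mem_roots hα' _) _) _) _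
  rw [posRep_geom_posRep hmem] at h'
  convert h' using 2
  rw [refl_posRep_geom, refl_posRep_geom, refl_posRep_geom]
  simp only [geom_inv_geom]
  rw [refl_apply G α, refl_apply G (geom G w⁻¹ α), map_sub, map_smul, geom_geom_inv, form_geom_left]

/-! ### Simple reflections of orthogonal sets -/

/-- For a positive root other than `α_i`, the height drops by at most one, and no root has height
zero. -/
theorem geom_s_mem_posRoots (hP : FormPosDef G) {i : ι} {β : ι → ℤ} (hβ : β ∈ posRoots G)
    (hne : β ≠ simpleRoot i) : geom G (s G i) β ∈ posRoots G := by
  have hr := geom_mem_roots hβ.1 (s G i)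
  refine mem_posRoots_of_height_pos hr ?_
  have h0 := height_ne_zero hr
  rw [geom_s_apply, height_sub, height_smul, height_simple, mul_one] at h0 ⊢
  obtain ⟨h1, h2, -, -⟩ := form_le_two hP hβ.1 (simpleRoot_mem_roots i)
  have h3 : form G β (simpleRoot i) ≠ 2 := fun e => hne (h2 e)
  have h4 := height_pos hβ
  omega

theorem mem_act_s (hP : FormPosDef G) {B : Finset (ι → ℤ)} (hB : IsOrthoSet G B) {i : ι}
    (hi : simpleRoot i ∉ B) {γ : ι → ℤ} :
    γ ∈ act G (s G i) B ↔ geom G (s G i) γ ∈ B := by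
  rw [mem_act]
  constructor
  · rintro ⟨β, hβ, rfl⟩
    rw [posRep_of_mem (geom_s_mem_posRoots hP (hB.1 β hβ) fun h => hi (h ▸ hβ)), geom_s_s]
    exact hβ
  · intro h
    refine ⟨_, h, ?_⟩
    have h1 := geom_s_mem_posRoots hP (hB.1 _ h) fun h' => hi (h' ▸ h)
    rw [posRep_of_mem h1, geom_s_s]

theorem geom_s_mem_act (hP : FormPosDef G) {B : Finset (ι → ℤ)} (hB : IsOrthoSet G B) {i : ι}
    (hi : simpleRoot i ∉ B) {β : ι → ℤ} (hβ : β ∈ B) : geom G (s G i) β ∈ act G (s G i) B := by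
  rw [mem_act_s hP hB hi, geom_s_s]
  exact hβ

theorem form_cases (hP : FormPosDef G) {B : Finset (ι → ℤ)} (hB : IsOrthoSet G B) {i : ι}
    (hi : simpleRoot i ∉ B) {β : ι → ℤ} (hβ : β ∈ B) :
    form G (simpleRoot i) β = -1 ∨ form G (simpleRoot i) β = 0 ∨ form G (simpleRoot i) β = 1 := by
  refine joined_or_perp hP (simpleRoot_mem_roots i) (hB.1 β hβ).1 (fun h => hi (h ▸ hβ)) fun h => ?_
  have := simpleRoot_mem_posRoots (G := G) i
  rw [h] at this
  exact not_neg_mem_posRoots (hB.1 β hβ) this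

theorem form_eq_zero_or_two {B : Finset (ι → ℤ)} (hB : IsOrthoSet G B) {β γ : ι → ℤ}
    (hβ : β ∈ B) (hγ : γ ∈ B) : form G β γ = 0 ∨ form G β γ = 2 := by
  by_cases h : β = γ
  · right
    rw [h, form_self (hB.1 γ hγ).1]
  · exact Or.inl (hB.2 β hβ γ hγ h)

theorem act_s_of_mem {B : Finset (ι → ℤ)} (hB : IsOrthoSet G B) {i : ι} (hi : simpleRoot i ∈ B) :
    act G (s G i) B = B := by
  have h : ∀ β ∈ B, posRep (geom G (s G i) β) = id β := fun β hβ => by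
    rw [id]
    by_cases hne : β = simpleRoot i
    · rw [hne, geom_s_simple_self, posRep_neg (simpleRoot_mem_roots (G := G) i),
        posRep_of_mem (simpleRoot_mem_posRoots (G := G) i)]
    · rw [geom_s_apply, hB.2 β hβ _ hi hne, zero_smul, sub_zero, posRep_of_mem (hB.1 β hβ)]
  rw [act, Finset.image_congr h, Finset.image_id]

theorem act_s_of_perp {B : Finset (ι → ℤ)} (hB : IsOrthoSet G B) {i : ι} (hi : Perp G i B) :
    act G (s G i) B = B := by
  have h : ∀ β ∈ B, posRep (geom G (s G i) β) = id β := fun β hβ => by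
    rw [geom_s_apply, form_comm, hi β hβ, zero_smul, sub_zero, posRep_of_mem (hB.1 β hβ), id]
  rw [act, Finset.image_congr h, Finset.image_id]

theorem geom_s_notMem {B : Finset (ι → ℤ)} (hB : IsOrthoSet G B) {i : ι}
    {β : ι → ℤ} (hβ : β ∈ B) (h : form G (simpleRoot i) β = 1 ∨ form G (simpleRoot i) β = -1) :
    geom G (s G i) β ∉ B := fun h' => by
  have h1 := form_eq_zero_or_two hB h' hβ
  rw [geom_s_apply, map_sub, map_smul, LinearMap.sub_apply, LinearMap.smul_apply, smul_eq_mul,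
    form_comm β (simpleRoot i), form_self (hB.1 β hβ).1] at h1
  rcases h with h | h <;> rw [h] at h1 <;> omega

theorem act_s_eq_self (hP : FormPosDef G) {B : Finset (ι → ℤ)} (hB : IsOrthoSet G B) {i : ι}
    (h : act G (s G i) B = B) : simpleRoot i ∈ B ∨ Perp G i B := by
  by_contra! hcon
  obtain ⟨hi, hp⟩ := hcon
  simp only [Perp, not_forall] at hp
  obtain ⟨β, hβ, h0⟩ := hp
  have h1 := geom_s_mem_act hP hB hi hβ
  rw [h] at h1
  exact geom_s_notMem hB hβ (by rcases form_cases hP hB hi hβ with h | h | h <;> tauto) h1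

theorem form_simple_geom_s (i : ι) (x : ι → ℤ) :
    form G (simpleRoot i) (geom G (s G i) x) = -form G (simpleRoot i) x := by
  rw [geom_s_apply, map_sub, map_smul, form_simple_self, form_comm x, smul_eq_mul]
  ring

theorem form_simple_geom_s_adj {i j : ι} (h : G.Adj i j) (x : ι → ℤ) :
    form G (simpleRoot j) (geom G (s G i) x) =
      form G (simpleRoot i) x + form G (simpleRoot j) x := by
  rw [geom_s_apply, map_sub, map_smul, form_simple_adj h.symm, form_comm x, smul_eq_mul]
  ring

theorem form_simple_geom_s_not_adj {i j : ι} (hne : i ≠ j) (h : ¬ G.Adj i j) (x : ι → ℤ) :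
    form G (simpleRoot j) (geom G (s G i) x) = form G (simpleRoot j) x := by
  rw [geom_s_apply, map_sub, map_smul, form_comm (simpleRoot j) (simpleRoot i),
    form_simple_not_adj hne h, smul_zero, sub_zero]

theorem height_geom_s (i : ι) (x : ι → ℤ) :
    height (geom G (s G i) x) = height x - form G (simpleRoot i) x := by
  rw [geom_s_apply, height_sub, height_smul, height_simple, form_comm, mul_one]

/-! ### Height gaps that cannot occur -/

theorem root_of_opposite {B : Finset (ι → ℤ)} (hB : IsOrthoSet G B) {i : ι} {β γ : ι → ℤ}
    (hβ : β ∈ B) (hγ : γ ∈ B) (h1 : form G (simpleRoot i) β = -1)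
    (h2 : form G (simpleRoot i) γ = 1) : γ - simpleRoot i - β ∈ roots G := by
  have hne : γ ≠ β := fun h => by rw [h, h1] at h2; omega
  have h3 : γ - simpleRoot i ∈ roots G :=
    sub_mem_roots (hB.1 γ hγ).1 (simpleRoot_mem_roots i) (by rw [form_comm, h2])
  refine sub_mem_roots h3 (hB.1 β hβ).1 ?_
  rw [map_sub, LinearMap.sub_apply, h1, hB.2 γ hγ β hβ hne]
  norm_num

/-- A gap of one would give the root `γ - α_i - β` height zero. So a gap of at least one is a gap of
at least two, and the order survives when `r_i` moves both roots towards each other. -/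
theorem height_ne_of_opposite {B : Finset (ι → ℤ)} (hB : IsOrthoSet G B) {i : ι} {β γ : ι → ℤ}
    (hβ : β ∈ B) (hγ : γ ∈ B) (h1 : form G (simpleRoot i) β = -1)
    (h2 : form G (simpleRoot i) γ = 1) : height γ ≠ height β + 1 := fun h => by
  have := height_ne_zero (root_of_opposite hB hβ hγ h1 h2)
  rw [height_sub, height_sub, height_simple] at this
  omega

theorem exists_neg_simpleRoot {x : ι → ℤ} (hx : x ∈ roots G) (h : height x = -1) :
    ∃ k, x = -simpleRoot k := by
  have h1 : height (-x) = 1 := by rw [height_neg, h, neg_neg]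
  obtain ⟨k, hk⟩ := exists_eq_simpleRoot
    (mem_posRoots_of_height_pos (neg_mem_roots hx) (by rw [h1]; norm_num)) h1
  exact ⟨k, by rw [← hk, neg_neg]⟩

theorem form_simple_ne_neg_one {x : ι → ℤ} (hx : x ∈ roots G) (h : height x = -1) (j : ι) :
    form G (simpleRoot j) x ≠ -1 := by
  obtain ⟨k, rfl⟩ := exists_neg_simpleRoot hx h
  rw [map_neg]
  by_cases hjk : j = k
  · rw [hjk, form_simple_self]
    norm_num
  · have := form_simple_nonpos (G := G) hjk
    omega

/-- With a gap of two, `γ - β - 2α_j - α_i` would be a root of height `-1`, hence the negative of a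
simple root. Its product with `α_j` is `-1`, which no negative of a simple root has. -/
theorem height_ne_of_opposite_adj {B : Finset (ι → ℤ)} (hB : IsOrthoSet G B) {i j : ι}
    (hij : G.Adj i j) {β γ : ι → ℤ} (hβ : β ∈ B) (hγ : γ ∈ B)
    (h1 : form G (simpleRoot j) β = -1) (h2 : form G (simpleRoot j) γ = 1)
    (h3 : form G (simpleRoot i) β = 0) (h4 : form G (simpleRoot i) γ = 0) :
    height γ ≠ height β + 2 := fun h => by
  have hne : γ ≠ β := fun h => by rw [h, h1] at h2; omega
  have hγ' : γ - simpleRoot j ∈ roots G :=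
    sub_mem_roots (hB.1 γ hγ).1 (simpleRoot_mem_roots j) (by rw [form_comm, h2])
  have hβ' : β + simpleRoot j ∈ roots G :=
    add_mem_roots (hB.1 β hβ).1 (simpleRoot_mem_roots j) (by rw [form_comm, h1])
  have h5 : γ - simpleRoot j - simpleRoot i ∈ roots G := by
    refine sub_mem_roots hγ' (simpleRoot_mem_roots i) ?_
    rw [form_comm, map_sub, h4, form_simple_adj hij]
    norm_num
  have h6 : γ - simpleRoot j - simpleRoot i - (β + simpleRoot j) ∈ roots G := by
    refine sub_mem_roots h5 hβ' ?_
    simp only [map_sub, map_add, LinearMap.sub_apply, h1, h3, form_comm γ (simpleRoot j), h2,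
      form_simple_self, hB.2 γ hγ β hβ hne, form_simple_adj hij]
    norm_num
  refine form_simple_ne_neg_one h6 ?_ j ?_
  · simp only [height_sub, height_add, height_simple]
    omega
  · simp only [map_sub, map_add, h1, h2, form_simple_self, form_simple_adj hij.symm]
    norm_num

/-! ### The raising relation -/

/-- A new root of `r_i B` is either `δ + α_i` with `δ` not below the lowest root of product `-1`, or
`γ - α_i` with `γ` above `β`. In the second case the excluded gap of one keeps `γ - α_i` strictly
above `β`. `Raises.exists` is the converse, with the gap made explicit. -/
theorem raises_of_exists (hP : FormPosDef G) {B : Finset (ι → ℤ)} (hB : IsOrthoSet G B) {i : ι}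
    {β : ι → ℤ} (hβ : β ∈ B) (h1 : form G (simpleRoot i) β = -1)
    (h2 : ∀ γ ∈ B, form G (simpleRoot i) γ = 1 → height β < height γ) : Raises G i B := by
  have hi : simpleRoot i ∉ B := fun hi => by
    have := form_eq_zero_or_two hB hi hβ
    omega
  obtain ⟨β₀, hβ₀, hmin⟩ := Finset.exists_min_image
    (B.filter fun δ => form G (simpleRoot i) δ = -1) height ⟨β, by simp [hβ, h1]⟩
  rw [Finset.mem_filter] at hβ₀
  obtain ⟨hβ₀, h3⟩ := hβ₀
  have hle := hmin β (by simp [hβ, h1])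
  refine ⟨β₀, ?_, fun γ hγ => ?_⟩
  · rw [Finset.mem_sdiff, mem_act_s hP hB hi]
    exact ⟨hβ₀, geom_s_notMem hB hβ₀ (Or.inr h3)⟩
  · rw [Finset.mem_sdiff, mem_act_s hP hB hi] at hγ
    obtain ⟨hγ1, hγ2⟩ := hγ
    have hh := height_geom_s (G := G) i γ
    have hf := form_simple_geom_s (G := G) i γ
    rcases form_cases hP hB hi hγ1 with h | h | h
    · have := hmin _ (Finset.mem_filter.2 ⟨hγ1, h⟩)
      omega
    · exfalso
      apply hγ2
      have : geom G (s G i) γ = γ := by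
        rw [geom_s_apply, form_comm, show form G (simpleRoot i) γ = 0 by omega, zero_smul, sub_zero]
      rwa [this] at hγ1
    · have h5 := h2 _ hγ1 h
      have h6 := height_ne_of_opposite hB hβ hγ1 h1 h
      omega

theorem Raises.exists (hP : FormPosDef G) {B : Finset (ι → ℤ)} (hB : IsOrthoSet G B) {i : ι}
    (h : Raises G i B) : simpleRoot i ∉ B ∧ ∃ β ∈ B, form G (simpleRoot i) β = -1 ∧
      ∀ γ ∈ B, form G (simpleRoot i) γ = 1 → height β + 2 ≤ height γ := by
  obtain ⟨β, hβ, hmin⟩ := h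
  rw [Finset.mem_sdiff] at hβ
  have hi : simpleRoot i ∉ B := fun hi => by
    rw [act_s_of_mem hB hi] at hβ
    exact hβ.2 hβ.1
  rw [mem_act_s hP hB hi] at hβ
  have hlt : ∀ γ ∈ B, form G (simpleRoot i) γ = 1 → height β + 2 ≤ height γ := by
    intro γ hγ h1
    have h2 := hmin (geom G (s G i) γ) (by
      rw [Finset.mem_sdiff]
      exact ⟨geom_s_mem_act hP hB hi hγ, geom_s_notMem hB hγ (Or.inl h1)⟩)
    rw [height_geom_s, h1] at h2
    omega
  refine ⟨hi, β, hβ.1, ?_, hlt⟩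
  rcases form_cases hP hB hi hβ.1 with h | h | h
  · exact h
  · exfalso
    apply hβ.2
    rw [geom_s_apply, form_comm, h, zero_smul, sub_zero]
    exact hβ.1
  · have := hlt β hβ.1 h
    omega

theorem Raises.not_perp (hP : FormPosDef G) {B : Finset (ι → ℤ)} (hB : IsOrthoSet G B) {i : ι}
    (h : Raises G i B) : ¬ Perp G i B := fun hp => by
  obtain ⟨-, β, hβ, h1, -⟩ := h.exists hP hB
  rw [hp β hβ] at h1
  omega

/-- The lowest root of `B` not orthogonal to `α_i` decides: product `-1` means that `i` raises `B`,
product `1` that it lowers `B`. -/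
theorem raises_trichotomy (hP : FormPosDef G) {B : Finset (ι → ℤ)} (hB : IsOrthoSet G B) (i : ι) :
    act G (s G i) B = B ∨ Raises G i B ∨ Raises G i (act G (s G i) B) := by
  by_cases hi : simpleRoot i ∈ B
  · exact Or.inl (act_s_of_mem hB hi)
  by_cases hp : Perp G i B
  · exact Or.inl (act_s_of_perp hB hp)
  right
  simp only [Perp, not_forall] at hp
  obtain ⟨β₁, hβ₁, h0⟩ := hp
  obtain ⟨β, hβ, hmin⟩ := Finset.exists_min_image
    (B.filter fun δ => form G (simpleRoot i) δ ≠ 0) height ⟨β₁, by simp [hβ₁, h0]⟩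
  rw [Finset.mem_filter] at hβ
  obtain ⟨hβ, h1⟩ := hβ
  -- This covers ties as well: a root of product `1` at the minimal height drops below every other
  -- moved root, so `B` is being lowered.
  have key : ∀ γ ∈ B, form G (simpleRoot i) γ = 1 → height γ = height β →
      Raises G i (act G (s G i) B) := by
    intro γ hγ h2 h3
    refine raises_of_exists hP (hB.act _) (geom_s_mem_act hP hB hi hγ)
      (by rw [form_simple_geom_s, h2]) fun δ hδ h4 => ?_
    rw [mem_act_s hP hB hi] at hδ
    have h5 := form_simple_geom_s (G := G) i δ
    have h6 := hmin _ (Finset.mem_filter.2 ⟨hδ, by omega⟩)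
    rw [height_geom_s] at h6 ⊢
    omega
  rcases form_cases hP hB hi hβ with h | h | h
  · by_cases hex : ∃ γ ∈ B, form G (simpleRoot i) γ = 1 ∧ height γ ≤ height β
    · obtain ⟨γ, hγ, h2, h3⟩ := hex
      have h4 := hmin γ (Finset.mem_filter.2 ⟨hγ, by omega⟩)
      exact Or.inr (key γ hγ h2 (by omega))
    · push Not at hex
      exact Or.inl (raises_of_exists hP hB hβ h hex)
  · exact absurd h h1
  · exact Or.inr (key β hβ h rfl)

theorem perp_act_not_adj {B : Finset (ι → ℤ)} (hB : IsOrthoSet G B) {i j : ι}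
    (hne : i ≠ j) (h : ¬ G.Adj i j) : Perp G i (act G (s G j) B) ↔ Perp G i B := by
  have key : ∀ B : Finset (ι → ℤ), IsOrthoSet G B → Perp G i B → Perp G i (act G (s G j) B) := by
    intro B hB hp γ hγ
    obtain ⟨β, hβ, rfl⟩ := mem_act.1 hγ
    have := abs_form_of_eq_or_neg (G := G) (Or.inl (rfl : simpleRoot i = simpleRoot i))
      (posRep_eq_or (geom G (s G j) β))
    rwa [form_simple_geom_s_not_adj hne.symm (fun h' => h h'.symm), hp β hβ, abs_zero,
      abs_eq_zero] at this
  refine ⟨fun hp => ?_, key B hB⟩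
  rw [← act_s_s hB j]
  exact key _ (hB.act _) hp

theorem perp_act_self {B : Finset (ι → ℤ)} (hB : IsOrthoSet G B) {j : ι} :
    Perp G j (act G (s G j) B) ↔ Perp G j B := by
  have key : ∀ B : Finset (ι → ℤ), IsOrthoSet G B → Perp G j B → Perp G j (act G (s G j) B) := by
    intro B hB hp
    rwa [act_s_of_perp hB hp]
  refine ⟨fun hp => ?_, key B hB⟩
  rw [← act_s_s hB j]
  exact key _ (hB.act _) hp

/-- If `α_i ⊥ B` and `i ∼ j`, then `α_j ⊥ r_i r_j B`. -/
theorem perp_act_act {B : Finset (ι → ℤ)} {i j : ι} (hij : G.Adj i j) (hp : Perp G i B)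
    (hB : IsOrthoSet G B) : Perp G j (act G (s G i) (act G (s G j) B)) := by
  intro γ hγ
  rw [← act_mul hB.1] at hγ
  obtain ⟨β, hβ, rfl⟩ := mem_act.1 hγ
  have := abs_form_of_eq_or_neg (G := G) (Or.inl (rfl : simpleRoot j = simpleRoot j))
      (posRep_eq_or (geom G (s G i * s G j) β))
  rw [geom_mul_apply, form_simple_geom_s_adj hij, form_simple_geom_s_adj hij.symm,
    form_simple_geom_s, hp β hβ] at this
  rw [geom_mul_apply]
  simpa using this

/-- Raising `B ⊥ α_i` by a neighbour `j` of `i` makes it possible to raise by `i`. -/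
theorem Raises.raises_of_perp (hP : FormPosDef G) {B : Finset (ι → ℤ)} (hB : IsOrthoSet G B)
    {i j : ι} (hij : G.Adj i j) (hp : Perp G i B) (h : Raises G j B) :
    Raises G i (act G (s G j) B) := by
  obtain ⟨hj, β, hβ, h1, h2⟩ := h.exists hP hB
  refine raises_of_exists hP (hB.act _) (geom_s_mem_act hP hB hj hβ) ?_ fun γ hγ h3 => ?_
  · rw [form_simple_geom_s_adj hij.symm, h1, hp β hβ]
    norm_num
  · rw [mem_act_s hP hB hj] at hγ
    have h4 := hp _ hγ
    have h5 := form_simple_geom_s (G := G) j γ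
    have h6 := form_simple_geom_s_adj (G := G) hij.symm γ
    have h7 := h2 _ hγ (by omega)
    -- A gap of exactly two would become a tie after `r_j`; excluding it leaves a strict inequality.
    have h8 := height_ne_of_opposite_adj hB hij hβ hγ h1 (by omega) (hp β hβ) h4
    have h9 := height_geom_s (G := G) j γ
    rw [height_geom_s, h1]
    omega

/-- If `β` and `β + α_i + α_j` belong to the admissible set `B`, then `r_i B = r_j B`. -/
theorem act_s_eq_act_s (hP : FormPosDef G) {B : Finset (ι → ℤ)} (hB : IsAdmissible G B)
    {i j : ι} (hne : i ≠ j) (hij : ¬ G.Adj i j) (hi : simpleRoot i ∉ B) (hj : simpleRoot j ∉ B)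
    {β : ι → ℤ} (hβ : β ∈ B) (hγ : β + simpleRoot i + simpleRoot j ∈ B) :
    act G (s G i) B = act G (s G j) B := by
  have hβγ : β ≠ β + simpleRoot i + simpleRoot j := fun h => by
    have := congrArg height h
    rw [height_add, height_add, height_simple, height_simple] at this
    omega
  have h0 := hB.1.2 β hβ _ hγ hβγ
  have hij0 := form_simple_not_adj (G := G) hne hij
  rw [map_add, map_add, form_self (hB.1.1 β hβ).1, form_comm β, form_comm β] at h0
  have hbi : form G (simpleRoot i) β = -1 := by
    rcases form_cases hP hB.1 hi hβ with h | h | h <;>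
      rcases form_cases hP hB.1 hj hβ with h' | h' | h' <;> omega
  have hbj : form G (simpleRoot j) β = -1 := by omega
  refine Finset.eq_of_subset_of_card_le (fun δ' hδ' => ?_) (by rw [card_act hB.1, card_act hB.1])
  rw [mem_act_s hP hB.1 hi] at hδ'
  rw [mem_act_s hP hB.1 hj]
  obtain ⟨δ, rfl⟩ : ∃ δ, δ' = geom G (s G i) δ := ⟨geom G (s G i) δ', (geom_s_s _ _).symm⟩
  rw [geom_s_s] at hδ'
  have hcalc : geom G (s G j) (geom G (s G i) δ) =
      δ - form G (simpleRoot i) δ • simpleRoot i - form G (simpleRoot j) δ • simpleRoot j := by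
    rw [geom_s_apply j, form_comm, form_simple_geom_s_not_adj hne hij, geom_s_apply, form_comm δ]
  by_cases hδβ : δ = β
  · subst hδβ
    rw [hcalc, hbi, hbj]
    convert hγ using 1
    module
  by_cases hδγ : δ = β + simpleRoot i + simpleRoot j
  · subst hδγ
    rw [hcalc]
    simp only [map_add, form_simple_self, hij0, form_comm (simpleRoot j) (simpleRoot i), hbi, hbj]
    convert hβ using 1
    module
  have o1 := hB.1.2 δ hδ' β hβ hδβ
  have o2 := hB.1.2 δ hδ' _ hγ hδγ
  rw [map_add, map_add, o1, form_comm δ, form_comm δ] at o2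
  by_cases hz : form G (simpleRoot i) δ = 0
  · rw [hcalc, hz, show form G (simpleRoot j) δ = 0 by omega]
    simpa using hδ'
  have hs : form G (simpleRoot i) δ = 1 ∨ form G (simpleRoot i) δ = -1 := by
    rcases form_cases hP hB.1 hi hδ' with h | h | h <;> tauto
  have hgi : form G (simpleRoot i) (β + simpleRoot i + simpleRoot j) = 1 := by
    rw [map_add, map_add, hbi, form_simple_self, hij0]
    norm_num
  -- `α_i` is joined to the three elements `β`, `β + α_i + α_j` and `δ` of `B`. The root that
  -- admissibility then puts in `B` is `r_j r_i δ` up to sign, so `r_i δ` lies in `r_j B`.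
  have hadm := admissible_root hB hβ hγ hδ' hβγ (Ne.symm hδβ) (Ne.symm hδγ)
    (simpleRoot_mem_roots i) (by rw [Joined, hbi]; norm_num) (by rw [Joined, hgi]; norm_num)
    (by rw [Joined]; rcases hs with h | h <;> rw [h] <;> norm_num)
  have hpos : geom G (s G j) (geom G (s G i) δ) ∈ posRoots G := by
    refine geom_s_mem_posRoots hP (geom_s_mem_posRoots hP (hB.1.1 δ hδ') fun h => hi (h ▸ hδ'))
      fun h => ?_
    have h' := congrArg (geom G (s G i)) h
    rw [geom_s_s, geom_simple_of_not_adj hne.symm fun h => hij h.symm] at h'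
    exact hj (h' ▸ hδ')
  have hbj' : form G (simpleRoot j) δ = -form G (simpleRoot i) δ := by omega
  rwa [posRep_eq_of_eq_or_neg hpos] at hadm
  rw [hcalc, hbi, hgi, hbj']
  rcases hs with h | h <;> rw [h]
  · right
    module
  · left
    module

/-- The witness `β` for raising by `j` still works after `r_i` unless some `γ` two levels above `β`
is moved down by `i` and `j` while `i` moves `β` up. Then `γ - β - 2α_i - α_j` is a root of height
`-1` with product `-2` with `α_i`, hence equals `-α_i`, and `γ = β + α_i + α_j`. -/
theorem Raises.diamond_aux (hP : FormPosDef G) {B : Finset (ι → ℤ)} (hB : IsAdmissible G B)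
    {i j : ι} (hne : i ≠ j) (hij : ¬ G.Adj i j) (hi : Raises G i B) (hj : Raises G j B) :
    (act G (s G i) B = act G (s G j) B ∧ ∃ β ∈ B, β + simpleRoot i + simpleRoot j ∈ B) ∨
      Raises G j (act G (s G i) B) := by
  obtain ⟨hi0, -⟩ := hi.exists hP hB.1
  obtain ⟨hj0, β, hβ, h1, h2⟩ := hj.exists hP hB.1
  by_cases hex : ∃ γ ∈ B, form G (simpleRoot j) γ = 1 ∧ form G (simpleRoot i) γ = 1 ∧
      form G (simpleRoot i) β = -1 ∧ height γ = height β + 2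
  · left
    obtain ⟨γ, hγ, h3, h4, h5, h6⟩ := hex
    have hne' : γ ≠ β := fun h => by rw [h, h1] at h3; omega
    have hij0 := form_simple_not_adj (G := G) hne hij
    have hγ' : γ - simpleRoot i ∈ roots G :=
      sub_mem_roots (hB.1.1 γ hγ).1 (simpleRoot_mem_roots i) (by rw [form_comm, h4])
    have hβ' : β + simpleRoot i ∈ roots G :=
      add_mem_roots (hB.1.1 β hβ).1 (simpleRoot_mem_roots i) (by rw [form_comm, h5])
    have h7 : γ - simpleRoot i - simpleRoot j ∈ roots G := by
      refine sub_mem_roots hγ' (simpleRoot_mem_roots j) ?_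
      rw [map_sub, LinearMap.sub_apply, form_comm, h3, hij0]
      norm_num
    have h8 : γ - simpleRoot i - simpleRoot j - (β + simpleRoot i) ∈ roots G := by
      refine sub_mem_roots h7 hβ' ?_
      simp only [map_sub, map_add, LinearMap.sub_apply, h1, h5, form_comm γ (simpleRoot i), h4,
        form_comm (simpleRoot j) (simpleRoot i), form_simple_self, hB.1.2 γ hγ β hβ hne', hij0]
      norm_num
    obtain ⟨k, hk⟩ := exists_neg_simpleRoot h8 (by
      simp only [height_sub, height_add, height_simple]
      omega)
    have h9 : form G (simpleRoot i) (-simpleRoot k) = -2 := by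
      rw [← hk]
      simp only [map_sub, map_add, h4, h5, form_simple_self, hij0]
      norm_num
    have hik : i = k := by
      by_contra hik
      have := form_simple_nonpos (G := G) hik
      rw [map_neg] at h9
      omega
    subst hik
    have hγe : γ = β + simpleRoot i + simpleRoot j := by
      have : γ - simpleRoot i - simpleRoot j - (β + simpleRoot i) + simpleRoot i
        + (β + simpleRoot i + simpleRoot j) = β + simpleRoot i + simpleRoot j := by rw [hk]; module
      rw [← this]
      module
    rw [hγe] at hγ
    exact ⟨act_s_eq_act_s hP hB hne hij hi0 hj0 hβ hγ, β, hβ, hγ⟩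
  · right
    push Not at hex
    refine raises_of_exists hP (hB.1.act _) (geom_s_mem_act hP hB.1 hi0 hβ)
      (by rw [form_simple_geom_s_not_adj hne hij, h1]) fun γ hγ h3 => ?_
    rw [mem_act_s hP hB.1 hi0] at hγ
    have h4 := form_simple_geom_s_not_adj (G := G) hne hij γ
    have h5 := h2 _ hγ (by omega)
    have h6 := hex _ hγ (by omega)
    have h7 := form_cases hP hB.1 hi0 hγ
    have h8 := form_cases hP hB.1 hi0 hβ
    have h9 := height_geom_s (G := G) i γ
    have h10 := form_simple_geom_s (G := G) i γ
    rw [height_geom_s]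
    by_cases h11 : form G (simpleRoot i) (geom G (s G i) γ) = 1
    · by_cases h12 : form G (simpleRoot i) β = -1
      · have := h6 h11 h12
        omega
      · omega
    · omega

theorem Raises.diamond (hP : FormPosDef G) {B : Finset (ι → ℤ)} (hB : IsAdmissible G B)
    {i j : ι} (hne : i ≠ j) (hij : ¬ G.Adj i j) (hi : Raises G i B) (hj : Raises G j B) :
    (act G (s G i) B = act G (s G j) B ∧ ∃ β ∈ B, β + simpleRoot i + simpleRoot j ∈ B) ∨
      (Raises G j (act G (s G i) B) ∧ Raises G i (act G (s G j) B)) := by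
  rcases hi.diamond_aux hP hB hne hij hj with h | h
  · exact Or.inl h
  rcases hj.diamond_aux hP hB hne.symm (fun h => hij h.symm) hi with ⟨h', β, hβ, hγ⟩ | h'
  · exact Or.inl ⟨h'.symm, β, hβ, by rwa [add_right_comm]⟩
  · exact Or.inr ⟨h, h'⟩

/-- `α_i + α_j` is a root that is too low to lie in `B`, so its products with elements of `B` are
`-1`, `0` or `1`. This bounds how a root can react to `i` and `j` together; the rest compares
heights. -/
theorem Raises.hexagon (hP : FormPosDef G) {B : Finset (ι → ℤ)} (hB : IsOrthoSet G B)
    {i j : ι} (hij : G.Adj i j) (hi : Raises G i B) (hj : Raises G j B) :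
    Raises G j (act G (s G i) B) ∧ Raises G i (act G (s G j) (act G (s G i) B)) := by
  obtain ⟨hi0, β, hβ, h1, h2⟩ := hi.exists hP hB
  obtain ⟨hj0, γ, hγ, h3, h4⟩ := hj.exists hP hB
  have hij0 : simpleRoot i + simpleRoot j ∉ B := fun h => by
    have h5 := h2 _ h (by rw [map_add, form_simple_self, form_simple_adj hij]; norm_num)
    rw [height_add, height_simple, height_simple] at h5
    have := height_pos (hB.1 β hβ)
    omega
  have hsum : ∀ δ ∈ B, form G (simpleRoot i) δ + form G (simpleRoot j) δ ≤ 1 ∧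
      -1 ≤ form G (simpleRoot i) δ + form G (simpleRoot j) δ := by
    intro δ hδ
    have hr : simpleRoot i + simpleRoot j ∈ roots G :=
      add_mem_roots (simpleRoot_mem_roots i) (simpleRoot_mem_roots j) (form_simple_adj hij)
    have h5 : simpleRoot i + simpleRoot j ∈ posRoots G := mem_posRoots_of_height_pos hr (by
      rw [height_add, height_simple, height_simple]; norm_num)
    have := joined_or_perp hP hr (hB.1 δ hδ).1 (fun h => hij0 (h ▸ hδ)) fun h => by
      rw [h] at h5
      exact not_neg_mem_posRoots (hB.1 δ hδ) h5
    rw [map_add, LinearMap.add_apply] at this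
    omega
  have hci := fun δ (hδ : δ ∈ B) => form_cases hP hB hi0 hδ
  have hcj := fun δ (hδ : δ ∈ B) => form_cases hP hB hj0 hδ
  have hjB : simpleRoot j ∉ act G (s G i) B := by
    rw [mem_act_s hP hB hi0, geom_simple_add hij.symm, add_comm]
    exact hij0
  have sβ := hsum β hβ
  have sγ := hsum γ hγ
  have cβ := hcj β hβ
  have cγ := hci γ hγ
  constructor
  · have key : ∀ δ ∈ B, form G (simpleRoot i) δ + form G (simpleRoot j) δ = -1 →
        (∀ ε ∈ B, form G (simpleRoot i) ε + form G (simpleRoot j) ε = 1 →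
          height δ - form G (simpleRoot i) δ < height ε - form G (simpleRoot i) ε) →
        Raises G j (act G (s G i) B) := by
      intro δ hδ h5 h6
      refine raises_of_exists hP (hB.act _) (geom_s_mem_act hP hB hi0 hδ)
        (by rw [form_simple_geom_s_adj hij, h5]) fun ε' hε' h7 => ?_
      rw [mem_act_s hP hB hi0] at hε'
      have h8 := h6 _ hε' (by rw [← form_simple_geom_s_adj hij, geom_s_s, h7])
      rwa [← height_geom_s, ← height_geom_s, geom_s_s] at h8
    -- A root of `r_i B` has as product with `α_j` the product of its preimage with `α_i + α_j`. The
    -- witness for raising by `j` must therefore have product `-1` with `α_i + α_j`: it is `β` in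
    -- the case below, and otherwise `γ`, which is then orthogonal to `α_i`.
    by_cases hw : form G (simpleRoot j) β = 0 ∧
        (height β + 1 ≤ height γ ∨ form G (simpleRoot i) γ = 1)
    · refine key β hβ (by omega) fun ε hε h5 => ?_
      have h6 := hci ε hε
      have h7 := hcj ε hε
      have h8 := h2 ε hε
      have h9 := h4 ε hε
      have h10 := h2 γ hγ
      by_cases h11 : form G (simpleRoot i) ε = 1
      · have h12 := height_ne_of_opposite_adj hB hij.symm hβ hε h1 h11 hw.1 (by omega)
        have := h8 h11
        omega
      · have := h9 (by omega)
        rcases hw.2 with h | h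
        · omega
        · have := h10 h
          omega
    · have hγ0 : form G (simpleRoot i) γ = 0 := by
        have h5 := h4 β hβ
        have h6 := h2 γ hγ
        by_contra hne
        have h7 : form G (simpleRoot i) γ = 1 := by omega
        have h8 := h6 h7
        have h9 : form G (simpleRoot j) β ≠ 0 := fun h => hw ⟨h, Or.inr h7⟩
        have h10 := h5 (by omega)
        omega
      refine key γ hγ (by omega) fun ε hε h5 => ?_
      have h6 := hci ε hε
      have h7 := hcj ε hε
      have h8 := h2 ε hε
      have h9 := h4 ε hε
      have h10 := h4 β hβ
      by_cases h11 : form G (simpleRoot i) ε = 1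
      · have h12 := h8 h11
        by_cases h13 : form G (simpleRoot j) β = 0
        · have h14 : ¬ height β + 1 ≤ height γ := fun h => hw ⟨h13, Or.inl h⟩
          omega
        · have := h10 (by omega)
          omega
      · have := h9 (by omega)
        omega
  · have hBi := hB.act (s G i)
    have hhj : ∀ x : ι → ℤ, height (geom G (s G j) (geom G (s G i) x)) =
        height x - 2 * form G (simpleRoot i) x - form G (simpleRoot j) x := by
      intro x
      rw [height_geom_s, height_geom_s, form_simple_geom_s_adj hij]
      ring
    have hfj : ∀ x : ι → ℤ, form G (simpleRoot i) (geom G (s G j) (geom G (s G i) x)) =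
        form G (simpleRoot j) x := by
      intro x
      rw [form_simple_geom_s_adj hij.symm, form_simple_geom_s_adj hij, form_simple_geom_s]
      ring
    refine raises_of_exists hP (hBi.act _)
      (geom_s_mem_act hP hBi hjB (geom_s_mem_act hP hB hi0 hγ)) (by rw [hfj, h3])
      fun ε' hε' h5 => ?_
    rw [mem_act_s hP hBi hjB, mem_act_s hP hB hi0] at hε'
    obtain ⟨ε, rfl⟩ : ∃ ε, ε' = geom G (s G j) (geom G (s G i) ε) :=
      ⟨geom G (s G i) (geom G (s G j) ε'), by rw [geom_s_s, geom_s_s]⟩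
    rw [geom_s_s, geom_s_s] at hε'
    rw [hfj] at h5
    have h6 := h4 ε hε' h5
    have h7 := hci ε hε'
    have h8 := hsum ε hε'
    rw [hhj, hhj]
    -- Only roots `γ`, `ε` both orthogonal to `α_i` could end at equal heights, which would need a
    -- gap of exactly two; in all other cases `r_j r_i` closes the gap by less.
    by_cases h9 : form G (simpleRoot i) γ = 0 ∧ form G (simpleRoot i) ε = 0
    · have := height_ne_of_opposite_adj hB hij hγ hε' h3 h5 h9.1 h9.2
      omega
    · omega

/-! ### Termination -/

/-- A weight on sets of roots that decreases along the raising relation. -/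
def potential (N : ℕ) (M : ℤ) (B : Finset (ι → ℤ)) : ℕ := ∑ β ∈ B, N ^ (M - height β).toNat

/-- Each new root contributes at most `N ^ (M - height β - 1)`, and there are fewer than `N` of
them, so together they weigh less than the lost root `β`. The bound `M` on heights makes the
exponents honest natural numbers. -/
theorem Raises.potential_lt {B : Finset (ι → ℤ)} {i : ι} (h : Raises G i B) {N : ℕ} {M : ℤ}
    (hN : (act G (s G i) B).card < N)
    (hM : ∀ β ∈ act G (s G i) B, height β ≤ M) :
    potential N M (act G (s G i) B) < potential N M B := by
  obtain ⟨β, hβ, hlt⟩ := h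
  set A := act G (s G i) B
  have e1 : potential N M A = ∑ γ ∈ A \ B, N ^ (M - height γ).toNat
      + ∑ γ ∈ A ∩ B, N ^ (M - height γ).toNat := by
    rw [potential, ← Finset.sum_sdiff (Finset.inter_subset_left : A ∩ B ⊆ A)]
    simp
  have e2 : potential N M B = ∑ γ ∈ B \ A, N ^ (M - height γ).toNat
      + ∑ γ ∈ A ∩ B, N ^ (M - height γ).toNat := by
    rw [potential, ← Finset.sum_sdiff (Finset.inter_subset_right : A ∩ B ⊆ B)]
    simp
  rw [e1, e2]
  refine Nat.add_lt_add_right ?_ _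
  have h1 : N ^ (M - height β).toNat ≤ ∑ γ ∈ B \ A, N ^ (M - height γ).toNat :=
    Finset.single_le_sum (f := fun γ => N ^ (M - height γ).toNat) (fun _ _ => Nat.zero_le _) hβ
  refine lt_of_lt_of_le ?_ h1
  rcases (A \ B).eq_empty_or_nonempty with he | ⟨γ₀, hγ₀⟩
  · rw [he, Finset.sum_empty]
    exact pow_pos (by omega) _
  have hγ1 := hlt γ₀ hγ₀
  have hγ2 := hM γ₀ (Finset.mem_sdiff.1 hγ₀).1
  calc ∑ γ ∈ A \ B, N ^ (M - height γ).toNat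
      ≤ (A \ B).card • N ^ ((M - height β).toNat - 1) := by
        refine Finset.sum_le_card_nsmul _ _ _ fun γ hγ => Nat.pow_le_pow_right (by omega) ?_
        have := hlt γ hγ
        have := hM γ (Finset.mem_sdiff.1 hγ).1
        omega
    _ < N * N ^ ((M - height β).toNat - 1) := by
        rw [smul_eq_mul]
        refine Nat.mul_lt_mul_of_pos_right ?_ (pow_pos (by omega) _)
        exact lt_of_le_of_lt (Finset.card_le_card Finset.sdiff_subset) hN
    _ = N ^ (M - height β).toNat := by
        rw [← pow_succ']
        congr 1
        omega

/-- The finitely many roots give a uniform height bound, and the cardinality is constant on the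
orbit, so one potential serves everywhere. The rank drives all the inductions towards `X` below. -/
theorem exists_rank (hP : FormPosDef G) {X : Finset (ι → ℤ)} (hX : IsOrthoSet G X) :
    ∃ rk : Finset (ι → ℤ) → ℕ, ∀ B ∈ orbit G X, ∀ i, Raises G i B →
      rk (act G (s G i) B) < rk B := by
  obtain ⟨M, hM⟩ := ((roots_finite hP).image height).bddAbove
  refine ⟨potential (X.card + 1) M, ?_⟩
  rintro _ ⟨w, rfl⟩ i h
  refine h.potential_lt ?_ fun β hβ => hM ⟨β, (((hX.act w).act _).1 β hβ).1, rfl⟩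
  rw [card_act (hX.act w), card_act hX]
  exact Nat.lt_succ_self _

/-! ### The orbit of the highest element -/

theorem act_comm {B : Finset (ι → ℤ)} (hB : IsOrthoSet G B) {i j : ι} (hne : i ≠ j)
    (h : ¬ G.Adj i j) :
    act G (s G i) (act G (s G j) B) = act G (s G j) (act G (s G i) B) := by
  rw [← act_mul hB.1, ← act_mul hB.1, s_comm hne h]

theorem act_braid {B : Finset (ι → ℤ)} (hB : IsOrthoSet G B) {i j : ι} (h : G.Adj i j) :
    act G (s G i) (act G (s G j) (act G (s G i) B)) =
      act G (s G j) (act G (s G i) (act G (s G j) B)) := by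
  have h3 : ∀ a b c : W G, act G a (act G b (act G c B)) = act G (a * b * c) B := fun a b c => by
    rw [mul_assoc, act_mul hB.1, act_mul hB.1]
  rw [h3, h3, s_braid h]

theorem IsAdmissible.of_mem_orbit {X B : Finset (ι → ℤ)} (hX : IsAdmissible G X)
    (hB : B ∈ orbit G X) : IsAdmissible G B := by
  obtain ⟨w, rfl⟩ := hB
  exact hX.act w

theorem act_mem_orbit {X B : Finset (ι → ℤ)} (hX : IsOrthoSet G X) (hB : B ∈ orbit G X)
    (w : W G) : act G w B ∈ orbit G X := by
  obtain ⟨v, rfl⟩ := hB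
  exact ⟨w * v, act_mul hX.1 w v⟩

/-- The rank does not increase along the order, so `X` has the least rank of its orbit; raising it
would give a smaller one. -/
theorem IsHighest.not_raises (hP : FormPosDef G) {X : Finset (ι → ℤ)} (hX : IsAdmissible G X)
    (hhigh : IsHighest G X) (j : ι) : ¬ Raises G j X := by
  intro hj
  obtain ⟨rk, hrk⟩ := exists_rank hP hX.1
  have hle : ∀ B B' : Finset (ι → ℤ), B ∈ orbit G X → le G B B' → rk B' ≤ rk B := by
    intro B B' hB h
    have : B' ∈ orbit G X ∧ rk B' ≤ rk B := by
      induction h with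
      | refl => exact ⟨hB, le_rfl⟩
      | tail _ hstep ih =>
        obtain ⟨i, hi, rfl⟩ := hstep
        exact ⟨act_mem_orbit hX.1 ih.1 _, (hrk _ ih.1 i hi).le.trans ih.2⟩
    exact this.2
  have h1 := hrk X (self_mem_orbit G hX.1) j hj
  have hmem := act_mem_orbit hX.1 (self_mem_orbit G hX.1) (s G j)
  have h2 := hle _ _ hmem (hhigh _ hmem)
  omega

theorem IsHighest.exists_raises {X : Finset (ι → ℤ)} (hhigh : IsHighest G X)
    {B : Finset (ι → ℤ)} (hB : B ∈ orbit G X) (hne : B ≠ X) : ∃ j, Raises G j B := by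
  rcases Relation.ReflTransGen.cases_head (hhigh B hB) with h | ⟨B', ⟨i, hi, -⟩, -⟩
  · exact absurd h hne
  · exact ⟨i, hi⟩

theorem perp_of_adj_iff {B : Finset (ι → ℤ)} (hB : IsOrthoSet G B) {i j : ι} (hij : G.Adj i j) :
    Perp G j (act G (s G i) (act G (s G j) B)) ↔ Perp G i B := by
  refine ⟨fun h => ?_, fun h => perp_act_act hij h hB⟩
  have h1 := perp_act_act hij.symm h ((hB.act _).act _)
  rwa [act_s_s (hB.act _), act_s_s hB] at h1

/-! ### The nodes `h_{B,i}` -/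

theorem HNode.perp {X B : Finset (ι → ℤ)} {i k : ι} (h : HNode G X B i k) : Perp G i B := by
  cases h <;> assumption

theorem HNode.mem_nodesC {X B : Finset (ι → ℤ)} {i k : ι} (h : HNode G X B i k) :
    k ∈ nodesC G X := by
  induction h with
  | base i h => exact h
  | comm => assumption
  | braid => assumption

/-- `k` is obtained for `(B, i)` by first raising `B` with `j`. -/
def HStep (G : SimpleGraph ι) [DecidableRel G.Adj] (X B : Finset (ι → ℤ)) (i j k : ι) : Prop :=
  (¬ G.Adj i j → HNode G X (act G (s G j) B) i k) ∧
    (G.Adj i j → HNode G X (act G (s G i) (act G (s G j) B)) j k)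

theorem HNode.exists_hStep {X : Finset (ι → ℤ)} {B : Finset (ι → ℤ)} {i k : ι}
    (h : HNode G X B i k) (hne : B ≠ X) :
    ∃ j, Raises G j B ∧ HStep G X B i j k := by
  cases h with
  | base => exact absurd rfl hne
  | comm _ _ j _ hp hij hadj hr h => exact ⟨j, hr, fun _ => h, fun h' => absurd h' hadj⟩
  | braid _ _ j _ hp hadj hr hr' h => exact ⟨j, hr, fun h' => absurd hadj h', fun _ => h⟩

theorem HNode.eq_of_top (hP : FormPosDef G) {X : Finset (ι → ℤ)} (hX : IsAdmissible G X)
    (hhigh : IsHighest G X) {i k : ι} (h : HNode G X X i k) : k = i := by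
  cases h with
  | base => rfl
  | comm _ _ j _ hp hij hadj hr h => exact absurd hr (hhigh.not_raises hP hX j)
  | braid _ _ j _ hp hadj hr hr' h => exact absurd hr (hhigh.not_raises hP hX j)

theorem Raises.ne_of_perp (hP : FormPosDef G) {B : Finset (ι → ℤ)} (hB : IsOrthoSet G B)
    {i j : ι} (hp : Perp G i B) (hj : Raises G j B) : i ≠ j := by
  rintro rfl
  exact hj.not_perp hP hB hp

theorem HStep.hNode (hP : FormPosDef G) {X B : Finset (ι → ℤ)} (hB : IsOrthoSet G B)
    {i j k : ι} (hp : Perp G i B) (hj : Raises G j B) (h : HStep G X B i j k) :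
    HNode G X B i k := by
  by_cases hij : G.Adj i j
  · exact HNode.braid B i j k hp hij hj (hj.raises_of_perp hP hB hij hp) (h.2 hij)
  · exact HNode.comm B i j k hp (hj.ne_of_perp hP hB hp) hij hj (h.1 hij)

/-! ### Local confluence of the recursion for `h_{B,i}` -/

section Confluence

variable {X : Finset (ι → ℤ)} {rk : Finset (ι → ℤ) → ℕ} {B : Finset (ι → ℤ)}

/-- The node `i` is unchanged by both raises, so both recursions can be continued around the diamond
or hexagon of `j` and `j'` to a common set of smaller rank. -/
theorem hStep_confluence_both_not_adj (hP : FormPosDef G) (hX : IsAdmissible G X)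
    (hrk : ∀ B ∈ orbit G X, ∀ i, Raises G i B → rk (act G (s G i) B) < rk B)
    (hB : B ∈ orbit G X)
    (ih : ∀ E ∈ orbit G X, rk E < rk B → ∀ i, Perp G i E → ∃ k, HNode G X E i k)
    {i j j' : ι} (hp : Perp G i B) (hj : Raises G j B) (hj' : Raises G j' B) (hne : j ≠ j')
    (hij : ¬ G.Adj i j) (hij' : ¬ G.Adj i j') :
    ∃ k, HStep G X B i j k ∧ HStep G X B i j' k := by
  have hBa := hX.of_mem_orbit hB
  have o {E : Finset (ι → ℤ)} (hE : E ∈ orbit G X) (l : ι) : act G (s G l) E ∈ orbit G X :=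
    act_mem_orbit hX.1 hE _
  have ho {E : Finset (ι → ℤ)} (hE : E ∈ orbit G X) : IsOrthoSet G E := (hX.of_mem_orbit hE).1
  have nj := hj.ne_of_perp hP hBa.1 hp
  have nj' := hj'.ne_of_perp hP hBa.1 hp
  have p1 := (perp_act_not_adj hBa.1 nj hij).2 hp
  have p1' := (perp_act_not_adj hBa.1 nj' hij').2 hp
  have r1 := hrk _ hB j hj
  have mk : ∀ k, HNode G X (act G (s G j) B) i k → HNode G X (act G (s G j') B) i k →
      ∃ k, HStep G X B i j k ∧ HStep G X B i j' k := fun k h h' =>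
    ⟨k, ⟨fun _ => h, fun h => absurd h hij⟩, ⟨fun _ => h', fun h => absurd h hij'⟩⟩
  by_cases hjj : G.Adj j j'
  · obtain ⟨a1, a2⟩ := hj.hexagon hP hBa.1 hjj hj'
    obtain ⟨b1, b2⟩ := hj'.hexagon hP hBa.1 hjj.symm hj
    have p2 := (perp_act_not_adj (ho (o hB j)) nj' hij').2 p1
    have p2' := (perp_act_not_adj (ho (o hB j')) nj hij).2 p1'
    have p3 := (perp_act_not_adj (ho (o (o hB j) j')) nj hij).2 p2
    have r2 := hrk _ (o hB j) j' a1
    have r3 := hrk _ (o (o hB j) j') j a2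
    obtain ⟨k, hk⟩ := ih _ (o (o (o hB j) j') j) (by omega) i p3
    refine mk k (HNode.comm _ i j' k p1 nj' hij' a1 (HNode.comm _ i j k p2 nj hij a2 hk))
      (HNode.comm _ i j k p1' nj hij b1 (HNode.comm _ i j' k p2' nj' hij' b2 ?_))
    rwa [act_braid hBa.1 hjj] at hk
  · rcases hj.diamond hP hBa hne hjj hj' with ⟨h, -⟩ | ⟨a, b⟩
    · obtain ⟨k, hk⟩ := ih _ (o hB j) r1 i p1
      exact mk k hk (h ▸ hk)
    · have p2 := (perp_act_not_adj (ho (o hB j)) nj' hij').2 p1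
      have r2 := hrk _ (o hB j) j' a
      obtain ⟨k, hk⟩ := ih _ (o (o hB j) j') (by omega) i p2
      refine mk k (HNode.comm _ i j' k p1 nj' hij' a hk) (HNode.comm _ i j k p1' nj hij b ?_)
      rwa [act_comm hBa.1 hne hjj]

/-- If `j` and `j'` are not adjacent, both sides reach `r_{j'} r_i r_j B` with node `j`. If they are
adjacent, `i, j, j'` is a chain; both sides reach node `j'`, at two sets that differ by `r_i`, which
does not affect node `j'`. -/
theorem hStep_confluence_adj_not_adj (hP : FormPosDef G) (hX : IsAdmissible G X)
    (hrk : ∀ B ∈ orbit G X, ∀ i, Raises G i B → rk (act G (s G i) B) < rk B)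
    (hB : B ∈ orbit G X)
    (ih : ∀ E ∈ orbit G X, rk E < rk B → ∀ i, Perp G i E → ∃ k, HNode G X E i k)
    {i j j' : ι} (hp : Perp G i B) (hj : Raises G j B) (hj' : Raises G j' B) (hne : j ≠ j')
    (hij : G.Adj i j) (hij' : ¬ G.Adj i j') :
    ∃ k, HStep G X B i j k ∧ HStep G X B i j' k := by
  have hBa := hX.of_mem_orbit hB
  have o {E : Finset (ι → ℤ)} (hE : E ∈ orbit G X) (l : ι) : act G (s G l) E ∈ orbit G X :=
    act_mem_orbit hX.1 hE _
  have ha {E : Finset (ι → ℤ)} (hE : E ∈ orbit G X) : IsAdmissible G E := hX.of_mem_orbit hE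
  have ho {E : Finset (ι → ℤ)} (hE : E ∈ orbit G X) : IsOrthoSet G E := (ha hE).1
  have nj' := hj'.ne_of_perp hP hBa.1 hp
  have p1' := (perp_act_not_adj hBa.1 nj' hij').2 hp
  have hi := hj.raises_of_perp hP hBa.1 hij hp
  have r1 := hrk _ hB j hj
  have r1' := hrk _ hB j' hj'
  have r2 := hrk _ (o hB j) i hi
  have q2 := perp_act_act hij hp hBa.1
  have mk : ∀ k, HNode G X (act G (s G i) (act G (s G j) B)) j k →
      HNode G X (act G (s G j') B) i k →
      ∃ k, HStep G X B i j k ∧ HStep G X B i j' k := fun k h h' =>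
    ⟨k, ⟨fun h' => absurd hij h', fun _ => h⟩, ⟨fun _ => h', fun h => absurd h hij'⟩⟩
  by_cases hjj : G.Adj j j'
  · obtain ⟨a1, a2⟩ := hj.hexagon hP hBa.1 hjj hj'
    obtain ⟨b1, b2⟩ := hj'.hexagon hP hBa.1 hjj.symm hj
    -- from `r_j B`
    have hd1 : Raises G j' (act G (s G i) (act G (s G j) B)) := by
      -- The degenerate diamond would make `α_j` orthogonal to `r_{j'} r_j B`, a set that `j`
      -- raises.
      rcases hi.diamond hP (ha (o hB j)) nj' hij' a1 with ⟨h, -⟩ | ⟨h, -⟩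
      · rw [h] at q2
        exact absurd q2 (a2.not_perp hP (ho (o (o hB j) j')))
      · exact h
    have hS := o (o hB j) i
    have r3 := hrk _ hS j' hd1
    have c1 := hd1.raises_of_perp hP (ho hS) hjj q2
    have r4 := hrk _ (o hS j') j c1
    have q3 := perp_act_act hjj q2 (ho hS)
    -- from `r_j' B`
    have hD := o hB j'
    have d1 := b1.raises_of_perp hP (ho hD) hij p1'
    have q2' := perp_act_act hij p1' (ho hD)
    have hd2 : Raises G j' (act G (s G i) (act G (s G j) (act G (s G j') B))) := by
      rcases d1.diamond hP (ha (o hD j)) nj' hij' b2 with ⟨h, -⟩ | ⟨h, -⟩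
      · rw [h, ← act_braid hBa.1 hjj, perp_act_self (ho (o (o hB j) j'))] at q2'
        exact absurd q2' (a2.not_perp hP (ho (o (o hB j) j')))
      · exact h
    have hF := o (o hD j) i
    have c2 := hd2.raises_of_perp hP (ho hF) hjj q2'
    have q3' := perp_act_act hjj q2' (ho hF)
    have s1 := hrk _ hD j b1
    have s2 := hrk _ (o hD j) i d1
    have s3 := hrk _ hF j' hd2
    have s4 := hrk _ (o hF j') j c2
    -- the two ends are related by `r_i`
    have hT : act G (s G j) (act G (s G j') (act G (s G i) (act G (s G j) (act G (s G j') B)))) =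
        act G (s G i) (act G (s G j) (act G (s G j') (act G (s G i) (act G (s G j) B)))) := by
      have e : s G j * s G j' * s G i * s G j * s G j' =
          s G i * s G j * s G j' * s G i * s G j := by
        have e1 := s_comm nj' hij'
        have e2 := s_braid hij
        have e3 := s_braid hjj
        calc s G j * s G j' * s G i * s G j * s G j'
            = s G j * (s G j' * s G i) * s G j * s G j' := by simp only [mul_assoc]
          _ = s G j * s G i * (s G j' * s G j * s G j') := by rw [← e1]; simp only [mul_assoc]
          _ = (s G j * s G i * s G j) * s G j' * s G j := by rw [← e3]; simp only [mul_assoc]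
          _ = s G i * s G j * (s G i * s G j') * s G j := by rw [← e2]; simp only [mul_assoc]
          _ = s G i * s G j * s G j' * s G i * s G j := by rw [e1]; simp only [mul_assoc]
      have h5 : ∀ a b c d e : ι, act G (s G a) (act G (s G b) (act G (s G c)
          (act G (s G d) (act G (s G e) B)))) = act G (s G a * s G b * s G c * s G d * s G e) B := by
        intro a b c d e
        rw [mul_assoc, mul_assoc, mul_assoc, act_mul hBa.1.1, act_mul hBa.1.1, act_mul hBa.1.1,
          act_mul hBa.1.1]
      rw [h5, h5, e]
    have hjo := o (o hS j') j
    have nij' := nj'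
    have key : ∃ k, HNode G X (act G (s G j) (act G (s G j') (act G (s G i) (act G (s G j) B))))
        j' k ∧ HNode G X (act G (s G j) (act G (s G j') (act G (s G i)
          (act G (s G j) (act G (s G j') B))))) j' k := by
      -- Whichever direction `r_i` has between the two ends, the commuting rule passes the same node
      -- from the higher to the lower one.
      rcases raises_trichotomy hP (ho hjo) i with h | h | h
      · obtain ⟨k, hk⟩ := ih _ hjo (by omega) j' q3
        exact ⟨k, hk, by rwa [hT, h]⟩
      · obtain ⟨k, hk⟩ := ih _ (o (o hF j') j) (by omega) j' q3'
        exact ⟨k, HNode.comm _ j' i k q3 nij'.symm (fun h => hij' h.symm) h (hT ▸ hk), hk⟩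
      · obtain ⟨k, hk⟩ := ih _ hjo (by omega) j' q3
        rw [← hT] at h
        refine ⟨k, hk, HNode.comm _ j' i k q3' nij'.symm (fun h => hij' h.symm) h ?_⟩
        rwa [hT, act_s_s (ho hjo)]
    obtain ⟨k, hk1, hk2⟩ := key
    refine mk k (HNode.braid _ j j' k q2 hjj hd1 c1 hk1)
      (HNode.braid _ i j k p1' hij b1 d1 (HNode.braid _ j j' k q2' hjj hd2 c2 hk2))
  · rcases hj.diamond hP hBa hne hjj hj' with ⟨h, -⟩ | ⟨a, b⟩
    · rw [← h] at p1'
      exact absurd p1' (hi.not_perp hP (ho (o hB j)))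
    · have hd1 : Raises G j' (act G (s G i) (act G (s G j) B)) := by
        rcases hi.diamond hP (ha (o hB j)) nj' hij' a with ⟨h, -⟩ | ⟨h, -⟩
        · rw [h, act_comm hBa.1 hne.symm fun h => hjj h.symm,
            perp_act_self (ho (o hB j'))] at q2
          exact absurd q2 (b.not_perp hP (ho (o hB j')))
        · exact h
      have hS := o (o hB j) i
      have q3 := (perp_act_not_adj (ho hS) hne hjj).2 q2
      have r3 := hrk _ hS j' hd1
      obtain ⟨k, hk⟩ := ih _ (o hS j') (by omega) j q3
      refine mk k (HNode.comm _ j j' k q2 hne hjj hd1 hk) (HNode.braid _ i j k p1' hij b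
        (b.raises_of_perp hP (ho (o hB j')) hij p1') ?_)
      rwa [act_comm hBa.1 hne hjj, act_comm (hBa.1.act _) nj' hij']

/-- Here `j` and `j'` are not adjacent, since there are no triangles. The node runs from `i` to `j`
and back to `i` on one side, and from `i` to `j'` and back on the other, both ending at `r_j r_i
r_{j'} r_i r_j B`. The degenerate diamond is impossible, as `β` and `β + α_j + α_{j'}` cannot both
be orthogonal to `α_i`. -/
theorem hStep_confluence_both_adj (hP : FormPosDef G) (hX : IsAdmissible G X)
    (hrk : ∀ B ∈ orbit G X, ∀ i, Raises G i B → rk (act G (s G i) B) < rk B)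
    (hB : B ∈ orbit G X)
    (ih : ∀ E ∈ orbit G X, rk E < rk B → ∀ i, Perp G i E → ∃ k, HNode G X E i k)
    {i j j' : ι} (hp : Perp G i B) (hj : Raises G j B) (hj' : Raises G j' B) (hne : j ≠ j')
    (hij : G.Adj i j) (hij' : G.Adj i j') :
    ∃ k, HStep G X B i j k ∧ HStep G X B i j' k := by
  have hBa := hX.of_mem_orbit hB
  have o {E : Finset (ι → ℤ)} (hE : E ∈ orbit G X) (l : ι) : act G (s G l) E ∈ orbit G X :=
    act_mem_orbit hX.1 hE _
  have ha {E : Finset (ι → ℤ)} (hE : E ∈ orbit G X) : IsAdmissible G E := hX.of_mem_orbit hE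
  have ho {E : Finset (ι → ℤ)} (hE : E ∈ orbit G X) : IsOrthoSet G E := (ha hE).1
  have hjj : ¬ G.Adj j j' := triangle_free hP hij.symm hij'
  have half : ∀ {j j' : ι}, Raises G j B → G.Adj i j → G.Adj i j' → j ≠ j' → ¬ G.Adj j j' →
      Raises G j' (act G (s G j) B) → ∀ k, HNode G X (act G (s G j) (act G (s G i) (act G (s G j')
        (act G (s G i) (act G (s G j) B))))) i k →
      rk (act G (s G j) (act G (s G i) (act G (s G j')
        (act G (s G i) (act G (s G j) B))))) < rk B ∧ HStep G X B i j k := by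
    intro j j' hj hij hij' hne hjj a k hk
    have hi := hj.raises_of_perp hP hBa.1 hij hp
    have q2 := perp_act_act hij hp hBa.1
    obtain ⟨c1, c2⟩ := hi.hexagon hP (ho (o hB j)) hij' a
    have hS := o (o hB j) i
    have q3 := (perp_act_not_adj (ho hS) hne hjj).2 q2
    have c3 := c2.raises_of_perp hP (ho (o hS j')) hij.symm q3
    have r1 := hrk _ hB j hj
    have r2 := hrk _ (o hB j) i hi
    have r3 := hrk _ hS j' c1
    have r4 := hrk _ (o hS j') i c2
    have r5 := hrk _ (o (o hS j') i) j c3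
    exact ⟨by omega, fun h => absurd hij h, fun _ => HNode.comm _ j j' k q2 hne hjj c1
      (HNode.braid _ j i k q3 hij.symm c2 c3 hk)⟩
  have perpT : ∀ {j j' : ι}, Raises G j B → G.Adj i j → G.Adj i j' → j ≠ j' → ¬ G.Adj j j' →
      Raises G j' (act G (s G j) B) →
      Perp G i (act G (s G j) (act G (s G i) (act G (s G j')
        (act G (s G i) (act G (s G j) B))))) ∧ rk (act G (s G j) (act G (s G i) (act G (s G j')
        (act G (s G i) (act G (s G j) B))))) < rk B := by
    intro j j' hj hij hij' hne hjj a
    have hi := hj.raises_of_perp hP hBa.1 hij hp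
    have q2 := perp_act_act hij hp hBa.1
    obtain ⟨c1, c2⟩ := hi.hexagon hP (ho (o hB j)) hij' a
    have hS := o (o hB j) i
    have q3 := (perp_act_not_adj (ho hS) hne hjj).2 q2
    have c3 := c2.raises_of_perp hP (ho (o hS j')) hij.symm q3
    have r1 := hrk _ hB j hj
    have r2 := hrk _ (o hB j) i hi
    have r3 := hrk _ hS j' c1
    have r4 := hrk _ (o hS j') i c2
    have r5 := hrk _ (o (o hS j') i) j c3
    exact ⟨perp_act_act hij.symm q3 (ho (o hS j')), by omega⟩
  rcases hj.diamond hP hBa hne hjj hj' with ⟨-, β, hβ, hγ⟩ | ⟨a, b⟩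
  · exfalso
    have h1 := hp _ hγ
    rw [map_add, map_add, hp β hβ, form_simple_adj hij, form_simple_adj hij'] at h1
    omega
  · obtain ⟨p, r⟩ := perpT hj hij hij' hne hjj a
    obtain ⟨k, hk⟩ := ih _ (o (o (o (o (o hB j) i) j') i) j) r i p
    refine ⟨k, (half hj hij hij' hne hjj a k hk).2,
      (half hj' hij' hij hne.symm (fun h => hjj h.symm) b k ?_).2⟩
    convert hk using 1
    have e : s G j' * s G i * s G j * s G i * s G j' = s G j * s G i * s G j' * s G i * s G j := by
      have e1 := s_comm hne hjj
      have e2 := s_braid hij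
      have e3 := s_braid hij'
      calc s G j' * s G i * s G j * s G i * s G j'
          = s G j' * (s G i * s G j * s G i) * s G j' := by simp only [mul_assoc]
        _ = (s G j' * s G j) * s G i * (s G j * s G j') := by rw [e2]; simp only [mul_assoc]
        _ = s G j * (s G j' * s G i * s G j') * s G j := by rw [e1]; nth_rw 1 [← e1]; simp only [mul_assoc]
        _ = s G j * s G i * s G j' * s G i * s G j := by rw [← e3]; simp only [mul_assoc]
    have h5 : ∀ a b c d e : ι, act G (s G a) (act G (s G b) (act G (s G c)
        (act G (s G d) (act G (s G e) B)))) = act G (s G a * s G b * s G c * s G d * s G e) B := by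
      intro a b c d e
      rw [mul_assoc, mul_assoc, mul_assoc, act_mul hBa.1.1, act_mul hBa.1.1, act_mul hBa.1.1,
        act_mul hBa.1.1]
    rw [h5, h5, e]

end Confluence

/-- The node determining `h_{B,i}` exists and is unique. -/
theorem existsUnique_hNode (hP : FormPosDef G) {X : Finset (ι → ℤ)} (hX : IsAdmissible G X)
    (hhigh : IsHighest G X) (B : Finset (ι → ℤ)) (hB : B ∈ orbit G X) (i : ι) (hp : Perp G i B) :
    ∃! k, HNode G X B i k := by
  obtain ⟨rk, hrk⟩ := exists_rank hP hX.1
  induction hn : rk B using Nat.strong_induction_on generalizing B i with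
  | _ n ih =>
  subst hn
  have hBa := hX.of_mem_orbit hB
  have o {E : Finset (ι → ℤ)} (hE : E ∈ orbit G X) (l : ι) : act G (s G l) E ∈ orbit G X :=
    act_mem_orbit hX.1 hE _
  by_cases hBX : B = X
  · subst hBX
    exact ⟨i, HNode.base i hp, fun k hk => hk.eq_of_top hP hX hhigh⟩
  have ihE : ∀ E ∈ orbit G X, rk E < rk B → ∀ i, Perp G i E → ∃ k, HNode G X E i k :=
    fun E hE hlt i hp => (ih _ hlt E hE i hp rfl).exists
  have step_exists : ∀ j, Raises G j B → ∃ k, HStep G X B i j k := by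
    intro j hj
    have r1 := hrk _ hB j hj
    by_cases hij : G.Adj i j
    · have hi := hj.raises_of_perp hP hBa.1 hij hp
      have r2 := hrk _ (o hB j) i hi
      obtain ⟨k, hk⟩ := ihE _ (o (o hB j) i) (by omega) j (perp_act_act hij hp hBa.1)
      exact ⟨k, fun h => absurd hij h, fun _ => hk⟩
    · obtain ⟨k, hk⟩ := ihE _ (o hB j) r1 i
        ((perp_act_not_adj hBa.1 (hj.ne_of_perp hP hBa.1 hp) hij).2 hp)
      exact ⟨k, fun _ => hk, fun h => absurd h hij⟩
  have step_unique : ∀ j, Raises G j B → ∀ k k', HStep G X B i j k → HStep G X B i j k' →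
      k = k' := by
    intro j hj k k' h h'
    have r1 := hrk _ hB j hj
    by_cases hij : G.Adj i j
    · have hi := hj.raises_of_perp hP hBa.1 hij hp
      have r2 := hrk _ (o hB j) i hi
      exact (ih _ (r2.trans r1) _ (o (o hB j) i) j (perp_act_act hij hp hBa.1) rfl).unique
        (h.2 hij) (h'.2 hij)
    · exact (ih _ r1 _ (o hB j) i
        ((perp_act_not_adj hBa.1 (hj.ne_of_perp hP hBa.1 hp) hij).2 hp) rfl).unique
        (h.1 hij) (h'.1 hij)
  obtain ⟨j, hj⟩ := hhigh.exists_raises hB hBX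
  obtain ⟨k, hk⟩ := step_exists j hj
  refine ⟨k, hk.hNode hP hBa.1 hp hj, fun k' hk' => ?_⟩
  obtain ⟨j', hj', h'⟩ := hk'.exists_hStep hBX
  by_cases hjj : j = j'
  · subst hjj
    exact step_unique j hj k' k h' hk
  -- A node common to both first steps exists by local confluence; uniqueness after each first step,
  -- known by induction, identifies all three.
  obtain ⟨k₀, h1, h2⟩ : ∃ k, HStep G X B i j k ∧ HStep G X B i j' k := by
    by_cases hij : G.Adj i j <;> by_cases hij' : G.Adj i j'
    · exact hStep_confluence_both_adj hP hX hrk hB ihE hp hj hj' hjj hij hij'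
    · exact hStep_confluence_adj_not_adj hP hX hrk hB ihE hp hj hj' hjj hij hij'
    · obtain ⟨k, h1, h2⟩ :=
        hStep_confluence_adj_not_adj hP hX hrk hB ihE hp hj' hj (Ne.symm hjj) hij' hij
      exact ⟨k, h2, h1⟩
    · exact hStep_confluence_both_not_adj hP hX hrk hB ihE hp hj hj' hjj hij hij'
  rw [step_unique j hj k k₀ hk h1, step_unique j' hj' k' k₀ h' h2]

/-! ### The group generated by `annGens` -/

/-- The subgroup of `W` generated by `annGens G B`. -/
abbrev annGrp (G : SimpleGraph ι) [DecidableRel G.Adj] (B : Finset (ι → ℤ)) : Subgroup (W G) :=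
  Subgroup.closure (annGens G B)

theorem joined_comm {α β : ι → ℤ} : Joined G α β ↔ Joined G β α := by
  rw [Joined, Joined, form_comm]

theorem joined_geom (w : W G) {α β : ι → ℤ} :
    Joined G (geom G w α) (geom G w β) ↔ Joined G α β := by
  rw [Joined, Joined, form_geom]

theorem joined_posRep (α β : ι → ℤ) : Joined G (posRep α) (posRep β) ↔ Joined G α β := by
  rw [Joined, Joined, abs_form_of_eq_or_neg (posRep_eq_or α) (posRep_eq_or β)]

theorem rootRefl_posRep {α : ι → ℤ} (hα : α ∈ roots G) :
    rootRefl G (posRep α) = rootRefl G α :=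
  rootRefl_of_eq_or_neg hα (eq_or_neg_posRep α)

theorem rootRefl_mem_annGrp {B : Finset (ι → ℤ)} {β : ι → ℤ} (hβ : β ∈ B) :
    rootRefl G β ∈ annGrp G B :=
  Subgroup.subset_closure (Or.inl ⟨β, hβ, rfl⟩)

/-- The generators `r_α r_β r_γ r_α`, for a not necessarily positive root `α`. -/
theorem rootRefl_mul_mem_annGrp {B : Finset (ι → ℤ)} {α β γ : ι → ℤ} (hα : α ∈ roots G)
    (hβ : β ∈ B) (hγ : γ ∈ B) (h1 : Joined G β α) (h2 : Joined G α γ) :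
    rootRefl G α * rootRefl G β * rootRefl G γ * rootRefl G α ∈ annGrp G B := by
  refine Subgroup.subset_closure (Or.inr ⟨posRep α, posRep_mem hα, β, hβ, γ, hγ, ?_, ?_, ?_⟩)
  · rwa [Joined, abs_form_of_eq_or_neg (Or.inl rfl) (posRep_eq_or α)]
  · rwa [Joined, abs_form_of_eq_or_neg (posRep_eq_or α) (Or.inl rfl)]
  · rw [rootRefl_posRep hα]

theorem conj_mem_annGrp {B : Finset (ι → ℤ)} (hB : IsOrthoSet G B) (w : W G) {g : W G}
    (hg : g ∈ annGrp G B) : w * g * w⁻¹ ∈ annGrp G (act G w B) := by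
  have hr : ∀ {β : ι → ℤ}, β ∈ roots G →
      w * rootRefl G β * w⁻¹ = rootRefl G (posRep (geom G w β)) := fun hβ => by
    rw [rootRefl_posRep (geom_mem_roots hβ w), rootRefl_conj hβ]
  induction hg using Subgroup.closure_induction with
  | mem g hg =>
    rcases hg with ⟨β, hβ, rfl⟩ | ⟨α, hα, β, hβ, γ, hγ, h1, h2, rfl⟩
    · rw [hr (hB.1 β hβ).1]
      exact rootRefl_mem_annGrp (posRep_geom_mem_act hβ)
    · have e : w * (rootRefl G α * rootRefl G β * rootRefl G γ * rootRefl G α) * w⁻¹ =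
          (w * rootRefl G α * w⁻¹) * (w * rootRefl G β * w⁻¹) * (w * rootRefl G γ * w⁻¹) *
            (w * rootRefl G α * w⁻¹) := by group
      rw [e, hr hα.1, hr (hB.1 β hβ).1, hr (hB.1 γ hγ).1]
      exact rootRefl_mul_mem_annGrp (posRep_mem (geom_mem_roots hα.1 w)).1
        (posRep_geom_mem_act hβ) (posRep_geom_mem_act hγ)
        ((joined_posRep _ _).2 ((joined_geom w).2 h1)) ((joined_posRep _ _).2 ((joined_geom w).2 h2))
  | one => simp
  | mul x y _ _ hx hy =>
    have e : w * (x * y) * w⁻¹ = (w * x * w⁻¹) * (w * y * w⁻¹) := by group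
    exact e ▸ mul_mem hx hy
  | inv x _ hx =>
    have e : w * x⁻¹ * w⁻¹ = (w * x * w⁻¹)⁻¹ := by group
    exact e ▸ inv_mem hx

theorem conj_mem_annGrp_of_act_eq {B B' : Finset (ι → ℤ)} (hB : IsOrthoSet G B) {w : W G}
    (hw : act G w B = B') {g : W G} (hg : g ∈ annGrp G B) : w * g * w⁻¹ ∈ annGrp G B' :=
  hw ▸ conj_mem_annGrp hB w hg

theorem inv_conj_mem_annGrp {B B' : Finset (ι → ℤ)} (hB : IsOrthoSet G B) {w : W G}
    (hw : act G w B = B') {g : W G} (hg : g ∈ annGrp G B') : w⁻¹ * g * w ∈ annGrp G B := by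
  subst hw
  simpa using conj_mem_annGrp_of_act_eq (hB.act w) (act_inv_act hB w) hg

theorem form_cases_of_joined (hP : FormPosDef G) {B : Finset (ι → ℤ)} (hB : IsOrthoSet G B)
    {α β δ : ι → ℤ} (hα : α ∈ roots G) (hβ : β ∈ B) (hδ : δ ∈ B) (h : Joined G α β) :
    form G α δ = 0 ∨ Joined G α δ := by
  by_cases hβδ : β = δ
  · exact Or.inr (hβδ ▸ h)
  have h0 := hB.2 β hβ δ hδ hβδ
  have hne : α ≠ δ ∧ α ≠ -δ := by
    constructor
    · rintro rfl
      rw [Joined, form_comm, h0] at h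
      simp at h
    · rintro rfl
      rw [Joined, map_neg, LinearMap.neg_apply, form_comm, h0] at h
      simp at h
  rw [Joined]
  rcases joined_or_perp hP hα (hB.1 δ hδ).1 hne.1 hne.2 with h | h | h <;> simp [h]

/-- The element is the product of the reflections in the orthogonal roots `r_α β = β - (α, β) α` and
`r_α γ = γ - (α, γ) α`. -/
theorem geom_annGen {B : Finset (ι → ℤ)} (hB : IsOrthoSet G B) {α β γ : ι → ℤ}
    (hα : α ∈ roots G) (hβ : β ∈ B) (hγ : γ ∈ B) (hne : β ≠ γ) (x : ι → ℤ) :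
    geom G (rootRefl G α * rootRefl G β * rootRefl G γ * rootRefl G α) x =
      x - (form G x β - form G α β * form G x α) • (β - form G α β • α)
        - (form G x γ - form G α γ * form G x α) • (γ - form G α γ • α) := by
  have hβγ := hB.2 β hβ γ hγ hne
  simp only [geom_mul_apply, geom_rootRefl hα, geom_rootRefl (hB.1 β hβ).1,
    geom_rootRefl (hB.1 γ hγ).1, map_sub, map_smul, LinearMap.sub_apply, LinearMap.smul_apply,
    smul_eq_mul, form_self hα, form_self (hB.1 β hβ).1, form_self (hB.1 γ hγ).1, hβγ,
    form_comm γ β, form_comm β α, form_comm γ α]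
  module

theorem act_eq_self_of_forall {B : Finset (ι → ℤ)} (hB : IsOrthoSet G B) {w : W G}
    (h : ∀ β ∈ B, posRep (geom G w β) ∈ B) : act G w B = B :=
  Finset.eq_of_subset_of_card_le (fun γ hγ => by
    obtain ⟨β, hβ, rfl⟩ := mem_act.1 hγ
    exact h β hβ) (card_act hB w).ge

theorem sq_eq_one_of_joined {α β : ι → ℤ} (h : Joined G α β) :
    form G α β * form G α β = 1 := by
  rw [Joined] at h
  rw [← abs_mul_abs_self, h, one_mul]

theorem act_rootRefl_of_mem {B : Finset (ι → ℤ)} (hB : IsOrthoSet G B) {β : ι → ℤ}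
    (hβ : β ∈ B) : act G (rootRefl G β) B = B := by
  refine act_eq_self_of_forall hB fun γ hγ => ?_
  rw [geom_rootRefl (hB.1 β hβ).1]
  by_cases hne : γ = β
  · subst hne
    rw [form_self (hB.1 γ hγ).1, posRep_eq_of_eq_or_neg (hB.1 γ hγ) (Or.inr (by module))]
    exact hγ
  · rw [hB.2 γ hγ β hβ hne, zero_smul, sub_zero, posRep_of_mem (hB.1 γ hγ)]
    exact hγ

/-- The element exchanges `β` and `γ` up to signs and fixes the roots of `B` orthogonal to `α`. A
third root `δ` joined to `α` goes, up to sign, to the root that admissibility provides. -/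
theorem act_annGen (hP : FormPosDef G) {B : Finset (ι → ℤ)} (hB : IsAdmissible G B)
    {α β γ : ι → ℤ} (hα : α ∈ roots G) (hβ : β ∈ B) (hγ : γ ∈ B) (h1 : Joined G α β)
    (h2 : Joined G α γ) (hne : β ≠ γ) :
    act G (rootRefl G α * rootRefl G β * rootRefl G γ * rootRefl G α) B = B := by
  refine act_eq_self_of_forall hB.1 fun δ hδ => ?_
  rw [geom_annGen hB.1 hα hβ hγ hne]
  have e1 := sq_eq_one_of_joined h1
  have e2 := sq_eq_one_of_joined h2
  have hβ2 := form_self (hB.1.1 β hβ).1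
  have hγ2 := form_self (hB.1.1 γ hγ).1
  have hβγ := hB.1.2 β hβ γ hγ hne
  set a := form G α β with ha
  set c := form G α γ with hc
  have hac : a = c ∨ a = -c := by
    rw [← sub_eq_zero, ← sub_eq_zero (a := a) (b := -c), ← mul_eq_zero]
    linear_combination e1 - e2
  have hac' : a * c = 1 ∨ a * c = -1 := by
    rcases hac with h | h
    · exact Or.inl (by rw [h]; exact e2)
    · exact Or.inr (by rw [h, neg_mul, e2])
  by_cases hδβ : δ = β
  · subst hδβ
    rw [hβ2, hβγ, form_comm δ α, ← ha]
    have : δ - (2 - a * a) • (δ - a • α) - (0 - c * a) • (γ - c • α) = (a * c) • γ := by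
      rw [e1, show (0 - c * a) • (γ - c • α) = -((a * c) • γ) + (a * (c * c)) • α by module, e2]
      module
    rw [this, posRep_eq_of_eq_or_neg (hB.1.1 γ hγ) (by rcases hac' with h | h <;> simp [h])]
    exact hγ
  by_cases hδγ : δ = γ
  · subst hδγ
    rw [hγ2, form_comm δ β, hβγ, form_comm δ α, ← hc]
    have : δ - (0 - a * c) • (β - a • α) - (2 - c * c) • (δ - c • α) = (a * c) • β := by
      rw [e2, show (0 - a * c) • (β - a • α) = -((a * c) • β) + (c * (a * a)) • α by module, e1]
      module
    rw [this, posRep_eq_of_eq_or_neg (hB.1.1 β hβ) (by rcases hac' with h | h <;> simp [h])]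
    exact hβ
  rw [hB.1.2 δ hδ β hβ hδβ, hB.1.2 δ hδ γ hγ hδγ, form_comm δ α]
  rcases form_cases_of_joined hP hB.1 hα hβ hδ h1 with h3 | h3
  · simpa [h3, posRep_of_mem (hB.1.1 δ hδ)] using hδ
  · have e3 := sq_eq_one_of_joined h3
    have hadm := admissible_root hB hβ hγ hδ hne (Ne.symm hδβ) (Ne.symm hδγ) hα h1 h2 h3
    set d := form G α δ
    have e : δ - (0 - a * d) • (β - a • α) - (0 - c * d) • (γ - c • α) =
        (-d) • ((2 : ℤ) • α - a • β - c • γ - d • δ) := by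
      have : δ - (0 - a * d) • (β - a • α) - (0 - c * d) • (γ - c • α) =
        δ + (a * d) • β + (c * d) • γ - (d * (a * a)) • α - (d * (c * c)) • α := by module
      rw [this, e1, e2, show (-d) • ((2 : ℤ) • α - a • β - c • γ - d • δ) =
        (d * d) • δ + (a * d) • β + (c * d) • γ - (2 * d) • α by module, e3]
      module
    rw [e, posRep_eq_of_eq_or_neg (hB.1.1 _ hadm) ?_]
    · exact hadm
    · have hd : d = 1 ∨ d = -1 := mul_self_eq_one_iff.1 e3
      have := posRep_eq_or ((2 : ℤ) • α - a • β - c • γ - d • δ)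
      rcases hd with h | h <;> rw [h] at this ⊢ <;>
        simp only [neg_smul, one_smul, neg_neg, sub_neg_eq_add] at this ⊢ <;>
        rcases this with h | h <;> rw [h] <;> simp

/-- For `β = γ` the second kind of generator collapses to `1`; this isolates the case of two
orthogonal roots. -/
theorem annGens_induction {B : Finset (ι → ℤ)} (hB : IsOrthoSet G B)
    {p : W G → Prop} (h0 : p 1) (h1 : ∀ β ∈ B, p (rootRefl G β))
    (h2 : ∀ α ∈ roots G, ∀ β ∈ B, ∀ γ ∈ B, β ≠ γ → Joined G α β → Joined G α γ →
      p (rootRefl G α * rootRefl G β * rootRefl G γ * rootRefl G α)) {g : W G}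
    (hg : g ∈ annGens G B) : p g := by
  rcases hg with ⟨β, hβ, rfl⟩ | ⟨α, hα, β, hβ, γ, hγ, j1, j2, rfl⟩
  · exact h1 β hβ
  · by_cases hne : β = γ
    · subst hne
      rwa [mul_assoc (rootRefl G α), rootRefl_mul_self (hB.1 β hβ).1, mul_one,
        rootRefl_mul_self hα.1]
    · exact h2 α hα.1 β hβ γ hγ hne (joined_comm.1 j1) j2

theorem act_of_mem_annGrp (hP : FormPosDef G) {B : Finset (ι → ℤ)} (hB : IsAdmissible G B)
    {g : W G} (hg : g ∈ annGrp G B) : act G g B = B := by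
  induction hg using Subgroup.closure_induction with
  | mem g hg =>
    exact annGens_induction hB.1 (p := fun g => act G g B = B) (act_one hB.1.1)
      (fun β hβ => act_rootRefl_of_mem hB.1 hβ)
      (fun α hα β hβ γ hγ hne j1 j2 => act_annGen hP hB hα hβ hγ j1 j2 hne) hg
  | one => exact act_one hB.1.1
  | mul x y _ _ hx hy => rw [act_mul hB.1.1, hy, hx]
  | inv x _ hx => conv_lhs => rw [← hx, act_inv_act hB.1]

/-! ### Congruences modulo two -/

/-- All inner products of `x` with the elements of `B` are even. -/
def EvenOn (G : SimpleGraph ι) [DecidableRel G.Adj] (B : Finset (ι → ℤ)) (x : ι → ℤ) : Prop :=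
  ∀ β ∈ B, Even (form G x β)

theorem EvenOn.geom {B : Finset (ι → ℤ)} (hB : IsOrthoSet G B) {x : ι → ℤ} {w : W G}
    (hw : act G w B = B) (hx : EvenOn G B x) : EvenOn G B (geom G w x) := by
  intro β hβ
  have hw' : act G w⁻¹ B = B := by conv_lhs => rw [← hw, act_inv_act hB]
  rw [form_geom_left]
  have h := hx _ (hw' ▸ posRep_geom_mem_act (w := w⁻¹) hβ)
  rcases posRep_eq_or (BrauerADE.geom G w⁻¹ β) with h' | h' <;> rw [h'] at h
  · exact h
  · simpa using h

/-- Reflection in `β ∈ B` changes the form by an even multiple. For `r_α r_β r_γ r_α`, the products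
of `x` with `r_α β` and `r_α γ` are both congruent to `(x, α)` modulo two, and likewise for `v`. So
the two correction terms are both congruent to `(x, α)(v, α)` and their sum is even. -/
theorem even_form_geom_sub (hP : FormPosDef G) {B : Finset (ι → ℤ)} (hB : IsAdmissible G B)
    {g : W G} (hg : g ∈ annGrp G B) {x v : ι → ℤ} (hx : EvenOn G B x) (hv : EvenOn G B v) :
    Even (form G (geom G g x) v - form G x v) := by
  induction hg using Subgroup.closure_induction generalizing x v with
  | mem g hg =>
    refine annGens_induction hB.1
      (p := fun g => Even (form G (geom G g x) v - form G x v)) ?_ ?_ ?_ hg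
    · simp
    · intro β hβ
      rw [geom_rootRefl (hB.1.1 β hβ).1, map_sub, LinearMap.sub_apply, map_smul,
        LinearMap.smul_apply, sub_sub_cancel_left, even_neg, smul_eq_mul]
      exact (hx β hβ).mul_right _
    · intro α hα β hβ γ hγ hne j1 j2
      rw [geom_annGen hB.1 hα hβ hγ hne]
      obtain ⟨p, hp⟩ := hx β hβ
      obtain ⟨q, hq⟩ := hx γ hγ
      obtain ⟨p', hp'⟩ := hv β hβ
      obtain ⟨q', hq'⟩ := hv γ hγ
      have e1 := sq_eq_one_of_joined j1
      have e2 := sq_eq_one_of_joined j2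
      simp only [map_sub, map_smul, LinearMap.sub_apply, LinearMap.smul_apply, smul_eq_mul, hp, hq,
        form_comm β v, form_comm γ v, hp', hq']
      set a := form G α β
      set c := form G α γ
      refine ⟨-(p * (p' + p' - a * form G α v)) + a * form G x α * p'
        - (q * (q' + q' - c * form G α v)) + c * form G x α * q' - form G x α * form G α v, ?_⟩
      linear_combination (-form G x α * form G α v) * e1 + (-form G x α * form G α v) * e2
  | one => simp
  | mul g h _ hh hg' hh' =>
    have e1 := hg' (hx.geom hB.1 (act_of_mem_annGrp hP hB hh)) hv
    have e2 := hh' hx hv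
    rw [geom_mul_apply]
    have := e1.add e2
    rwa [sub_add_sub_cancel] at this
  | inv g _ hg =>
    rw [form_geom_left, inv_inv, form_comm x (BrauerADE.geom G g v), form_comm x v]
    exact hg hv hx

/-! ### Raising paths -/

/-- `RaisingPath G X B w`: `w = r_{j₁} ⋯ r_{jₙ}` where successively raising `B` with
`j₁, …, jₙ` leads to `X`. -/
inductive RaisingPath (G : SimpleGraph ι) [DecidableRel G.Adj] (X : Finset (ι → ℤ)) :
    Finset (ι → ℤ) → W G → Prop
  | top : RaisingPath G X X 1
  | step (B : Finset (ι → ℤ)) (j : ι) (w : W G) : Raises G j B →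
      RaisingPath G X (act G (s G j) B) w → RaisingPath G X B (s G j * w)

section Paths

variable {X B : Finset (ι → ℤ)}

theorem RaisingPath.act_eq (hX : IsOrthoSet G X) {w : W G} (h : RaisingPath G X B w)
    (hB : IsOrthoSet G B) : act G w X = B := by
  induction h with
  | top => exact act_one hX.1
  | step B j w _ _ ih => rw [act_mul hX.1, ih (hB.act _), act_s_s hB]

theorem exists_raisingPath (hP : FormPosDef G) (hX : IsAdmissible G X) (hhigh : IsHighest G X)
    (hB : B ∈ orbit G X) : ∃ w, RaisingPath G X B w := by
  obtain ⟨rk, hrk⟩ := exists_rank hP hX.1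
  induction hn : rk B using Nat.strong_induction_on generalizing B with
  | _ n ih =>
  subst hn
  by_cases hBX : B = X
  · exact ⟨1, hBX ▸ RaisingPath.top⟩
  obtain ⟨j, hj⟩ := hhigh.exists_raises hB hBX
  obtain ⟨w, hw⟩ := ih _ (hrk B hB j hj) (act_mem_orbit hX.1 hB _) rfl
  exact ⟨_, RaisingPath.step B j w hj hw⟩

/-- Conjugating `r_β` and the reflection in `β + α_i + α_j` by the reflection in `β + α_i` gives
`s_i` and `s_j`. So the product is a generator of the second kind. -/
theorem s_mul_s_mem_annGrp (hB : IsOrthoSet G B) {i j : ι} (hne : i ≠ j)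
    (hij : ¬ G.Adj i j) {β : ι → ℤ} (hβ : β ∈ B) (hγ : β + simpleRoot i + simpleRoot j ∈ B)
    (h1 : form G (simpleRoot i) β = -1) :
    s G i * s G j ∈ annGrp G B := by
  have hb := form_self (hB.1 β hβ).1
  have hc := form_self (hB.1 _ hγ).1
  have hij0 := form_simple_not_adj hne hij
  have h2 : form G (simpleRoot j) β = -1 := by
    simp only [map_add, LinearMap.add_apply, form_simple_self, form_comm β, h1, hb, hij0,
      form_comm (simpleRoot j) (simpleRoot i)] at hc
    omega
  have hα : β + simpleRoot i ∈ roots G :=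
    add_mem_roots (hB.1 β hβ).1 (simpleRoot_mem_roots i) (by rw [form_comm, h1])
  have f1 : form G (β + simpleRoot i) β = 1 := by
    rw [map_add, LinearMap.add_apply, hb, h1]; norm_num
  have f2 : form G (β + simpleRoot i) (β + simpleRoot i + simpleRoot j) = 1 := by
    simp only [map_add, LinearMap.add_apply, form_simple_self, form_comm β, h1, h2, hb, hij0]
    norm_num
  have key := rootRefl_mul_mem_annGrp hα hβ hγ (joined_comm.1 (by rw [Joined, f1]; rfl))
    (by rw [Joined, f2]; rfl)
  have e1 : rootRefl G (β + simpleRoot i) * rootRefl G β * rootRefl G (β + simpleRoot i) =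
      s G i := by
    conv_lhs => rw [← rootRefl_inv hα]
    nth_rw 1 [rootRefl_inv hα]
    rw [← rootRefl_conj (hB.1 β hβ).1, geom_rootRefl hα, form_comm β, f1, one_smul,
      sub_add_cancel_left, rootRefl_neg (simpleRoot_mem_roots i), rootRefl_simple]
  have e2 : rootRefl G (β + simpleRoot i) * rootRefl G (β + simpleRoot i + simpleRoot j) *
      rootRefl G (β + simpleRoot i) = s G j := by
    conv_lhs => rw [← rootRefl_inv hα]
    nth_rw 1 [rootRefl_inv hα]
    rw [← rootRefl_conj (hB.1 _ hγ).1, geom_rootRefl hα, form_comm _ (β + simpleRoot i), f2,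
      one_smul, add_sub_cancel_left, rootRefl_simple]
  convert key using 1
  rw [← e1, ← e2]
  simp only [mul_assoc]
  rw [← mul_assoc (rootRefl G (β + simpleRoot i)) (rootRefl G (β + simpleRoot i)),
    rootRefl_mul_self hα, one_mul]

/-- Two raising paths from `B` to `X` differ by an element of `annGrp G B`. -/
theorem RaisingPath.mul_inv_mem (hP : FormPosDef G) (hX : IsAdmissible G X)
    (hhigh : IsHighest G X) (hB : B ∈ orbit G X) {w w' : W G} (hw : RaisingPath G X B w)
    (hw' : RaisingPath G X B w') : w * w'⁻¹ ∈ annGrp G B := by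
  obtain ⟨rk, hrk⟩ := exists_rank hP hX.1
  induction hn : rk B using Nat.strong_induction_on generalizing B w w' with
  | _ n ih =>
  subst hn
  cases hw with
  | top =>
    cases hw' with
    | top => simp
    | step _ j _ hj _ => exact absurd hj (hhigh.not_raises hP hX j)
  | step _ j u hj hu =>
  cases hw' with
  | top => exact absurd hj (hhigh.not_raises hP hX j)
  | step _ j' u' hj' hu' =>
  have hBa := hX.of_mem_orbit hB
  have o {E : Finset (ι → ℤ)} (hE : E ∈ orbit G X) (l : ι) : act G (s G l) E ∈ orbit G X :=
    act_mem_orbit hX.1 hE _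
  have step : ∀ {l : ι} {v v' : W G}, Raises G l B → RaisingPath G X (act G (s G l) B) v →
      RaisingPath G X (act G (s G l) B) v' → s G l * v * (s G l * v')⁻¹ ∈ annGrp G B := by
    intro l v v' hl hv hv'
    have h := ih _ (hrk B hB l hl) (o hB l) hv hv' rfl
    have h' := conj_mem_annGrp_of_act_eq (hBa.1.act _) (act_s_s hBa.1 l) h
    convert h' using 1
    group
  -- Each path is compared with a continuation of its own first step to the far corner of the
  -- diamond or hexagon. The two continuations are equal as elements of `W`.
  have common : ∀ {x v y : W G}, s G j * u * x⁻¹ ∈ annGrp G B →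
      s G j' * u' * y⁻¹ ∈ annGrp G B → x = y →
      s G j * u * (s G j' * u')⁻¹ ∈ annGrp G B := by
    rintro x - y h1 h2 rfl
    convert mul_mem h1 (inv_mem h2) using 1
    group
  by_cases hjj : j = j'
  · subst hjj
    exact step hj hu hu'
  by_cases hadj : G.Adj j j'
  · obtain ⟨a1, a2⟩ := hj.hexagon hP hBa.1 hadj hj'
    obtain ⟨b1, b2⟩ := hj'.hexagon hP hBa.1 hadj.symm hj
    obtain ⟨v, hv⟩ := exists_raisingPath hP hX hhigh (o (o (o hB j) j') j)
    have hv' := hv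
    rw [act_braid hBa.1 hadj] at hv'
    refine common (v := 1) (step hj hu (.step _ j' _ a1 (.step _ j _ a2 hv)))
      (step hj' hu' (.step _ j _ b1 (.step _ j' _ b2 hv'))) ?_
    simp only [← mul_assoc, s_braid hadj]
  · rcases hj.diamond hP hBa hjj hadj hj' with ⟨h, β, hβ, hγ⟩ | ⟨a, b⟩
    · have h1 := ih _ (hrk B hB j hj) (o hB j) hu (h ▸ hu') rfl
      have h2 := conj_mem_annGrp_of_act_eq (hBa.1.act _) (act_s_s hBa.1 j) h1
      -- In the degenerate diamond the two edges lead to the same set, and their quotient has to be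
      -- absorbed by the group itself.
      have h3 : s G j * s G j' ∈ annGrp G B := by
        refine s_mul_s_mem_annGrp hBa.1 hjj hadj hβ hγ ?_
        have hne : β ≠ β + simpleRoot j + simpleRoot j' := fun h => by
          have := congrArg height h
          rw [height_add, height_add, height_simple, height_simple] at this
          omega
        have h0 := hBa.1.2 _ hβ _ hγ hne
        rw [map_add, map_add, form_self (hBa.1.1 β hβ).1, form_comm β, form_comm β] at h0
        have c1 := form_cases hP hBa.1 (hj.exists hP hBa.1).1 hβ
        have c2 := form_cases hP hBa.1 (hj'.exists hP hBa.1).1 hβ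
        omega
      convert mul_mem h2 h3 using 1
      simp only [mul_inv_rev, s_inv, mul_assoc, s_mul_cancel]
    · obtain ⟨v, hv⟩ := exists_raisingPath hP hX hhigh (o (o hB j) j')
      have hv' := hv
      rw [act_comm hBa.1 (Ne.symm hjj) fun h => hadj h.symm] at hv'
      refine common (v := 1) (step hj hu (.step _ j' _ a hv)) (step hj' hu' (.step _ j _ b hv')) ?_
      simp only [← mul_assoc, s_comm hjj hadj]

theorem RaisingPath.inv_mul_mem (hP : FormPosDef G) (hX : IsAdmissible G X)
    (hhigh : IsHighest G X) (hB : B ∈ orbit G X) {w w' : W G} (hw : RaisingPath G X B w)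
    (hw' : RaisingPath G X B w') : w⁻¹ * w' ∈ annGrp G X := by
  have h := inv_conj_mem_annGrp hX.1 (hw.act_eq hX.1 (hX.of_mem_orbit hB).1)
    (hw'.mul_inv_mem hP hX hhigh hB hw)
  convert h using 1
  group

/-- The recursion for the node follows a raising path and carries the simple root along it.
Consequently `r_i = w r_k w⁻¹`, which gives `h_{B,i}` its meaning inside `W`. -/
theorem HNode.exists_raisingPath {i k : ι} (h : HNode G X B i k) :
    ∃ w, RaisingPath G X B w ∧ geom G w (simpleRoot k) = simpleRoot i := by
  induction h with
  | base i _ => exact ⟨1, .top, by simp⟩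
  | comm B i j k _ hij hadj hj _ ih =>
    obtain ⟨w, hw, e⟩ := ih
    exact ⟨_, .step _ j _ hj hw, by rw [geom_mul_apply, e, geom_simple_of_not_adj hij hadj]⟩
  | braid B i j k _ hadj hj hi _ ih =>
    obtain ⟨w, hw, e⟩ := ih
    exact ⟨_, .step _ j _ hj (.step _ i _ hi hw), by
      rw [geom_mul_apply, geom_mul_apply, e, geom_s_s_simple hadj.symm]⟩

/-- Different nodes may use different paths, but these differ by an element of `annGrp G X`. That
element does not change products modulo two between `α_k` and `α_l`, which are orthogonal to `X`. -/
theorem even_form_sub_of_hNode (hP : FormPosDef G) (hX : IsAdmissible G X)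
    (hhigh : IsHighest G X) (hB : B ∈ orbit G X) {i j k l : ι} (hk : HNode G X B i k)
    (hl : HNode G X B j l) :
    Even (form G (simpleRoot i) (simpleRoot j) - form G (simpleRoot k) (simpleRoot l)) := by
  obtain ⟨w, hw, e⟩ := hk.exists_raisingPath
  obtain ⟨w', hw', e'⟩ := hl.exists_raisingPath
  have hev : ∀ {k : ι}, k ∈ nodesC G X → EvenOn G X (simpleRoot k) := fun hk β hβ => by
    rw [hk β hβ]
    exact Even.zero
  have h := even_form_geom_sub hP hX (hw'.inv_mul_mem hP hX hhigh hB hw) (hev hk.mem_nodesC)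
    (hev hl.mem_nodesC)
  rwa [geom_mul_apply, form_geom_left, inv_inv, e, e'] at h

/-- Among the possible products `2`, `0`, `-1` of simple roots only `-1` is odd, so parity detects
adjacency. -/
theorem HNode.adj (hP : FormPosDef G) (hX : IsAdmissible G X)
    (hhigh : IsHighest G X) (hB : B ∈ orbit G X) {i j k l : ι} (hk : HNode G X B i k)
    (hl : HNode G X B j l) (hij : G.Adj i j) : G.Adj k l := by
  have h := even_form_sub_of_hNode hP hX hhigh hB hk hl
  rw [form_simple_adj hij] at h
  by_contra hkl
  by_cases hkl' : k = l
  · subst hkl'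
    rw [form_simple_self] at h
    exact absurd h (by decide)
  · rw [form_simple_not_adj hkl' hkl] at h
    exact absurd h (by decide)

theorem HNode.s_comm (hP : FormPosDef G) (hX : IsAdmissible G X)
    (hhigh : IsHighest G X) (hB : B ∈ orbit G X) {i j k l : ι} (hk : HNode G X B i k)
    (hl : HNode G X B j l) (hne : i ≠ j) (hij : ¬ G.Adj i j) :
    s G k * s G l = s G l * s G k := by
  have h := even_form_sub_of_hNode hP hX hhigh hB hk hl
  rw [form_simple_not_adj hne hij] at h
  by_cases hkl' : k = l
  · rw [hkl']
  refine BrauerADE.s_comm hkl' fun hkl => ?_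
  rw [form_simple_adj hkl] at h
  exact absurd h (by decide)

/-! ### The decomposition of `W` -/

theorem geom_of_mem_WC {w : W G} (hw : w ∈ WC G X) {β : ι → ℤ} (hβ : β ∈ X) :
    geom G w β = β := by
  induction hw using Subgroup.closure_induction with
  | mem w hw =>
    obtain ⟨i, hi, rfl⟩ := hw
    rw [geom_s_apply, form_comm, hi β hβ, zero_smul, sub_zero]
  | one => simp
  | mul x y _ _ hx hy => rw [geom_mul_apply, hy, hx]
  | inv x _ hx => conv_lhs => rw [← hx, ← geom_mul_apply, inv_mul_cancel]; simp

theorem act_of_mem_WC (hX : IsOrthoSet G X) {w : W G} (hw : w ∈ WC G X) : act G w X = X :=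
  act_eq_self_of_forall hX fun β hβ => by
    rwa [geom_of_mem_WC hw hβ, posRep_of_mem (hX.1 β hβ)]

/-- `W(C)` stabilizes `X`, hence normalizes `annGrp G X`, and the join is a product. -/
theorem exists_mul_of_mem_sup (hX : IsOrthoSet G X) {x : W G} (hx : x ∈ WC G X ⊔ annGrp G X) :
    ∃ c ∈ WC G X, ∃ κ ∈ annGrp G X, x = c * κ := by
  have hn : WC G X ≤ Subgroup.normalizer (annGrp G X : Set (W G)) := fun c hc => by
    rw [Subgroup.mem_normalizer_iff]
    have hc' := act_of_mem_WC hX hc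
    refine fun g => ⟨fun hg => conj_mem_annGrp_of_act_eq hX hc' hg, fun hg => ?_⟩
    have := inv_conj_mem_annGrp hX hc' hg
    simpa [mul_assoc] using this
  rw [← SetLike.mem_coe, Subgroup.coe_mul_of_left_le_normalizer_right _ _ hn] at hx
  obtain ⟨c, hc, κ, hκ, rfl⟩ := hx
  exact ⟨c, hc, κ, hκ, rfl⟩

/-- Every element of `W` is the product of a raising path, an element of `W(C)` and an element
of `annGrp G X`. -/
theorem exists_raisingPath_inv_mul_mem (hP : FormPosDef G) (hX : IsAdmissible G X)
    (hhigh : IsHighest G X) (w : W G) :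
    ∃ p, RaisingPath G X (act G w X) p ∧ p⁻¹ * w ∈ WC G X ⊔ annGrp G X := by
  have hK : annGrp G X ≤ WC G X ⊔ annGrp G X := le_sup_right
  have hC : WC G X ≤ WC G X ⊔ annGrp G X := le_sup_left
  induction w using W_induction_left with
  | one => exact ⟨1, by rw [act_one hX.1.1]; exact .top, by simp⟩
  | mul w i ih =>
    obtain ⟨p, hp, h⟩ := ih
    rw [act_mul hX.1.1]
    have hB : act G w X ∈ orbit G X := ⟨w, rfl⟩
    generalize act G w X = B at hp hB
    have hBa := hX.of_mem_orbit hB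
    have hB' := act_mem_orbit hX.1 hB (s G i)
    -- If `r_i` fixes `B`, then either `α_i ∈ B` and `r_i` is a generator at `B`, or `α_i ⊥ B` and
    -- `r_i` is conjugate to a generator of `W(C)`. If it raises or lowers `B`, the edge is absorbed
    -- into a raising path.
    rcases raises_trichotomy hP hBa.1 i with h' | h' | h'
    · rw [h']
      refine ⟨p, hp, ?_⟩
      suffices p⁻¹ * s G i * p ∈ WC G X ⊔ annGrp G X by
        convert mul_mem this h using 1
        group
      rcases act_s_eq_self hP hBa.1 h' with hi | hi
      · have h1 := rootRefl_mem_annGrp (G := G) hi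
        rw [rootRefl_simple] at h1
        exact hK (inv_conj_mem_annGrp hX.1 (hp.act_eq hX.1 hBa.1) h1)
      · obtain ⟨k, hk, -⟩ := existsUnique_hNode hP hX hhigh B hB i hi
        obtain ⟨q, hq, e⟩ := hk.exists_raisingPath
        have e1 : s G i = q * s G k * q⁻¹ := by
          rw [← rootRefl_simple, ← e, rootRefl_conj (simpleRoot_mem_roots k), rootRefl_simple]
        have h1 : s G k ∈ WC G X := Subgroup.subset_closure ⟨k, hk.mem_nodesC, rfl⟩
        convert mul_mem (mul_mem (hK (hp.inv_mul_mem hP hX hhigh hB hq)) (hC h1))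
          (hK (hq.inv_mul_mem hP hX hhigh hB hp)) using 1
        rw [e1]
        group
    · obtain ⟨q, hq⟩ := exists_raisingPath hP hX hhigh hB'
      refine ⟨q, hq, ?_⟩
      convert mul_mem (hK ((RaisingPath.step _ i _ h' hq).inv_mul_mem hP hX hhigh hB hp)) h using 1
      rw [mul_inv_rev, s_inv]
      group
    · refine ⟨s G i * p, .step _ i _ h' (by rwa [act_s_s hBa.1]), ?_⟩
      convert h using 1
      group

end Paths

/-! ### The elements `h_{B,i}` -/

section HElt

variable {X B : Finset (ι → ℤ)}

theorem hElt_of_hNode (hP : FormPosDef G) (hX : IsAdmissible G X) (hhigh : IsHighest G X)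
    (hB : B ∈ orbit G X) {i k : ι} (h : HNode G X B i k) : (hElt G X B i : W G) = s G k := by
  have hex : ∃ k : nodesC G X, HNode G X B i k := ⟨⟨k, h.mem_nodesC⟩, h⟩
  rw [hElt, dif_pos hex]
  change s G (hex.choose : ι) = s G k
  rw [(existsUnique_hNode hP hX hhigh B hB i h.perp).unique hex.choose_spec h]

theorem hElt_of_not_perp {i : ι} (h : ¬ Perp G i B) : hElt G X B i = 1 := by
  rw [hElt, dif_neg]
  rintro ⟨k, hk⟩
  exact h hk.perp

theorem hElt_mul_self (hP : FormPosDef G) (hX : IsAdmissible G X) (hhigh : IsHighest G X)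
    (hB : B ∈ orbit G X) (i : ι) : hElt G X B i * hElt G X B i = 1 := by
  by_cases hp : Perp G i B
  · obtain ⟨k, hk, -⟩ := existsUnique_hNode hP hX hhigh B hB i hp
    ext
    rw [Subgroup.coe_mul, hElt_of_hNode hP hX hhigh hB hk, s_mul_self, Subgroup.coe_one]
  · rw [hElt_of_not_perp hp, one_mul]

theorem hElt_act_self (hX : IsAdmissible G X) (hB : B ∈ orbit G X) (i : ι) :
    hElt G X (act G (s G i) B) i = hElt G X B i := by
  have hBo := (hX.of_mem_orbit hB).1
  by_cases hp : Perp G i B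
  · rw [act_s_of_perp hBo hp]
  · rw [hElt_of_not_perp hp, hElt_of_not_perp fun h => hp ((perp_act_self hBo).1 h)]

theorem hElt_act_not_adj (hP : FormPosDef G) (hX : IsAdmissible G X) (hhigh : IsHighest G X)
    (hB : B ∈ orbit G X) {i j : ι} (hne : i ≠ j) (hij : ¬ G.Adj i j) :
    hElt G X (act G (s G j) B) i = hElt G X B i := by
  have hBo := (hX.of_mem_orbit hB).1
  have hB' := act_mem_orbit hX.1 hB (s G j)
  have hiff := perp_act_not_adj hBo hne hij
  by_cases hp : Perp G i B
  · ext
    have hp' := hiff.2 hp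
    rcases raises_trichotomy hP hBo j with h | h | h
    · rw [h]
    · obtain ⟨k, hk, -⟩ := existsUnique_hNode hP hX hhigh _ hB' i hp'
      rw [hElt_of_hNode hP hX hhigh hB' hk,
        hElt_of_hNode hP hX hhigh hB (.comm B i j k hp hne hij h hk)]
    · obtain ⟨k, hk, -⟩ := existsUnique_hNode hP hX hhigh _ hB i hp
      rw [hElt_of_hNode hP hX hhigh hB hk,
        hElt_of_hNode hP hX hhigh hB' (.comm _ i j k hp' hne hij h (by rwa [act_s_s hBo]))]
  · rw [hElt_of_not_perp hp, hElt_of_not_perp fun h => hp (hiff.1 h)]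

theorem perp_act_adj_iff {i j : ι} (hij : G.Adj i j) :
    Perp G i (act G (s G j) B) ↔
      ∀ β ∈ B, form G (simpleRoot i) β + form G (simpleRoot j) β = 0 := by
  have key : ∀ β, form G (simpleRoot i) (posRep (geom G (s G j) β)) = 0 ↔
      form G (simpleRoot i) β + form G (simpleRoot j) β = 0 := fun β => by
    rcases posRep_eq_or (geom G (s G j) β) with h | h <;> rw [h] <;>
      simp only [map_neg, neg_eq_zero, form_simple_geom_s_adj hij.symm, add_comm]
  constructor
  · exact fun h β hβ => (key β).1 (h _ (posRep_geom_mem_act hβ))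
  · intro h γ hγ
    obtain ⟨β, hβ, rfl⟩ := mem_act.1 hγ
    exact (key β).2 (h β hβ)

theorem perp_act_of_adj {i j : ι} (hij : G.Adj i j) (hp : Perp G i B) :
    Perp G i (act G (s G j) B) ↔ Perp G j B := by
  rw [perp_act_adj_iff hij]
  exact forall₂_congr fun β hβ => by rw [hp β hβ, zero_add]

/-- The braid rule is reversible. If `j` raises `B`, it is the defining rule at `(B, i)`; if `j`
lowers `B`, then `i` lowers `r_j B`, and it is the rule at `(r_i r_j B, j)`. -/
theorem hElt_act_act_adj (hP : FormPosDef G) (hX : IsAdmissible G X) (hhigh : IsHighest G X)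
    (hB : B ∈ orbit G X) {i j : ι} (hij : G.Adj i j) (hi : Perp G i B) (hj : ¬ Perp G j B) :
    hElt G X (act G (s G i) (act G (s G j) B)) j = hElt G X B i := by
  have hBo := (hX.of_mem_orbit hB).1
  have hD := act_mem_orbit hX.1 hB (s G j)
  have hDo := (hX.of_mem_orbit hD).1
  have hS := act_mem_orbit hX.1 hD (s G i)
  have hSo := (hX.of_mem_orbit hS).1
  have hq := perp_act_act hij hi hBo
  have hjB : simpleRoot j ∉ B := fun h => by
    have := hi _ h
    rw [form_simple_adj hij] at this
    omega
  ext
  rcases raises_trichotomy hP hBo j with h | h | h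
  · exact absurd (act_s_eq_self hP hBo h) (not_or.2 ⟨hjB, hj⟩)
  · obtain ⟨k, hk, -⟩ := existsUnique_hNode hP hX hhigh _ hS j hq
    rw [hElt_of_hNode hP hX hhigh hS hk, hElt_of_hNode hP hX hhigh hB
      (.braid B i j k hi hij h (h.raises_of_perp hP hBo hij hi) hk)]
  · rcases raises_trichotomy hP hDo i with h' | h' | h'
    · rcases act_s_eq_self hP hDo h' with hiD | hiD
      · obtain ⟨β, hβ, e⟩ := mem_act.1 hiD
        have h0 := hi β hβ
        rw [← geom_s_s (G := G) j β, form_simple_geom_s_adj hij.symm] at h0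
        have e' := eq_or_neg_posRep (geom G (s G j) β)
        rw [e] at e'
        rcases e' with h1 | h1 <;> rw [h1] at h0 <;>
          simp only [map_neg, form_simple_self, form_simple_adj hij.symm] at h0 <;> omega
      · exact absurd ((perp_act_of_adj hij hi).1 hiD) hj
    -- If both nodes raised `r_j B`, the hexagon would make `i` raise `B`, contrary to `α_i ⊥ B`.
    · have := (h.hexagon hP hDo hij.symm h').1
      rw [act_s_s hBo] at this
      exact absurd hi (this.not_perp hP hBo)
    · obtain ⟨k, hk, -⟩ := existsUnique_hNode hP hX hhigh _ hB i hi
      rw [hElt_of_hNode hP hX hhigh hB hk, hElt_of_hNode hP hX hhigh hS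
        (.braid _ j i k hq hij.symm h' (by rwa [act_s_s hDo]) (by rwa [act_s_s hDo, act_s_s hBo]))]

theorem hElt_comm (hP : FormPosDef G) (hX : IsAdmissible G X) (hhigh : IsHighest G X)
    (hB : B ∈ orbit G X) {i j : ι} (hne : i ≠ j) (hij : ¬ G.Adj i j) :
    hElt G X (act G (s G j) B) i * hElt G X B j = hElt G X (act G (s G i) B) j * hElt G X B i := by
  rw [hElt_act_not_adj hP hX hhigh hB hne hij,
    hElt_act_not_adj hP hX hhigh hB hne.symm fun h => hij h.symm]
  by_cases hi : Perp G i B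
  · by_cases hj : Perp G j B
    · obtain ⟨k, hk, -⟩ := existsUnique_hNode hP hX hhigh B hB i hi
      obtain ⟨l, hl, -⟩ := existsUnique_hNode hP hX hhigh B hB j hj
      ext
      rw [Subgroup.coe_mul, Subgroup.coe_mul, hElt_of_hNode hP hX hhigh hB hk,
        hElt_of_hNode hP hX hhigh hB hl, hk.s_comm hP hX hhigh hB hl hne hij]
    · rw [hElt_of_not_perp hj, one_mul, mul_one]
  · rw [hElt_of_not_perp hi, one_mul, mul_one]

/-- If both nodes are orthogonal to `B`, this is the braid relation for the corresponding nodes of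
`C`. In every other case at most one factor on each side is not `1`, and the reversible braid rule
moves it across. -/
theorem hElt_braid (hP : FormPosDef G) (hX : IsAdmissible G X) (hhigh : IsHighest G X)
    (hB : B ∈ orbit G X) {i j : ι} (hij : G.Adj i j) :
    hElt G X (act G (s G j) (act G (s G i) B)) i * hElt G X (act G (s G i) B) j * hElt G X B i =
      hElt G X (act G (s G i) (act G (s G j) B)) j * hElt G X (act G (s G j) B) i *
        hElt G X B j := by
  have hBo := (hX.of_mem_orbit hB).1
  have half : ∀ {i j : ι}, G.Adj i j → Perp G i B → ¬ Perp G j B →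
      hElt G X (act G (s G j) (act G (s G i) B)) i * hElt G X (act G (s G i) B) j *
          hElt G X B i =
        hElt G X (act G (s G i) (act G (s G j) B)) j * hElt G X (act G (s G j) B) i *
          hElt G X B j := by
    intro i j hij hi hj
    rw [hElt_act_act_adj hP hX hhigh hB hij hi hj, hElt_of_not_perp hj,
      hElt_of_not_perp fun h => hj ((perp_of_adj_iff hBo hij.symm).1 h), act_s_of_perp hBo hi,
      hElt_of_not_perp hj, hElt_of_not_perp fun h => hj ((perp_act_of_adj hij hi).1 h)]
    simp only [one_mul, mul_one]
  by_cases hi : Perp G i B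
  · by_cases hj : Perp G j B
    · obtain ⟨k, hk, -⟩ := existsUnique_hNode hP hX hhigh B hB i hi
      obtain ⟨l, hl, -⟩ := existsUnique_hNode hP hX hhigh B hB j hj
      ext
      simp only [Subgroup.coe_mul, act_s_of_perp hBo hi, act_s_of_perp hBo hj,
        hElt_of_hNode hP hX hhigh hB hk, hElt_of_hNode hP hX hhigh hB hl]
      exact s_braid (hk.adj hP hX hhigh hB hl hij)
    · exact half hij hi hj
  · by_cases hj : Perp G j B
    · exact (half hij.symm hj hi).symm
    · rw [hElt_of_not_perp hi, hElt_of_not_perp hj,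
        hElt_of_not_perp fun h => hj ((perp_of_adj_iff hBo hij.symm).1 h),
        hElt_of_not_perp fun h => hi ((perp_of_adj_iff hBo hij).1 h)]
      simp only [one_mul, mul_one]
      have hD := act_mem_orbit hX.1 hB (s G i)
      have hDo := (hX.of_mem_orbit hD).1
      by_cases hjD : Perp G j (act G (s G i) B)
      · have := hElt_act_act_adj hP hX hhigh hD hij.symm hjD
          fun h => hi ((perp_act_self hBo).1 h)
        rw [act_s_s hBo] at this
        exact this.symm
      · rw [hElt_of_not_perp hjD, hElt_of_not_perp]
        rwa [perp_act_adj_iff hij, ← (forall₂_congr fun β _ => by rw [add_comm] :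
          (∀ β ∈ B, form G (simpleRoot j) β + form G (simpleRoot i) β = 0) ↔ _),
          ← perp_act_adj_iff hij.symm]

end HElt

/-! ### The representation `ρ` -/

theorem isLiftable_of_relations {M : Type*} [Monoid M] (f : ι → M) (h1 : ∀ i, f i * f i = 1)
    (h2 : ∀ i j, i ≠ j → ¬ G.Adj i j → f i * f j = f j * f i)
    (h3 : ∀ i j, G.Adj i j → f i * f j * f i = f j * f i * f j) : (coxMat G).IsLiftable f := by
  intro i j
  rw [coxMat_apply]
  by_cases h : i = j
  · subst h
    simp [h1]
  · rw [if_neg h]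
    by_cases ha : G.Adj i j
    · rw [if_pos ha]
      calc (f i * f j) ^ 3 = (f i * f j * f i) * (f j * f i * f j) := by
            simp only [pow_succ, pow_zero, one_mul, mul_assoc]
        _ = (f j * f i) * (f j * f j) * (f i * f j) := by
            rw [h3 i j ha]
            simp only [mul_assoc]
        _ = f j * (f i * f i) * f j := by
            rw [h1, mul_one]
            simp only [mul_assoc]
        _ = 1 := by rw [h1, mul_one, h1]
    · rw [if_neg ha, pow_two]
      calc f i * f j * (f i * f j) = f i * f j * (f j * f i) := by rw [h2 i j h ha]
        _ = f i * (f j * f j) * f i := by simp only [mul_assoc]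
        _ = 1 := by rw [h1, mul_one, h1]

section Rho

variable {X : Finset (ι → ℤ)}

/-- The action of `w` on the orbit of `X`. -/
def orbitAct (hX : IsOrthoSet G X) (w : W G) (B : orbit G X) : orbit G X :=
  ⟨act G w B, act_mem_orbit hX B.2 w⟩

/-- The element `h_{B,i}` in the coefficient ring. -/
abbrev hCoeff (G : SimpleGraph ι) [DecidableRel G.Adj] (X B : Finset (ι → ℤ)) (i : ι) :
    Coeff G X :=
  MonoidAlgebra.of (LaurentPolynomial ℤ) (WC G X) (hElt G X B i)

/-- The endomorphism `ξ_B ↦ ξ_{r_i B} h_{B,i}` of `V`. -/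
def rhoGen (hX : IsOrthoSet G X) (i : ι) : Module.End (Coeff G X)ᵐᵒᵖ (VMod G X) :=
  Finsupp.lsum ℕ fun B => Finsupp.lsingle (orbitAct hX (s G i) B) ∘ₗ
    LinearMap.mulLeft (Coeff G X)ᵐᵒᵖ (hCoeff G X B i)

theorem rhoGen_single (hX : IsOrthoSet G X) (i : ι) (B : orbit G X) (a : Coeff G X) :
    rhoGen hX i (Finsupp.single B a) =
      Finsupp.single (orbitAct hX (s G i) B) (hCoeff G X B i * a) := by
  simp [rhoGen]

theorem single_eq_smul_xi (B : orbit G X) (a : Coeff G X) :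
    (Finsupp.single B a : VMod G X) = MulOpposite.op a • xi G X B := by
  simp [xi, Finsupp.smul_single]

theorem rhoGen_liftable (hP : FormPosDef G) (hX : IsAdmissible G X) (hhigh : IsHighest G X) :
    (coxMat G).IsLiftable (rhoGen (G := G) hX.1) := by
  refine isLiftable_of_relations _ (fun i => ?_) (fun i j hne hij => ?_) fun i j hij => ?_ <;>
    refine Finsupp.lhom_ext fun B a => ?_ <;>
    have hBo := (hX.of_mem_orbit B.2).1 <;>
    simp only [Module.End.mul_apply, rhoGen_single, Module.End.one_apply, ← mul_assoc, ← map_mul,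
      orbitAct]
  · simp only [act_s_s hBo, hElt_act_self hX B.2, hElt_mul_self hP hX hhigh B.2, map_one, one_mul]
  · simp only [act_comm hBo hne hij, hElt_comm hP hX hhigh B.2 hne hij]
  · simp only [act_braid hBo hij, hElt_braid hP hX hhigh B.2 hij]

theorem IsRho.apply_single {ρ : W G →* Module.End (Coeff G X)ᵐᵒᵖ (VMod G X)}
    (hρ : IsRho G X ρ) (hX : IsOrthoSet G X) (i : ι) (B : orbit G X) (a : Coeff G X) :
    ρ (s G i) (Finsupp.single B a) =
      Finsupp.single (orbitAct hX (s G i) B) (hCoeff G X B i * a) := by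
  rw [single_eq_smul_xi, map_smul, hρ i B (orbitAct hX (s G i) B) rfl, single_eq_smul_xi,
    smul_smul, ← MulOpposite.op_mul]

theorem existsUnique_isRho (hP : FormPosDef G) (hX : IsAdmissible G X) (hhigh : IsHighest G X) :
    ∃! ρ, IsRho G X ρ := by
  refine ⟨(coxMat G).toCoxeterSystem.lift ⟨_, rhoGen_liftable hP hX hhigh⟩, ?_, ?_⟩
  · intro i B B' hB'
    have h1 : (coxMat G).toCoxeterSystem.lift ⟨_, rhoGen_liftable hP hX hhigh⟩ (s G i) =
        rhoGen hX.1 i :=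
      (coxMat G).toCoxeterSystem.lift_apply_simple (rhoGen_liftable hP hX hhigh) i
    have h2 : B' = orbitAct hX.1 (s G i) B := Subtype.ext hB'
    rw [h1, h2, xi, rhoGen_single, mul_one, single_eq_smul_xi]
  · intro ρ hρ
    refine (coxMat G).toCoxeterSystem.ext_simple fun i => ?_
    refine Eq.trans ?_ ((coxMat G).toCoxeterSystem.lift_apply_simple
      (rhoGen_liftable hP hX hhigh) i).symm
    refine Finsupp.lhom_ext fun B a => ?_
    rw [rhoGen_single]
    exact hρ.apply_single hX.1 i B a

end Rho

/-! ### The stabilizer of `ξ_X` -/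

section Kernel

variable {X : Finset (ι → ℤ)} {ρ : W G →* Module.End (Coeff G X)ᵐᵒᵖ (VMod G X)}

theorem orbitAct_mul (hX : IsOrthoSet G X) (hXo : ∀ B ∈ orbit G X, IsOrthoSet G B) (w v : W G)
    (B : orbit G X) : orbitAct hX (w * v) B = orbitAct hX w (orbitAct hX v B) :=
  Subtype.ext (act_mul (hXo _ B.2).1 w v)

/-- The representation is monomial: each generator permutes the basis and multiplies the coefficient
on the left by a group element. -/
theorem IsRho.exists_apply (hρ : IsRho G X ρ) (hX : IsAdmissible G X) (w : W G) (B : orbit G X) :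
    ∃ g : WC G X, ∀ a, ρ w (Finsupp.single B a) =
      Finsupp.single (orbitAct hX.1 w B) (MonoidAlgebra.of (LaurentPolynomial ℤ) _ g * a) := by
  induction w using W_induction_left with
  | one =>
    refine ⟨1, fun a => ?_⟩
    have h : orbitAct hX.1 1 B = B := Subtype.ext (act_one (hX.of_mem_orbit B.2).1.1)
    rw [h, map_one, Module.End.one_apply, map_one, one_mul]
  | mul w i ih =>
    obtain ⟨g, hg⟩ := ih
    refine ⟨hElt G X (orbitAct hX.1 w B) i * g, fun a => ?_⟩
    rw [map_mul, Module.End.mul_apply, hg, hρ.apply_single hX.1, ← mul_assoc, ← map_mul,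
      orbitAct_mul hX.1 fun B hB => (hX.of_mem_orbit hB).1]

theorem not_perp_of_act (w : W G) {D : Finset (ι → ℤ)} {i : ι} {a β : ι → ℤ} (hβ : β ∈ D)
    (hw : geom G w (simpleRoot i) = a ∨ geom G w (simpleRoot i) = -a) (h : form G a β ≠ 0) :
    ¬ Perp G i (act G w⁻¹ D) := by
  intro hp
  have h1 := hp _ (posRep_geom_mem_act hβ)
  have h2 : form G (simpleRoot i) (geom G w⁻¹ β) = 0 := by
    rcases posRep_eq_or (geom G w⁻¹ β) with h | h <;> rw [h] at h1
    · exact h1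
    · simpa using h1
  rw [← form_geom_left] at h2
  rcases hw with hw | hw <;> rw [hw] at h2
  · exact h h2
  · rw [map_neg, LinearMap.neg_apply, neg_eq_zero] at h2
    exact h h2

theorem rootRefl_of_geom_simple {w : W G} {i : ι} {a : ι → ℤ} (ha : a ∈ roots G)
    (hw : geom G w (simpleRoot i) = a ∨ geom G w (simpleRoot i) = -a) :
    rootRefl G a = w * s G i * w⁻¹ := by
  rw [← rootRefl_geom]
  rcases hw with hw | hw <;> rw [hw]
  rw [rootRefl_neg ha]

/-- `ρ(w⁻¹)` moves `ξ_B` to another basis vector with a coefficient, which is why the hypothesis is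
needed for all coefficients `a`. -/
theorem IsRho.apply_of_conj (hρ : IsRho G X ρ) (hX : IsAdmissible G X) (w v : W G)
    (B : orbit G X)
    (h : ∀ a, ρ v (Finsupp.single (orbitAct hX.1 w⁻¹ B) a) =
      Finsupp.single (orbitAct hX.1 w⁻¹ B) a) :
    ρ (w * v * w⁻¹) (xi G X B) = xi G X B := by
  obtain ⟨g, hg⟩ := hρ.exists_apply hX w⁻¹ B
  rw [map_mul, Module.End.mul_apply, map_mul, Module.End.mul_apply, xi, hg, h, ← hg,
    ← Module.End.mul_apply, ← map_mul, mul_inv_cancel, map_one, Module.End.one_apply]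

/-- The pair is conjugated to non-adjacent simple roots. Neither is orthogonal to the transported
set, and commuting reflections do not change this, so both factors `h` are `1` and only the action
on sets remains. -/
theorem IsRho.rootRefl_mul_rootRefl (hP : FormPosDef G) (hρ : IsRho G X ρ)
    (hX : IsAdmissible G X) {a b : ι → ℤ} (ha : a ∈ roots G) (hb : b ∈ roots G)
    (hab : form G a b = 0) (D : orbit G X)
    (hD : act G (rootRefl G a * rootRefl G b) D = D)
    {β γ : ι → ℤ} (hβ : β ∈ (D : Finset (ι → ℤ))) (hγ : γ ∈ (D : Finset (ι → ℤ)))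
    (haβ : form G a β ≠ 0) (hbγ : form G b γ ≠ 0) :
    ρ (rootRefl G a * rootRefl G b) (xi G X D) = xi G X D := by
  have hDo := (hX.of_mem_orbit D.2).1
  obtain ⟨n1, n2⟩ := ne_or_neg_of_form ha (b := b) (by rw [hab]; norm_num)
  obtain ⟨w, i, j, hne, hi, hj⟩ := exists_simple_pair_of_roots hP ha hb n1 n2
  have hij : ¬ G.Adj i j := fun h => by
    have h1 := form_simple_adj h
    rw [← form_geom w] at h1
    rcases hi with hi | hi <;> rcases hj with hj | hj <;> rw [hi, hj] at h1 <;> simp [hab] at h1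
  have pi := not_perp_of_act w hβ hi haβ
  have pj := not_perp_of_act w hγ hj hbγ
  have e : rootRefl G a * rootRefl G b = w * (s G i * s G j) * w⁻¹ := by
    rw [rootRefl_of_geom_simple ha hi, rootRefl_of_geom_simple hb hj]
    group
  rw [e] at hD ⊢
  refine hρ.apply_of_conj hX w _ D fun a => ?_
  have hD' := (hX.of_mem_orbit (orbitAct hX.1 w⁻¹ D).2).1
  have h1 : hElt G X (orbitAct hX.1 w⁻¹ D) j = 1 := hElt_of_not_perp pj
  have h2 : hElt G X (orbitAct hX.1 (s G j) (orbitAct hX.1 w⁻¹ D)) i = 1 :=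
    hElt_of_not_perp fun h => pi ((perp_act_not_adj hD' hne hij).1 h)
  have h3 : orbitAct hX.1 (s G i) (orbitAct hX.1 (s G j) (orbitAct hX.1 w⁻¹ D)) =
      orbitAct hX.1 w⁻¹ D := by
    have ho : ∀ B ∈ orbit G X, IsOrthoSet G B := fun B hB => (hX.of_mem_orbit hB).1
    have hD0 : orbitAct hX.1 (w * (s G i * s G j) * w⁻¹) D = D := Subtype.ext hD
    conv_rhs => rw [← hD0]
    rw [← orbitAct_mul hX.1 ho, ← orbitAct_mul hX.1 ho, ← orbitAct_mul hX.1 ho]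
    congr 1
    group
  rw [map_mul, Module.End.mul_apply, hρ.apply_single hX.1, hρ.apply_single hX.1, hCoeff, hCoeff,
    h1, h2, h3, map_one, one_mul, one_mul]

theorem IsRho.rootRefl_of_mem (hρ : IsRho G X ρ) (hX : IsAdmissible G X)
    (D : orbit G X) {β : ι → ℤ} (hβ : β ∈ (D : Finset (ι → ℤ))) :
    ρ (rootRefl G β) (xi G X D) = xi G X D := by
  have hDo := (hX.of_mem_orbit D.2).1
  have hβr := (hDo.1 β hβ).1
  obtain ⟨w, i, hw⟩ := hβr
  have e := rootRefl_of_geom_simple ⟨w, i, hw⟩ (Or.inl hw)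
  rw [e]
  refine hρ.apply_of_conj hX w _ D fun a => ?_
  have hi : simpleRoot i ∈ act G w⁻¹ D :=
    mem_act.2 ⟨β, hβ, by
      rw [← hw, ← geom_mul_apply, inv_mul_cancel, map_one (geom G)]
      exact posRep_of_mem (simpleRoot_mem_posRoots (G := G) i)⟩
  have h3 : orbitAct hX.1 (s G i) (orbitAct hX.1 w⁻¹ D) = orbitAct hX.1 w⁻¹ D :=
    Subtype.ext (act_s_of_mem (hX.of_mem_orbit (orbitAct hX.1 w⁻¹ D).2).1 hi)
  have h1 : hElt G X (orbitAct hX.1 w⁻¹ D) i = 1 := hElt_of_not_perp fun h => by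
    have := h _ hi
    rw [form_simple_self] at this
    exact absurd this (by norm_num)
  rw [hρ.apply_single hX.1, hCoeff, h1, h3, map_one, one_mul]

theorem IsRho.apply_of_mem_annGrp (hP : FormPosDef G) (hρ : IsRho G X ρ)
    (hX : IsAdmissible G X) {g : W G} (hg : g ∈ annGrp G X) : g ∈ kernelK G hX.1 ρ := by
  have hXm := self_mem_orbit G hX.1
  induction hg using Subgroup.closure_induction with
  | mem g hg =>
    refine annGens_induction hX.1 (p := fun g => g ∈ kernelK G hX.1 ρ) ?_ ?_ ?_ hg
    · change ρ 1 _ = _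
      rw [map_one, Module.End.one_apply]
    · exact fun β hβ => hρ.rootRefl_of_mem hX ⟨X, hXm⟩ hβ
    · intro α hα β hβ γ hγ hne j1 j2
      have hβr := (hX.1.1 β hβ).1
      have hγr := (hX.1.1 γ hγ).1
      have h0 := hX.1.2 β hβ γ hγ hne
      have e : rootRefl G α * rootRefl G β * rootRefl G γ * rootRefl G α =
          rootRefl G (geom G (rootRefl G α) β) * rootRefl G (geom G (rootRefl G α) γ) := by
        rw [rootRefl_conj hβr, rootRefl_conj hγr, rootRefl_inv hα]
        simp only [mul_assoc]
        rw [← mul_assoc (rootRefl G α) (rootRefl G α), rootRefl_mul_self hα, one_mul]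
      have hne0 : form G α β * form G α γ ≠ 0 := fun h => by
        rw [Joined] at j1 j2
        rcases mul_eq_zero.1 h with h | h <;> simp [h] at j1 j2
      have hact := act_annGen hP hX hα hβ hγ j1 j2 hne
      rw [e] at hact ⊢
      -- The witnesses are crossed: `r_α β` is not orthogonal to `γ`, nor `r_α γ` to `β`, both
      -- products being `-(α, β)(α, γ)`.
      refine hρ.rootRefl_mul_rootRefl hP hX (geom_mem_roots hβr _) (geom_mem_roots hγr _)
        (by rw [form_geom, h0]) ⟨X, hXm⟩ hact hγ hβ ?_ ?_
      · rw [geom_rootRefl hα, map_sub, LinearMap.sub_apply, map_smul, LinearMap.smul_apply, h0,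
          zero_sub, smul_eq_mul, form_comm β α, neg_ne_zero]
        exact hne0
      · rw [geom_rootRefl hα, map_sub, LinearMap.sub_apply, map_smul, LinearMap.smul_apply,
          form_comm γ β, h0, zero_sub, smul_eq_mul, form_comm γ α, neg_ne_zero, mul_comm]
        exact hne0
  | one =>
    change ρ 1 _ = _
    rw [map_one, Module.End.one_apply]
  | mul x y _ _ hx hy =>
    change ρ (x * y) _ = _
    rw [map_mul, Module.End.mul_apply, hy, hx]
  | inv x _ hx =>
    change ρ x⁻¹ _ = _
    conv_lhs => rw [← hx, ← Module.End.mul_apply, ← map_mul, inv_mul_cancel, map_one]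
    rfl

/-- At the top `h_{X,i} = r_i` and `r_i X = X` for `i ∈ C`. This is what makes `W(C)` act faithfully
on the line of `ξ_X`. -/
theorem IsRho.apply_of_mem_WC (hP : FormPosDef G) (hρ : IsRho G X ρ) (hX : IsAdmissible G X)
    (hhigh : IsHighest G X) {c : W G} (hc : c ∈ WC G X) (a : Coeff G X) :
    ρ c (Finsupp.single ⟨X, self_mem_orbit G hX.1⟩ a) =
      Finsupp.single ⟨X, self_mem_orbit G hX.1⟩
        (MonoidAlgebra.of (LaurentPolynomial ℤ) _ (⟨c, hc⟩ : WC G X) * a) := by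
  have hXm := self_mem_orbit G hX.1
  induction hc using Subgroup.closure_induction generalizing a with
  | mem c hc =>
    obtain ⟨i, hi, rfl⟩ := hc
    have h1 : hElt G X X i = ⟨s G i, Subgroup.subset_closure ⟨i, hi, rfl⟩⟩ :=
      Subtype.ext (hElt_of_hNode hP hX hhigh hXm (.base i hi))
    have h2 : orbitAct hX.1 (s G i) ⟨X, hXm⟩ = ⟨X, hXm⟩ :=
      Subtype.ext (act_s_of_perp hX.1 hi)
    rw [hρ.apply_single hX.1, h2, hCoeff, h1]
  | one =>
    have : (⟨1, one_mem _⟩ : WC G X) = 1 := rfl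
    rw [map_one, Module.End.one_apply, this, map_one, one_mul]
  | mul x y hx hy ihx ihy =>
    have : (⟨x * y, mul_mem hx hy⟩ : WC G X) = ⟨x, hx⟩ * ⟨y, hy⟩ := rfl
    rw [map_mul, Module.End.mul_apply, ihy, ihx, ← mul_assoc, ← map_mul, this]
  | inv x hx ih =>
    have : (⟨x⁻¹, inv_mem hx⟩ : WC G X) = ⟨x, hx⟩⁻¹ := rfl
    have h := ih (MonoidAlgebra.of (LaurentPolynomial ℤ) _ (⟨x, hx⟩⁻¹ : WC G X) * a)
    rw [← mul_assoc, ← map_mul, mul_inv_cancel, map_one, one_mul] at h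
    rw [← h, ← Module.End.mul_apply, ← map_mul, inv_mul_cancel, map_one, Module.End.one_apply,
      this]

theorem IsRho.eq_one_of_mem_WC (hP : FormPosDef G) (hρ : IsRho G X ρ) (hX : IsAdmissible G X)
    (hhigh : IsHighest G X) {c : W G} (hc : c ∈ WC G X) (hk : c ∈ kernelK G hX.1 ρ) : c = 1 := by
  change ρ c _ = _ at hk
  rw [xi, hρ.apply_of_mem_WC hP hX hhigh hc, mul_one] at hk
  have h := Finsupp.single_injective _ hk
  rw [← map_one (MonoidAlgebra.of (LaurentPolynomial ℤ) (WC G X))] at h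
  exact congrArg Subtype.val (MonoidAlgebra.of_injective h)

theorem exists_mul_of_mem_setStab (hP : FormPosDef G) (hX : IsAdmissible G X)
    (hhigh : IsHighest G X) {w : W G} (hw : w ∈ setStab G X) :
    ∃ κ ∈ annGrp G X, ∃ c ∈ WC G X, w = κ * c := by
  obtain ⟨p, hp, h⟩ := exists_raisingPath_inv_mul_mem hP hX hhigh w
  rw [show act G w X = X from hw] at hp
  -- The raising path now starts and ends at `X`; comparing it with the empty path puts it in the
  -- group.
  have hpK := hp.mul_inv_mem hP hX hhigh (self_mem_orbit G hX.1) .top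
  rw [inv_one, mul_one] at hpK
  obtain ⟨c, hc, κ, hκ, e⟩ := exists_mul_of_mem_sup hX.1 h
  refine ⟨p * (c * κ * c⁻¹), mul_mem hpK
    (conj_mem_annGrp_of_act_eq hX.1 (act_of_mem_WC hX.1 hc) hκ), c, hc, ?_⟩
  rw [mul_assoc, inv_mul_cancel_right, ← e, mul_inv_cancel_left]

/-- An element fixing `ξ_X` stabilizes `X`, hence is `κ c` with `κ` in the group and `c ∈ W(C)`. As
`κ` fixes `ξ_X`, so does `c`, which forces `c = 1`. -/
theorem IsRho.kernelK_eq (hP : FormPosDef G) (hρ : IsRho G X ρ) (hX : IsAdmissible G X)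
    (hhigh : IsHighest G X) : kernelK G hX.1 ρ = annGrp G X := by
  have hXm := self_mem_orbit G hX.1
  refine Set.Subset.antisymm (fun w hw => ?_) fun w hw => hρ.apply_of_mem_annGrp hP hX hw
  have hstab : w ∈ setStab G X := by
    obtain ⟨g, hg⟩ := hρ.exists_apply hX w ⟨X, hXm⟩
    change ρ w _ = _ at hw
    rw [xi, hg, mul_one] at hw
    rcases Finsupp.single_eq_single_iff _ _ _ _ |>.1 hw with ⟨h, -⟩ | ⟨-, h⟩
    · exact congrArg Subtype.val h
    · exact absurd h one_ne_zero
  obtain ⟨κ, hκ, c, hc, rfl⟩ := exists_mul_of_mem_setStab hP hX hhigh hstab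
  have hκ' := hρ.apply_of_mem_annGrp hP hX (inv_mem hκ)
  have hck : c ∈ kernelK G hX.1 ρ := by
    change ρ c _ = _
    change ρ (κ * c) _ = _ at hw
    change ρ κ⁻¹ _ = _ at hκ'
    conv_rhs => rw [← hκ', ← hw]
    rw [← Module.End.mul_apply, ← map_mul, inv_mul_cancel_left]
  rw [hρ.eq_one_of_mem_WC hP hX hhigh hc hck, mul_one]
  exact hκ

end Kernel

/-! ### A monoid action of the Brauer monoid -/

theorem rootRefl_braid {α γ : ι → ℤ} (hα : α ∈ roots G) (hγ : γ ∈ roots G)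
    (h : Joined G α γ) :
    rootRefl G α * rootRefl G γ * rootRefl G α = rootRefl G γ * rootRefl G α * rootRefl G γ := by
  have e := sq_eq_one_of_joined h
  have h1 : rootRefl G (geom G (rootRefl G α) γ) = rootRefl G (geom G (rootRefl G γ) α) := by
    refine rootRefl_of_eq_or_neg (geom_mem_roots hα _) ?_
    rw [geom_rootRefl hα, geom_rootRefl hγ, form_comm γ α]
    rcases mul_self_eq_one_iff.1 e with h | h <;> rw [h]
    · exact Or.inr (by module)
    · exact Or.inl (by module)
  rwa [rootRefl_conj hγ, rootRefl_conj hα, rootRefl_inv hα, rootRefl_inv hγ] at h1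

theorem form_of_joined_cases {α β : ι → ℤ} (h : Joined G α β) :
    form G α β = 1 ∨ form G α β = -1 :=
  mul_self_eq_one_iff.1 (sq_eq_one_of_joined h)

/-! ### Partial maps `e_β` and their commutation -/

section BrauerAction

variable {Q : Type*} [MulAction (W G) Q] {Bs : Q → Finset (ι → ℤ)}

/-- A `W`-equivariant family of orthogonal sets such that `annGrp G (Bs q)` fixes `q`. -/
structure IsAnnFamily (G : SimpleGraph ι) [DecidableRel G.Adj] {Q : Type*} [MulAction (W G) Q]
    (Bs : Q → Finset (ι → ℤ)) : Prop where
  ortho : ∀ q, IsOrthoSet G (Bs q)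
  smul : ∀ (w : W G) q, Bs (w • q) = act G w (Bs q)
  fix : ∀ q, ∀ g ∈ annGrp G (Bs q), g • q = q

open Classical in
/-- The partial action of `e_β` on `Q`. -/
def eAct (Bs : Q → Finset (ι → ℤ)) (β : ι → ℤ) (q : Q) : Option Q :=
  -- With `δ` acting trivially, `e_β² = δ e_β` makes `e_β` the identity on its image. The joined
  -- case is dictated by `e_β e_γ = r_γ r_β e_γ`; the orthogonal case is sent to the absorbing
  -- point.
  if posRep β ∈ Bs q then some q
  else if h : ∃ γ ∈ Bs q, Joined G β γ then some ((rootRefl G h.choose * rootRefl G β) • q)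
  else none

namespace IsAnnFamily

/-- The two results differ by the action of `r_β r_{γ'} r_γ r_β`, a generator that fixes `q`. So the
chosen `γ` in `eAct` does not matter. -/
theorem smul_eq_smul (hBs : IsAnnFamily G Bs) {β γ γ' : ι → ℤ} (hβ : β ∈ roots G) {q : Q}
    (hγ : γ ∈ Bs q) (hγ' : γ' ∈ Bs q) (h : Joined G β γ) (h' : Joined G β γ') :
    (rootRefl G γ * rootRefl G β) • q = (rootRefl G γ' * rootRefl G β) • q := by
  have hfix := hBs.fix q _ (rootRefl_mul_mem_annGrp hβ hγ' hγ (joined_comm.1 h') h)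
  conv_rhs => rw [← hfix]
  rw [← mul_smul]
  congr 1
  simp only [← mul_assoc]
  rw [mul_assoc (rootRefl G γ'), rootRefl_mul_self hβ, mul_one,
    rootRefl_mul_self ((hBs.ortho q).1 γ' hγ').1, one_mul]

theorem form_eq_zero_of_posRep_mem (hBs : IsAnnFamily G Bs) {β γ : ι → ℤ} {q : Q}
    (hβ : posRep β ∈ Bs q) (hγ : γ ∈ Bs q) (hne : posRep β ≠ γ) : form G β γ = 0 := by
  have h := (hBs.ortho q).2 _ hβ _ hγ hne
  rcases posRep_eq_or β with h' | h' <;> rw [h'] at h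
  · exact h
  · simpa using h

theorem not_joined_of_posRep_mem (hBs : IsAnnFamily G Bs) {β γ : ι → ℤ} {q : Q}
    (hβ : posRep β ∈ Bs q) (hγ : γ ∈ Bs q) : ¬ Joined G β γ := by
  intro h
  have h' : Joined G (posRep β) γ := by
    rwa [Joined, abs_form_of_eq_or_neg (posRep_eq_or β) (Or.inl rfl)]
  rw [Joined] at h'
  rcases form_eq_zero_or_two (hBs.ortho q) hβ hγ with h0 | h0 <;> rw [h0] at h' <;>
    norm_num at h'

theorem eAct_of_mem {β : ι → ℤ} {q : Q} (h : posRep β ∈ Bs q) :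
    eAct (G := G) Bs β q = some q := by
  rw [eAct, if_pos h]

theorem eAct_of_joined (hBs : IsAnnFamily G Bs) {β γ : ι → ℤ} (hβ : β ∈ roots G) {q : Q}
    (hγ : γ ∈ Bs q) (h : Joined G β γ) :
    eAct (G := G) Bs β q = some ((rootRefl G γ * rootRefl G β) • q) := by
  have hex : ∃ γ ∈ Bs q, Joined G β γ := ⟨γ, hγ, h⟩
  rw [eAct, if_neg fun hm => hBs.not_joined_of_posRep_mem hm hγ h, dif_pos hex,
    hBs.smul_eq_smul hβ hex.choose_spec.1 hγ hex.choose_spec.2 h]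

theorem eAct_of_perp {β : ι → ℤ} (hβ : β ∈ roots G) {q : Q}
    (h : ∀ γ ∈ Bs q, form G β γ = 0) : eAct (G := G) Bs β q = none := by
  rw [eAct, if_neg, dif_neg]
  · rintro ⟨γ, hγ, hj⟩
    rw [Joined, h γ hγ] at hj
    simp at hj
  · intro hm
    have h0 := h _ hm
    have h2 := form_self hβ
    rcases posRep_eq_or β with h' | h' <;> rw [h'] at h0
    · omega
    · rw [map_neg] at h0
      omega

theorem eAct_cases (hP : FormPosDef G) (hBs : IsAnnFamily G Bs) {β : ι → ℤ} (hβ : β ∈ roots G)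
    (q : Q) :
    posRep β ∈ Bs q ∨ (∃ γ ∈ Bs q, Joined G β γ) ∨ ∀ γ ∈ Bs q, form G β γ = 0 := by
  by_cases hm : posRep β ∈ Bs q
  · exact Or.inl hm
  refine Or.inr (or_iff_not_imp_left.2 fun h γ hγ => ?_)
  have hγp := (hBs.ortho q).1 γ hγ
  have n : ∀ h : β = γ ∨ β = -γ, False := fun h => hm (posRep_eq_of_eq_or_neg hγp h ▸ hγ)
  have hnj : ¬ Joined G β γ := fun hj => h ⟨γ, hγ, hj⟩
  rw [Joined] at hnj
  rcases joined_or_perp hP hβ hγp.1 (fun h => n (Or.inl h)) (fun h => n (Or.inr h)) with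
    h | h | h <;> simp [h] at hnj ⊢

theorem posRep_geom_mem (hBs : IsAnnFamily G Bs) {γ : ι → ℤ} {q : Q} (w : W G)
    (hγ : γ ∈ Bs q) : posRep (geom G w γ) ∈ Bs (w • q) := by
  rw [hBs.smul]
  exact posRep_geom_mem_act hγ

theorem forall_form_smul_iff (hBs : IsAnnFamily G Bs) {β : ι → ℤ} {q : Q} {w : W G} :
    (∀ γ ∈ Bs (w • q), form G β γ = 0) ↔ ∀ γ ∈ Bs q, form G β (geom G w γ) = 0 := by
  have key : ∀ x, form G β (posRep x) = 0 ↔ form G β x = 0 := fun x => by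
    rcases posRep_eq_or x with h | h <;> rw [h]
    rw [map_neg, neg_eq_zero]
  constructor
  · exact fun h γ hγ => (key _).1 (h _ (hBs.posRep_geom_mem w hγ))
  · intro h δ hδ
    rw [hBs.smul] at hδ
    obtain ⟨γ, hγ, rfl⟩ := mem_act.1 hδ
    exact (key _).2 (h γ hγ)

theorem eAct_smul_of_joined (hBs : IsAnnFamily G Bs) {β γ : ι → ℤ} (hβ : β ∈ roots G) {q : Q}
    (w : W G) (hγ : γ ∈ Bs q) (h : Joined G β (geom G w γ)) :
    eAct (G := G) Bs β (w • q) = some ((w * rootRefl G γ * w⁻¹ * rootRefl G β * w) • q) := by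
  have hγr := ((hBs.ortho q).1 γ hγ).1
  have h' : Joined G β (posRep (geom G w γ)) := by
    rwa [Joined, abs_form_of_eq_or_neg (Or.inl rfl) (posRep_eq_or _)]
  rw [hBs.eAct_of_joined hβ (hBs.posRep_geom_mem w hγ) h',
    rootRefl_posRep (geom_mem_roots hγr w), rootRefl_conj hγr, ← mul_smul]

theorem eAct_smul (hP : FormPosDef G) (hBs : IsAnnFamily G Bs) {β : ι → ℤ} (hβ : β ∈ roots G)
    (w : W G) (q : Q) :
    eAct (G := G) Bs (geom G w β) (w • q) = (eAct (G := G) Bs β q).map (w • ·) := by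
  rcases hBs.eAct_cases hP hβ q with h | ⟨γ, hγ, h⟩ | h
  · rw [eAct_of_mem h, eAct_of_mem]
    · rfl
    · have := hBs.posRep_geom_mem w h
      rwa [posRep_geom_posRep hβ] at this
  · rw [hBs.eAct_of_joined hβ hγ h, hBs.eAct_smul_of_joined (geom_mem_roots hβ w) w hγ
      ((joined_geom w).2 h), rootRefl_conj hβ, Option.map_some, ← mul_smul]
    congr 2
    group
  · rw [eAct_of_perp hβ h, eAct_of_perp (geom_mem_roots hβ w)]
    · rfl
    · rw [hBs.forall_form_smul_iff]
      intro γ hγ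
      rw [form_geom, h γ hγ]

theorem eAct_neg (hP : FormPosDef G) (hBs : IsAnnFamily G Bs) {β : ι → ℤ} (hβ : β ∈ roots G)
    (q : Q) : eAct (G := G) Bs (-β) q = eAct (G := G) Bs β q := by
  rcases hBs.eAct_cases hP hβ q with h | ⟨γ, hγ, h⟩ | h
  · rw [eAct_of_mem h, eAct_of_mem]
    rwa [posRep_neg hβ]
  · rw [hBs.eAct_of_joined hβ hγ h, hBs.eAct_of_joined (neg_mem_roots hβ) hγ, rootRefl_neg hβ]
    rwa [Joined, map_neg, LinearMap.neg_apply, abs_neg]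
  · rw [eAct_of_perp hβ h, eAct_of_perp (neg_mem_roots hβ)]
    intro γ hγ
    rw [map_neg, LinearMap.neg_apply, h γ hγ, neg_zero]

/-- In the joined case `r_γ r_β γ = ±β`, so the new set contains the positive one of `±β`. -/
theorem mem_of_eAct (hP : FormPosDef G) (hBs : IsAnnFamily G Bs) {β : ι → ℤ} (hβ : β ∈ roots G)
    {q q' : Q} (h : eAct (G := G) Bs β q = some q') : posRep β ∈ Bs q' := by
  rcases hBs.eAct_cases hP hβ q with h' | ⟨γ, hγ, h'⟩ | h'
  · rw [eAct_of_mem h', Option.some_inj] at h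
    exact h ▸ h'
  · rw [hBs.eAct_of_joined hβ hγ h', Option.some_inj] at h
    subst h
    have hγr := ((hBs.ortho q).1 γ hγ).1
    have hm := hBs.posRep_geom_mem (rootRefl G γ * rootRefl G β) hγ
    have e : geom G (rootRefl G γ * rootRefl G β) γ = -(form G β γ • β) := by
      have e1 := sq_eq_one_of_joined h'
      rw [geom_mul_apply, geom_rootRefl hβ, geom_rootRefl hγr, map_sub, LinearMap.sub_apply,
        form_self hγr, map_smul, LinearMap.smul_apply, smul_eq_mul, form_comm γ β, e1]
      module
    rw [e] at hm
    rcases form_of_joined_cases h' with h1 | h1 <;> rw [h1] at hm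
    · rwa [one_smul, posRep_neg hβ] at hm
    · simpa using hm
  · rw [eAct_of_perp hβ h'] at h
    cases h

theorem geom_eq_self (hBs : IsAnnFamily G Bs) {α β γ : ι → ℤ} (hβ : β ∈ roots G) {q : Q}
    (hγ : γ ∈ Bs q) (h1 : form G α β = 0) (h2 : form G α γ = 0) :
    geom G (rootRefl G γ * rootRefl G β) α = α := by
  rw [geom_mul_apply, geom_rootRefl hβ, h1, zero_smul, sub_zero,
    geom_rootRefl ((hBs.ortho q).1 γ hγ).1, h2, zero_smul, sub_zero]

theorem eAct_comm_of_mem (hP : FormPosDef G) (hBs : IsAnnFamily G Bs) {α β : ι → ℤ}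
    (hα : α ∈ roots G) (hβ : β ∈ roots G) (h : form G α β = 0) {q : Q} (hm : posRep α ∈ Bs q) :
    (eAct (G := G) Bs α q).bind (eAct (G := G) Bs β) =
      (eAct (G := G) Bs β q).bind (eAct (G := G) Bs α) := by
  rw [eAct_of_mem hm, Option.bind_some]
  rcases hBs.eAct_cases hP hβ q with h' | ⟨γ, hγ, h'⟩ | h'
  · rw [eAct_of_mem h', Option.bind_some, eAct_of_mem hm]
  · rw [hBs.eAct_of_joined hβ hγ h', Option.bind_some, eAct_of_mem]
    have hne : posRep α ≠ γ := by
      rintro rfl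
      rw [Joined, abs_form_of_eq_or_neg (Or.inl rfl) (posRep_eq_or α), form_comm, h] at h'
      simp at h'
    have h2 := hBs.posRep_geom_mem (rootRefl G γ * rootRefl G β) hm
    rwa [posRep_geom_posRep hα, hBs.geom_eq_self hβ hγ h
      (hBs.form_eq_zero_of_posRep_mem hm hγ hne)] at h2
  · rw [eAct_of_perp hβ h', Option.bind_none]

theorem eAct_comm_of_perp (hP : FormPosDef G) (hBs : IsAnnFamily G Bs) {α β : ι → ℤ}
    (hα : α ∈ roots G) (hβ : β ∈ roots G) (h : form G α β = 0) {q : Q}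
    (hp : ∀ γ ∈ Bs q, form G α γ = 0) :
    (eAct (G := G) Bs α q).bind (eAct (G := G) Bs β) =
      (eAct (G := G) Bs β q).bind (eAct (G := G) Bs α) := by
  rw [eAct_of_perp hα hp, Option.bind_none]
  rcases hBs.eAct_cases hP hβ q with h' | ⟨γ, hγ, h'⟩ | h'
  · rw [eAct_of_mem h', Option.bind_some, eAct_of_perp hα hp]
  · rw [hBs.eAct_of_joined hβ hγ h', Option.bind_some, eAct_of_perp hα]
    rw [hBs.forall_form_smul_iff]
    intro δ hδ
    rw [← hBs.geom_eq_self hβ hγ h (hp γ hγ), form_geom, hp δ hδ]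
  · rw [eAct_of_perp hβ h', Option.bind_none]

theorem geom_of_ne (hBs : IsAnnFamily G Bs) {α γ δ : ι → ℤ} (hα : α ∈ roots G) {q : Q}
    (hγ : γ ∈ Bs q) (hδ : δ ∈ Bs q) (hne : δ ≠ γ) :
    geom G (rootRefl G γ * rootRefl G α) δ =
      δ - form G α δ • α + (form G α δ * form G α γ) • γ := by
  rw [geom_mul_apply, geom_rootRefl hα, geom_rootRefl ((hBs.ortho q).1 γ hγ).1, map_sub,
    LinearMap.sub_apply, (hBs.ortho q).2 δ hδ γ hγ hne, map_smul, LinearMap.smul_apply,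
    smul_eq_mul, form_comm δ α]
  module

/-- The root `ε` is unaffected by the move for `α`, and `δ` remains joined to `α` after the move for
`β`. Both orders then give `r_ε r_β r_δ r_α q`. -/
theorem eAct_comm_of_joined_perp (hBs : IsAnnFamily G Bs) {α β : ι → ℤ}
    (hα : α ∈ roots G) (hβ : β ∈ roots G) (h : form G α β = 0) {q : Q} {δ ε : ι → ℤ}
    (hδ : δ ∈ Bs q) (hε : ε ∈ Bs q) (hαδ : Joined G α δ) (hβε : Joined G β ε)
    (hαε : form G α ε = 0) :
    (eAct (G := G) Bs α q).bind (eAct (G := G) Bs β) =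
      (eAct (G := G) Bs β q).bind (eAct (G := G) Bs α) := by
  have hδr := ((hBs.ortho q).1 δ hδ).1
  have hεr := ((hBs.ortho q).1 ε hε).1
  have hne : δ ≠ ε := by
    rintro rfl
    rw [Joined, hαε] at hαδ
    simp at hαδ
  have h0 := (hBs.ortho q).2 δ hδ ε hε hne
  rw [hBs.eAct_of_joined hα hδ hαδ, hBs.eAct_of_joined hβ hε hβε, Option.bind_some,
    Option.bind_some, hBs.eAct_smul_of_joined hβ _ hε, hBs.eAct_smul_of_joined hα _ hδ]
  · have c1 := rootRefl_comm hδr hεr h0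
    have c2 := rootRefl_comm hα hβ h
    have c3 := rootRefl_comm hα hεr hαε
    congr 2
    simp only [mul_inv_rev, rootRefl_inv hα, rootRefl_inv hβ, rootRefl_inv hδr, rootRefl_inv hεr]
    have s1 := rootRefl_mul_self hα
    have s2 := rootRefl_mul_self hβ
    have s3 := rootRefl_mul_self hδr
    have s4 := rootRefl_mul_self hεr
    generalize rootRefl G α = a at *
    generalize rootRefl G β = b at *
    generalize rootRefl G δ = d at *
    generalize rootRefl G ε = e at *
    calc d * a * e * (a * d) * b * (d * a)
        = d * (a * e) * (a * d) * b * (d * a) := by simp only [mul_assoc]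
      _ = (d * e) * (a * a) * d * b * (d * a) := by rw [← c3]; simp only [mul_assoc]
      _ = e * (d * d) * b * (d * a) := by rw [← c1, s1]; simp only [mul_assoc, one_mul]
      _ = e * b * d * a := by rw [s3]; simp only [mul_assoc, mul_one]
      _ = e * b * d * (b * (e * a) * e * b) := by
          rw [c3, mul_assoc b, mul_assoc a, s4, mul_one, c2, mul_assoc a, s2, mul_one]
      _ = e * b * d * (b * e) * a * (e * b) := by simp only [mul_assoc]
  · rw [hBs.geom_of_ne hβ hε hδ hne, Joined, map_add, map_sub, map_smul, map_smul, h, hαε,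
      smul_zero, smul_zero, sub_zero, add_zero]
    exact hαδ
  · rw [hBs.geom_eq_self hα hδ (by rw [form_comm, hαε]) (by rw [form_comm, h0])]
    exact hβε

theorem form_geom_of_ne (hBs : IsAnnFamily G Bs) {α β γ δ : ι → ℤ} (hα : α ∈ roots G)
    (h : form G α β = 0) {q : Q} (hγ : γ ∈ Bs q) (hδ : δ ∈ Bs q) (hne : δ ≠ γ) :
    form G β (geom G (rootRefl G γ * rootRefl G α) δ) =
      form G β δ + form G α δ * (form G α γ * form G β γ) := by
  rw [hBs.geom_of_ne hα hγ hδ hne, map_add, map_sub, map_smul, map_smul, form_comm β α, h,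
    smul_eq_mul, smul_eq_mul]
  ring

/-- The product of `β` with `r_γ r_α δ` is `2(β, δ) = ±2`, which forces equality up to sign. -/
theorem eq_or_neg_geom_of_same_sign (hP : FormPosDef G) (hBs : IsAnnFamily G Bs) {α β : ι → ℤ}
    (hα : α ∈ roots G) (hβ : β ∈ roots G) (h : form G α β = 0) {q : Q} {γ δ : ι → ℤ}
    (hγ : γ ∈ Bs q) (hδ : δ ∈ Bs q) (hne : δ ≠ γ) (hαδ : Joined G α δ) (hβδ : Joined G β δ)
    (hs : form G α γ * form G β γ = form G α δ * form G β δ) :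
    β = geom G (rootRefl G γ * rootRefl G α) δ ∨
      β = -geom G (rootRefl G γ * rootRefl G α) δ := by
  have e := hBs.form_geom_of_ne hα h hγ hδ hne
  have e1 := sq_eq_one_of_joined hαδ
  rw [hs, ← mul_assoc, e1, one_mul] at e
  have hb := form_le_two hP hβ (geom_mem_roots ((hBs.ortho q).1 δ hδ).1
    (rootRefl G γ * rootRefl G α))
  rcases form_of_joined_cases hβδ with h1 | h1 <;> rw [h1] at e
  · exact Or.inl (hb.2.1 e)
  · exact Or.inr (hb.2.2.2 e)

/-- After the move for `α` the set contains `±β`, so `e_β` does nothing, and symmetrically. The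
results `r_γ r_α q` and `r_γ r_β q` agree because `r_γ (r_α r_γ r_δ r_α) r_γ` fixes `q`. -/
theorem eAct_comm_of_same_sign (hP : FormPosDef G) (hBs : IsAnnFamily G Bs) {α β : ι → ℤ}
    (hα : α ∈ roots G) (hβ : β ∈ roots G) (h : form G α β = 0) {q : Q} {γ δ : ι → ℤ}
    (hγ : γ ∈ Bs q) (hδ : δ ∈ Bs q) (hne : δ ≠ γ) (hαγ : Joined G α γ) (hβγ : Joined G β γ)
    (hαδ : Joined G α δ) (hβδ : Joined G β δ)
    (hs : form G α γ * form G β γ = form G α δ * form G β δ) :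
    (eAct (G := G) Bs α q).bind (eAct (G := G) Bs β) =
      (eAct (G := G) Bs β q).bind (eAct (G := G) Bs α) := by
  have hγr := ((hBs.ortho q).1 γ hγ).1
  have hδr := ((hBs.ortho q).1 δ hδ).1
  have half : ∀ {α β : ι → ℤ}, α ∈ roots G → β ∈ roots G → form G α β = 0 →
      Joined G α γ → Joined G α δ → Joined G β δ →
      form G α γ * form G β γ = form G α δ * form G β δ →
      (eAct (G := G) Bs α q).bind (eAct (G := G) Bs β) =
        some ((rootRefl G γ * rootRefl G α) • q) := by
    intro α β hα hβ h hαγ hαδ hβδ hs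
    rw [hBs.eAct_of_joined hα hγ hαγ, Option.bind_some, eAct_of_mem]
    have hm := hBs.posRep_geom_mem (rootRefl G γ * rootRefl G α) hδ
    rw [posRep_eq_of_eq_or_neg ((hBs.ortho _).1 _ hm)]
    · exact hm
    · have hr := geom_mem_roots hδr (rootRefl G γ * rootRefl G α)
      rcases hBs.eq_or_neg_geom_of_same_sign hP hα hβ h hγ hδ hne hαδ hβδ hs with h1 | h1 <;>
        rw [h1]
      · exact eq_or_neg_posRep _
      · rw [neg_inj, neg_eq_iff_eq_neg]
        exact (eq_or_neg_posRep _).symm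
  rw [half hα hβ h hαγ hαδ hβδ hs, half hβ hα (by rw [form_comm, h]) hβγ hβδ hαδ
    (by rw [mul_comm, hs, mul_comm])]
  have hr : rootRefl G β = rootRefl G γ * rootRefl G α * rootRefl G δ *
      (rootRefl G γ * rootRefl G α)⁻¹ := by
    rw [← rootRefl_conj hδr]
    exact rootRefl_of_eq_or_neg (geom_mem_roots hδr _)
      (by
        rcases hBs.eq_or_neg_geom_of_same_sign hP hα hβ h hγ hδ hne hαδ hβδ hs with h1 | h1
        · exact Or.inl h1.symm
        · exact Or.inr (by rw [h1, neg_neg]))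
  have hk := hBs.fix q _ (mul_mem (mul_mem (rootRefl_mem_annGrp hγ)
    (rootRefl_mul_mem_annGrp hα hγ hδ (joined_comm.1 hαγ) hαδ)) (rootRefl_mem_annGrp hγ))
  congr 1
  conv_lhs => rw [← hk]
  rw [← mul_smul, hr, mul_inv_rev, rootRefl_inv hα, rootRefl_inv hγr]
  congr 1
  have c1 := rootRefl_braid hα hγr hαγ
  have s1 := rootRefl_mul_self hα
  have s3 := rootRefl_mul_self hγr
  generalize rootRefl G α = a at *
  generalize rootRefl G γ = c at *
  generalize rootRefl G δ = d at *
  calc c * a * (c * (a * c * d * a) * c) = c * a * (c * a * c) * d * a * c := by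
        simp only [mul_assoc]
    _ = c * (a * a) * c * a * d * a * c := by rw [← c1]; simp only [mul_assoc]
    _ = c * (c * a * d * (a * c)) := by rw [s1]; simp only [mul_assoc, one_mul]

/-- Under the sign condition, every root of the set after the move for `α` is orthogonal to `β`, so
`e_β` kills the result. -/
theorem bind_eAct_of_opposite (hBs : IsAnnFamily G Bs) {α β : ι → ℤ}
    (hα : α ∈ roots G) (hβ : β ∈ roots G) (h : form G α β = 0) {q : Q} {γ : ι → ℤ}
    (hγ : γ ∈ Bs q) (hαγ : Joined G α γ)
    (hs : ∀ δ ∈ Bs q, δ ≠ γ → form G β δ + form G α δ * (form G α γ * form G β γ) = 0) :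
    (eAct (G := G) Bs α q).bind (eAct (G := G) Bs β) = none := by
  rw [hBs.eAct_of_joined hα hγ hαγ, Option.bind_some, eAct_of_perp hβ]
  rw [hBs.forall_form_smul_iff]
  intro δ hδ
  by_cases hne : δ = γ
  · subst hne
    have hδr := ((hBs.ortho q).1 δ hδ).1
    have e1 := sq_eq_one_of_joined hαγ
    have e2 : geom G (rootRefl G δ * rootRefl G α) δ = -(form G α δ • α) := by
      rw [geom_mul_apply, geom_rootRefl hα, geom_rootRefl hδr, map_sub, LinearMap.sub_apply,
        form_self hδr, map_smul, LinearMap.smul_apply, smul_eq_mul, form_comm δ α, e1]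
      module
    rw [e2, map_neg, map_smul, form_comm β α, h, smul_zero, neg_zero]
  · rw [hBs.form_geom_of_ne hα h hγ hδ hne, hs δ hδ hne]

/-- After the cases where one root lies in or is orthogonal to the set, and those where a member is
joined to only one of `α`, `β`, both are joined to exactly the same members. Either two members `γ ≠
δ` have the same sign `(α, ·)(β, ·)` and the two orders agree, or all signs differ from that of `γ`
and both orders give `none`. -/
theorem eAct_comm (hP : FormPosDef G) (hBs : IsAnnFamily G Bs) {α β : ι → ℤ}
    (hα : α ∈ roots G) (hβ : β ∈ roots G) (h : form G α β = 0) (q : Q) :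
    (eAct (G := G) Bs α q).bind (eAct (G := G) Bs β) =
      (eAct (G := G) Bs β q).bind (eAct (G := G) Bs α) := by
  have h' : form G β α = 0 := by rw [form_comm, h]
  rcases hBs.eAct_cases hP hα q with hα1 | ⟨γ, hγ, hαγ⟩ | hα1
  · exact hBs.eAct_comm_of_mem hP hα hβ h hα1
  swap
  · exact hBs.eAct_comm_of_perp hP hα hβ h hα1
  rcases hBs.eAct_cases hP hβ q with hβ1 | ⟨ε, hε, hβε⟩ | hβ1
  · exact (hBs.eAct_comm_of_mem hP hβ hα h' hβ1).symm
  swap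
  · exact (hBs.eAct_comm_of_perp hP hβ hα h' hβ1).symm
  have ca := fun δ hδ => form_cases_of_joined hP (hBs.ortho q) hα hγ (δ := δ) hδ hαγ
  have cb := fun δ hδ => form_cases_of_joined hP (hBs.ortho q) hβ hε (δ := δ) hδ hβε
  by_cases hc : ∃ δ ∈ Bs q, Joined G β δ ∧ form G α δ = 0
  · obtain ⟨δ, hδ, h1, h2⟩ := hc
    exact hBs.eAct_comm_of_joined_perp hα hβ h hγ hδ hαγ h1 h2
  by_cases hc' : ∃ δ ∈ Bs q, Joined G α δ ∧ form G β δ = 0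
  · obtain ⟨δ, hδ, h1, h2⟩ := hc'
    exact (hBs.eAct_comm_of_joined_perp hβ hα h' hε hδ hβε h1 h2).symm
  have hβγ : Joined G β γ := (cb γ hγ).resolve_left fun h => hc' ⟨γ, hγ, hαγ, h⟩
  by_cases hs : ∃ δ ∈ Bs q, δ ≠ γ ∧ Joined G α δ ∧ Joined G β δ ∧
      form G α γ * form G β γ = form G α δ * form G β δ
  · obtain ⟨δ, hδ, hne, h1, h2, h3⟩ := hs
    exact hBs.eAct_comm_of_same_sign hP hα hβ h hγ hδ hne hαγ hβγ h1 h2 h3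
  have key : ∀ δ ∈ Bs q, δ ≠ γ → form G β δ + form G α δ * (form G α γ * form G β γ) = 0 ∧
      form G α δ + form G β δ * (form G β γ * form G α γ) = 0 := by
    intro δ hδ hne
    rcases ca δ hδ with h1 | h1
    · have h2 : form G β δ = 0 := (cb δ hδ).resolve_right fun h => hc ⟨δ, hδ, h, h1⟩
      simp [h1, h2]
    · have h2 : Joined G β δ := (cb δ hδ).resolve_left fun h => hc' ⟨δ, hδ, h1, h⟩
      have h3 : ¬ form G α γ * form G β γ = form G α δ * form G β δ :=
        fun h3 => hs ⟨δ, hδ, hne, h1, h2, h3⟩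
      rcases form_of_joined_cases hαγ with e1 | e1 <;>
      rcases form_of_joined_cases hβγ with e2 | e2 <;>
      rcases form_of_joined_cases h1 with e3 | e3 <;>
      rcases form_of_joined_cases h2 with e4 | e4 <;>
      rw [e1, e2, e3, e4] at h3 ⊢ <;> revert h3 <;> norm_num
  rw [hBs.bind_eAct_of_opposite hα hβ h hγ hαγ fun δ hδ hne => (key δ hδ hne).1,
    hBs.bind_eAct_of_opposite hβ hα h' hγ hβγ fun δ hδ hne => (key δ hδ hne).2]

end IsAnnFamily

end BrauerAction

/-! ### The action of the Brauer monoid -/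

section BrauerHom

variable {Q : Type*} [MulAction (W G) Q] {Bs : Q → Finset (ι → ℤ)}

/-- The action of the generators of the Brauer monoid on `Option Q`. -/
def genAct (G : SimpleGraph ι) [DecidableRel G.Adj] {Q : Type*} [MulAction (W G) Q]
    (Bs : Q → Finset (ι → ℤ)) : Gen ι → Function.End (Option Q)
  | .r i => fun o => o.map (s G i • ·)
  | .e i => fun o => o.bind (eAct (G := G) Bs (simpleRoot i))
  | .delta => id
  | .deltaInv => id

/-- Relations mixing `r` and `e` come from equivariance of `eAct`. Those absorbing or squaring `e_i`
hold since `α_i` lies in the resulting set. The relation `r_j r_i e_j = e_i e_j` is the definition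
of `eAct` with `γ = α_j`. -/
theorem genAct_rel (hP : FormPosDef G) (hBs : IsAnnFamily G Bs) (x y : FreeMonoid (Gen ι))
    (h : BrRel G x y) :
    FreeMonoid.lift (genAct G Bs) x = FreeMonoid.lift (genAct G Bs) y := by
  have eq (i : ι) (w : W G) (q : Q) := hBs.eAct_smul hP (simpleRoot_mem_roots i) w q
  have ers : ∀ (i : ι) (q : Q), eAct (G := G) Bs (simpleRoot i) (s G i • q) =
      (eAct (G := G) Bs (simpleRoot i) q).map (s G i • ·) := fun i q => by
    rw [← eq i (s G i) q, geom_s_simple_self, hBs.eAct_neg hP (simpleRoot_mem_roots i)]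
  have ree : ∀ (i : ι) (q : Q), (eAct (G := G) Bs (simpleRoot i) q).map (s G i • ·) =
      eAct (G := G) Bs (simpleRoot i) q := fun i q => by
    rcases ho : eAct (G := G) Bs (simpleRoot i) q with _ | q'
    · rfl
    · have hm := hBs.mem_of_eAct hP (simpleRoot_mem_roots i) ho
      rw [posRep_of_mem (simpleRoot_mem_posRoots (G := G) i)] at hm
      have := hBs.fix q' _ (rootRefl_mem_annGrp hm)
      rw [rootRefl_simple] at this
      rw [Option.map_some, this]
  have eadj : ∀ (i j : ι), G.Adj i j → ∀ q : Q,
      (eAct (G := G) Bs (simpleRoot i) (s G j • q)).map (s G j • ·) =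
        eAct (G := G) Bs (simpleRoot i + simpleRoot j) q := fun i j hij q => by
    rw [← eq, geom_simple_add hij, ← mul_smul, s_mul_self, one_smul]
  have hend : ∀ (f g : Function.End (Option Q)) (o : Option Q), (f * g) o = f (g o) :=
    fun _ _ _ => rfl
  cases h <;> simp only [map_mul, map_one, FreeMonoid.lift_eval_of] <;> funext o <;>
    simp only [hend]
  case delta_central => rfl
  case delta_inv => rfl
  all_goals
    rcases o with _ | q
    · rfl
    simp only [genAct, Option.map_some, Option.bind_some, id]
  case rSrr i => rw [← mul_smul, s_mul_self, one_smul]; rfl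
  case rSer i => rw [ers, ree]
  case rSre i => rw [ree]
  case hSee i =>
    rcases ho : eAct (G := G) Bs (simpleRoot i) q with _ | q'
    · rfl
    · rw [Option.bind_some,
        IsAnnFamily.eAct_of_mem (hBs.mem_of_eAct hP (simpleRoot_mem_roots i) ho)]
  case hCrr i j hne hij => rw [← mul_smul, ← mul_smul, s_comm hne hij]
  case hCer i j hne hij => rw [← eq, geom_simple_of_not_adj hne hij]
  case hCee i j hne hij =>
    exact hBs.eAct_comm hP (simpleRoot_mem_roots j) (simpleRoot_mem_roots i)
      (by rw [form_comm, form_simple_not_adj hne hij]) q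
  case hNrrr i j hij => rw [← mul_smul, ← mul_smul, ← mul_smul, ← mul_smul, s_braid hij]
  case hNrer i j hij => rw [eadj i j hij, eadj j i hij.symm, add_comm]
  case rNrre i j hij =>
    rcases ho : eAct (G := G) Bs (simpleRoot j) q with _ | q'
    · rfl
    · have hm := hBs.mem_of_eAct hP (simpleRoot_mem_roots j) ho
      rw [posRep_of_mem (simpleRoot_mem_posRoots (G := G) j)] at hm
      rw [Option.bind_some, hBs.eAct_of_joined (simpleRoot_mem_roots i) hm
        (by rw [Joined, form_simple_adj hij]; rfl), rootRefl_simple, rootRefl_simple, mul_smul]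
      rfl

/-- The action of the Brauer monoid on `Option Q`. -/
def brAct (hP : FormPosDef G) (hBs : IsAnnFamily G Bs) : BrM G →* Function.End (Option Q) :=
  PresentedMonoid.lift (genAct G Bs) (genAct_rel hP hBs)

theorem brAct_toBr (hP : FormPosDef G) (hBs : IsAnnFamily G Bs) (w : W G) (q : Q) :
    brAct hP hBs (toBr G w) (some q) = some (w • q) := by
  induction w using W_induction_left with
  | one => rw [map_one, map_one, one_smul]; rfl
  | mul w i ih =>
    rw [map_mul, map_mul, mul_smul, toBr_s]
    change brAct hP hBs (rBr G i) (brAct hP hBs (toBr G w) (some q)) = _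
    rw [ih]
    rfl

theorem brAct_toBr_none (hP : FormPosDef G) (hBs : IsAnnFamily G Bs) (w : W G) :
    brAct hP hBs (toBr G w) none = none := by
  induction w using W_induction_left with
  | one => rw [map_one, map_one]; rfl
  | mul w i ih =>
    rw [map_mul, map_mul, toBr_s]
    change brAct hP hBs (rBr G i) (brAct hP hBs (toBr G w) none) = _
    rw [ih]
    rfl

theorem brAct_eRoot (hP : FormPosDef G) (hBs : IsAnnFamily G Bs) {β : ι → ℤ} (hβ : β ∈ roots G)
    (o : Option Q) : brAct hP hBs (eRoot G β) o = o.bind (eAct (G := G) Bs β) := by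
  obtain ⟨w, i, rfl⟩ := hβ
  rw [eRoot_geom, map_mul, map_mul]
  change brAct hP hBs (toBr G w) ((brAct hP hBs (toBr G w⁻¹) o).bind
    (eAct (G := G) Bs (simpleRoot i))) = _
  rcases o with _ | q
  · rw [brAct_toBr_none]
    exact brAct_toBr_none hP hBs w
  · rw [brAct_toBr, Option.bind_some, Option.bind_some]
    have h := hBs.eAct_smul hP (simpleRoot_mem_roots i) w (w⁻¹ • q)
    rw [smul_inv_smul] at h
    rw [h]
    rcases eAct (G := G) Bs (simpleRoot i) (w⁻¹ • q) with _ | q'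
    · exact brAct_toBr_none hP hBs w
    · exact brAct_toBr hP hBs w q'

end BrauerHom

/-! ### The element `e_X` -/

section ESet

variable {X : Finset (ι → ℤ)}

theorem eRoot_commute (hP : FormPosDef G) {B : Finset (ι → ℤ)} (hB : IsOrthoSet G B)
    {β γ : ι → ℤ} (hβ : β ∈ B) (hγ : γ ∈ B) : Commute (eRoot G β) (eRoot G γ) := by
  by_cases h : β = γ
  · rw [h]
  · exact eRoot_mul_comm hP (hB.1 β hβ).1 (hB.1 γ hγ).1 (hB.2 β hβ γ hγ h)

theorem prod_eRoot_eq_of_perm (hP : FormPosDef G) {B : Finset (ι → ℤ)} (hB : IsOrthoSet G B)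
    {l : List (ι → ℤ)} (hl : B.toList.Perm l) : eSet G B = (l.map (eRoot G)).prod := by
  rw [eSet]
  refine (hl.map _).prod_eq' ?_
  rw [List.pairwise_map]
  refine (List.pairwise_of_forall_mem_list fun β hβ γ hγ => ?_)
  exact eRoot_commute hP hB (Finset.mem_toList.1 hβ) (Finset.mem_toList.1 hγ)

theorem exists_eSet_eq_mul (hP : FormPosDef G) (hX : IsOrthoSet G X) {β : ι → ℤ} (hβ : β ∈ X) :
    ∃ y, eSet G X = eRoot G β * y := by
  have h := List.perm_cons_erase (Finset.mem_toList.2 hβ)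
  exact ⟨_, by rw [prod_eRoot_eq_of_perm hP hX h, List.map_cons, List.prod_cons]⟩

theorem toBr_mul_eSet (hP : FormPosDef G) (hX : IsOrthoSet G X) (w : W G) :
    toBr G w * eSet G X = eSet G (act G w X) * toBr G w := by
  have h1 : ∀ l : List (ι → ℤ), (∀ β ∈ l, β ∈ roots G) →
      toBr G w * (l.map (eRoot G)).prod =
        ((l.map fun β => posRep (geom G w β)).map (eRoot G)).prod * toBr G w := by
    intro l hl
    induction l with
    | nil => simp
    | cons β l ih =>
      have hβ := hl β List.mem_cons_self
      simp only [List.map_cons, List.prod_cons]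
      rw [mul_assoc, ← ih fun γ hγ => hl γ (List.mem_cons_of_mem _ hγ),
        eRoot_of_eq_or_neg (geom_mem_roots hβ w) (eq_or_neg_posRep _), eRoot_conj hβ, mul_assoc,
        ← mul_assoc (toBr G w⁻¹), toBr_inv_mul, one_mul, mul_assoc]
  rw [eSet, h1 _ fun β hβ => (hX.1 β (Finset.mem_toList.1 hβ)).1]
  congr 1
  refine (prod_eRoot_eq_of_perm hP (hX.act w) ?_).symm
  have hinj : Set.InjOn (fun β => posRep (geom G w β)) X :=
    Finset.card_image_iff.1 (card_act hX w)
  refine (List.perm_ext_iff_of_nodup (Finset.nodup_toList _) ?_).2 fun γ => ?_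
  · refine (List.nodup_map_iff_inj_on (Finset.nodup_toList _)).2 fun β hβ γ hγ h => ?_
    exact hinj (Finset.mem_toList.1 hβ) (Finset.mem_toList.1 hγ) h
  · simp [mem_act]

/-- For every `γ ∈ X` joined to `α`, the product `r_γ r_α e_X` equals `e_α e_X`, independently of
`γ`. Replacing `γ` by `β` in `r_α r_β r_γ r_α e_X` makes everything cancel. -/
theorem annGrp_le_annihilator (hP : FormPosDef G) (hX : IsOrthoSet G X) :
    annGrp G X ≤ annihilator G X := by
  rw [Subgroup.closure_le]
  intro g hg
  refine annGens_induction hX (p := fun g => g ∈ annihilator G X) (one_mem _) ?_ ?_ hg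
  · intro β hβ
    obtain ⟨y, hy⟩ := exists_eSet_eq_mul hP hX hβ
    change toBr G _ * eSet G X = eSet G X
    rw [hy, ← mul_assoc, toBr_rootRefl_mul_eRoot (hX.1 β hβ).1]
  · intro α hα β hβ γ hγ hne j1 j2
    have key : ∀ γ ∈ X, Joined G α γ →
        toBr G (rootRefl G γ * rootRefl G α) * eSet G X = eRoot G α * eSet G X := by
      intro γ hγ j
      obtain ⟨y, hy⟩ := exists_eSet_eq_mul hP hX hγ
      rw [hy, ← mul_assoc, toBr_mul_eRoot_of_joined hP hα (hX.1 γ hγ).1 j, mul_assoc]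
    change toBr G _ * eSet G X = eSet G X
    rw [mul_assoc (rootRefl G α * rootRefl G β), map_mul, mul_assoc, key γ hγ j2, ← key β hβ j1,
      ← mul_assoc, ← map_mul, mul_assoc (rootRefl G α),
      ← mul_assoc (rootRefl G β) (rootRefl G β), rootRefl_mul_self (hX.1 β hβ).1, one_mul,
      rootRefl_mul_self hα, map_one, one_mul]

/-! ### The Brauer monoid acting on the cosets of `annGrp G X` -/

/-- The set `wX` attached to the coset of `w`. -/
def cosetSet (hP : FormPosDef G) (hX : IsAdmissible G X) : W G ⧸ annGrp G X → Finset (ι → ℤ) :=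
  Quotient.lift (fun w => act G w X) fun w v h => by
    have h' := act_of_mem_annGrp hP hX (QuotientGroup.leftRel_apply.1 h)
    change act G w X = act G v X
    conv_lhs => rw [← h', ← act_mul hX.1.1, mul_inv_cancel_left]

/-- The group attached to `wX` is the conjugate by `w` of the one attached to `X`, so it fixes the
coset of `w`. -/
theorem cosetSet_isAnnFamily (hP : FormPosDef G) (hX : IsAdmissible G X) :
    IsAnnFamily G (cosetSet hP hX) where
  ortho q := by
    induction q using QuotientGroup.induction_on with
    | H w => exact hX.1.act w
  smul v q := by
    induction q using QuotientGroup.induction_on with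
    | H w => exact act_mul hX.1.1 v w
  fix q g hg := by
    induction q using QuotientGroup.induction_on with
    | H w =>
      change g ∈ annGrp G (act G w X) at hg
      refine (QuotientGroup.eq.2 ?_ : ((g * w : W G) : W G ⧸ annGrp G X) = (w : W G))
      have h := inv_mem (inv_conj_mem_annGrp hX.1 rfl hg)
      convert h using 1
      group

/-- The factors of `e_X` commute, so any `e_β` with `β ∈ X` can be applied last, and its image lies
over sets containing `β`. -/
theorem mem_of_brAct_eSet (hP : FormPosDef G) (hX : IsAdmissible G X)
    {o : Option (W G ⧸ annGrp G X)} {q : W G ⧸ annGrp G X}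
    (h : brAct hP (cosetSet_isAnnFamily hP hX) (eSet G X) o = some q) :
    X ⊆ cosetSet hP hX q := by
  intro β hβ
  have hβp := hX.1.1 β hβ
  obtain ⟨y, hy⟩ := exists_eSet_eq_mul hP hX.1 hβ
  rw [hy, map_mul] at h
  change brAct hP (cosetSet_isAnnFamily hP hX) (eRoot G β)
    (brAct hP (cosetSet_isAnnFamily hP hX) y o) = some q at h
  rw [brAct_eRoot hP _ hβp.1] at h
  obtain ⟨q', -, hq'⟩ := Option.bind_eq_some_iff.1 h
  have := (cosetSet_isAnnFamily hP hX).mem_of_eAct hP hβp.1 hq'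
  rwa [posRep_of_mem hβp] at this

theorem brAct_eSet (hP : FormPosDef G) (hX : IsAdmissible G X) {q : W G ⧸ annGrp G X}
    (hq : X ⊆ cosetSet hP hX q) :
    brAct hP (cosetSet_isAnnFamily hP hX) (eSet G X) (some q) = some q := by
  have h : ∀ l : List (ι → ℤ), (∀ β ∈ l, β ∈ X) →
      brAct hP (cosetSet_isAnnFamily hP hX) (l.map (eRoot G)).prod (some q) = some q := by
    intro l hl
    induction l with
    | nil => rw [List.map_nil, List.prod_nil, map_one]; rfl
    | cons β l ih =>
      have hβ := hl β List.mem_cons_self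
      have hβp := hX.1.1 β hβ
      rw [List.map_cons, List.prod_cons, map_mul]
      change brAct hP (cosetSet_isAnnFamily hP hX) (eRoot G β)
        (brAct hP (cosetSet_isAnnFamily hP hX) _ (some q)) = some q
      rw [ih fun γ hγ => hl γ (List.mem_cons_of_mem _ hγ), brAct_eRoot hP _ hβp.1,
        Option.bind_some, IsAnnFamily.eAct_of_mem]
      rw [posRep_of_mem hβp]
      exact hq hβ
  exact h _ fun β hβ => Finset.mem_toList.1 hβ

theorem cosetSet_mk (hP : FormPosDef G) (hX : IsAdmissible G X) (w : W G) :
    cosetSet hP hX (w : W G ⧸ annGrp G X) = act G w X := rfl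

/-- `e_X` fixes the base coset. If `w e_X = e_X`, then `w` fixes it as well, and its stabilizer in
`W` is `annGrp G X`. -/
theorem annihilator_eq_annGrp (hP : FormPosDef G) (hX : IsAdmissible G X) :
    annihilator G X = annGrp G X := by
  refine le_antisymm (fun w hw => ?_) (annGrp_le_annihilator hP hX.1)
  have h1 := brAct_eSet hP hX (q := ((1 : W G) : W G ⧸ annGrp G X))
    (by rw [cosetSet_mk, act_one hX.1.1])
  have h2 : brAct hP (cosetSet_isAnnFamily hP hX) (toBr G w * eSet G X) (some (1 : W G)) =
      some ((1 : W G) : W G ⧸ annGrp G X) := by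
    rw [show toBr G w * eSet G X = eSet G X from hw, h1]
  rw [map_mul] at h2
  change brAct hP (cosetSet_isAnnFamily hP hX) (toBr G w)
    (brAct hP (cosetSet_isAnnFamily hP hX) (eSet G X) (some (1 : W G))) = _ at h2
  rw [h1, brAct_toBr, Option.some_inj] at h2
  have h3 : ((w * 1 : W G) : W G ⧸ annGrp G X) = (1 : W G) := h2
  rw [mul_one, QuotientGroup.eq, mul_one, inv_mem_iff] at h3
  exact h3

/-- If `w` commutes with `e_X`, then the coset of `w` is in the image of `e_X`, so `X ⊆ wX`, and the
cardinalities agree. The converse is `w e_X = e_{wX} w`. -/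
theorem centralizerN_eq_setStab (hP : FormPosDef G) (hX : IsAdmissible G X) :
    (centralizerN G X : Set (W G)) = setStab G X := by
  ext w
  constructor
  · intro hw
    have h1 := brAct_eSet hP hX (q := ((1 : W G) : W G ⧸ annGrp G X))
      (by rw [cosetSet_mk, act_one hX.1.1])
    have h2 : brAct hP (cosetSet_isAnnFamily hP hX) (eSet G X * toBr G w) (some (1 : W G)) =
        some (w • ((1 : W G) : W G ⧸ annGrp G X)) := by
      rw [show eSet G X * toBr G w = toBr G w * eSet G X from hw, map_mul]
      change brAct hP (cosetSet_isAnnFamily hP hX) (toBr G w)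
        (brAct hP (cosetSet_isAnnFamily hP hX) (eSet G X) (some (1 : W G))) = _
      rw [h1, brAct_toBr]
    rw [map_mul] at h2
    have h3 := mem_of_brAct_eSet hP hX h2
    rw [(cosetSet_isAnnFamily hP hX).smul, cosetSet_mk, act_one hX.1.1] at h3
    exact (Finset.eq_of_subset_of_card_le h3 (card_act hX.1 w).le).symm
  · intro hw
    change eSet G X * toBr G w = toBr G w * eSet G X
    rw [toBr_mul_eSet hP hX.1, show act G w X = X from hw]

end ESet


end BrauerADE

end

/-! ### Assembly of the three claims -/

theorem mainTheorem8 {ι : Type*} [Fintype ι] [DecidableEq ι] (G : SimpleGraph ι)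
    [DecidableRel G.Adj] (hG : BrauerADE.IsADE G) (X : Finset (ι → ℤ))
    (hX : BrauerADE.IsAdmissible G X) (hhigh : BrauerADE.IsHighest G X) :
    -- (i)
    ((BrauerADE.centralizerN G X : Set (BrauerADE.W G)) = BrauerADE.setStab G X) ∧
    -- (ii)
    (BrauerADE.annihilator G X ≤ BrauerADE.centralizerN G X ∧
      ((BrauerADE.annihilator G X).subgroupOf (BrauerADE.centralizerN G X)).Normal ∧
      (∃! ρ, BrauerADE.IsRho G X ρ) ∧
      (∀ ρ, BrauerADE.IsRho G X ρ →
        (BrauerADE.annihilator G X : Set (BrauerADE.W G)) = BrauerADE.kernelK G hX.1 ρ) ∧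
      BrauerADE.annihilator G X = Subgroup.closure (BrauerADE.annGens G X)) ∧
    -- (iii)
    (BrauerADE.WC G X ≤ BrauerADE.centralizerN G X ∧
      Subgroup.IsComplement'
        ((BrauerADE.annihilator G X).subgroupOf (BrauerADE.centralizerN G X))
        ((BrauerADE.WC G X).subgroupOf (BrauerADE.centralizerN G X))) := by
  have hP := BrauerADE.IsADE.formPosDef hG
  have hN := BrauerADE.centralizerN_eq_setStab hP hX
  have hA := BrauerADE.annihilator_eq_annGrp hP hX
  have hmem : ∀ w, w ∈ BrauerADE.centralizerN G X ↔ BrauerADE.act G w X = X := fun w => by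
    rw [← SetLike.mem_coe, hN]
    rfl
  have hρ := BrauerADE.existsUnique_isRho hP hX hhigh
  refine ⟨hN, ⟨fun w hw => ?_, ⟨fun a ha n => ?_⟩, hρ, fun ρ hρ => ?_, hA⟩, fun w hw => ?_, ?_⟩
  · rw [hA] at hw
    exact (hmem w).2 (BrauerADE.act_of_mem_annGrp hP hX hw)
  · rw [Subgroup.mem_subgroupOf, hA] at ha ⊢
    exact BrauerADE.conj_mem_annGrp_of_act_eq hX.1 ((hmem n).1 n.2) ha
  · rw [hA, hρ.kernelK_eq hP hX hhigh]
  · exact (hmem w).2 (BrauerADE.act_of_mem_WC hX.1 hw)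
  · obtain ⟨ρ, hρ, -⟩ := hρ
    refine Subgroup.isComplement'_of_disjoint_and_mul_eq_univ ?_ ?_
    · rw [Subgroup.disjoint_def]
      intro x hx hx'
      rw [Subgroup.mem_subgroupOf, hA] at hx
      exact Subtype.ext (hρ.eq_one_of_mem_WC hP hX hhigh hx' (hρ.apply_of_mem_annGrp hP hX hx))
    · refine Set.eq_univ_of_forall fun x => ?_
      obtain ⟨κ, hκ, c, hc, e⟩ :=
        BrauerADE.exists_mul_of_mem_setStab hP hX hhigh ((hmem x).1 x.2)
      have hκN := (hmem κ).2 (BrauerADE.act_of_mem_annGrp hP hX hκ)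
      have hcN := (hmem c).2 (BrauerADE.act_of_mem_WC hX.1 hc)
      refine ⟨⟨κ, hκN⟩, ?_, ⟨c, hcN⟩, hc, Subtype.ext e.symm⟩
      rw [SetLike.mem_coe, Subgroup.mem_subgroupOf, hA]
      exact hκ
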